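/- Let $\mathbb{T}^2=(\mathbb{R}/2\pi\mathbb{Z})^2\simeq[-\pi,\pi)^2$, $e_n(x)=\frac1{2\pi}e^{in\cdot x}$ and $\langle n\rangle=(1+|n|^2)^{1/2}$ for $n\in\mathbb{Z}^2$. Let $\mu_1$ be the massive Gaussian free field on $\mathbb{T}^2$, i.e. the law on the space $\mathcal{D}'(\mathbb{T}^2)$ of real distributions (with the $\sigma$-algebra generated by the pairings with test functions) of the random distribution $$w_0=\sum_{n\in\mathbb{Z}^2}\frac{g_n}{\langle n\rangle}e_n ,$$ where $g_n$, $n\in\mathbb{Z}^2$, are standard complex-valued Gaussian random variables, independent up to the constraint $g_{-n}=\overline{g_n}$ (so that $g_0\sim\mathcal{N}_{\mathbb{R}}(0,1)$ and, for $n\neq0$, $\operatorname{Re}g_n$ and $\operatorname{Im}g_n$ are independent with law $\mathcal{N}_{\mathbb{R}}(0,\tfrac12)$). Let $\rho:\mathbb{R}^2\to\mathbb{R}$ be a smooth, non-negative, even function, compactly supported in $[-\pi,\pi)^2$, with $\int_{\mathbb{R}^2}\rho\,dx=1$. For $N\in\mathbb{N}$ let $\mathbf{Q}_Nu=\rho_N*u$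 be the convolution on $\mathbb{T}^2$ with $\rho_N(x)=N^2\rho(Nx)$ (regarded as a function on $\mathbb{T}^2$), and put $$\sigma_N=\mathbb{E}_{\mu_1}\big[(\mathbf{Q}_Nu(x))^2\big],\qquad C_N=e^{-\frac{\beta^2}{2}\sigma_N},$$ where $\sigma_N$ does not depend on $x\in\mathbb{T}^2$. The renormalized truncated Gibbs measures are $$d\rho_{\mathrm{heat},N}(u)=Z_N^{-1}\exp\Big(-\lambda C_N\int_{\mathbb{T}^2}e^{\beta\,\mathbf{Q}_Nu(x)}\,dx\Big)d\mu_1(u),$$ where $Z_N$ is the integral of the exponential with respect to $\mu_1$. **Proposition.** Let $\lambda>0$ and let $\beta\in\mathbb{R}$ satisfy $0<\beta^2<4\pi$. Then the measures $\rho_{\mathrm{heat},N}$, $N\geq1$, are probability measures, and they converge in total variation, as $N\to\infty$, to a probability measure $\rho_{\mathrm{heat}}$ on $\mathcal{D}'(\mathbb{T}^2)$. Moreover, $\rho_{\mathrm{heat}}$ and $\mu_1$ are mutually absolutely continuous. -/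

import Mathlib

open Set Filter Topology MeasureTheory ProbabilityTheory
open scoped ContDiff ENNReal

noncomputable section

namespace ExpGibbs

/-! ### Test functions and distributions on the torus `𝕋² = (ℝ/2πℤ)²` -/

/-- The lattice vector `2πk`, for `k ∈ ℤ²`. -/
def latticeVec (k : ℤ × ℤ) : ℝ × ℝ := (2 * Real.pi * k.1, 2 * Real.pi * k.2)

/-- `C^∞(𝕋²; ℝ)`: the smooth functions on `ℝ²` that are `2π`-periodic in each variable. -/
def TestFunction : Submodule ℝ (ℝ × ℝ → ℝ) where
  carrier := {φ | ContDiff ℝ ∞ φ ∧ ∀ (x : ℝ × ℝ) (k : ℤ × ℤ), φ (x + latticeVec k) = φ x}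
  add_mem' := by
    rintro φ ψ ⟨h1, h2⟩ ⟨h3, h4⟩
    exact ⟨h1.add h3, fun x k => by simp [h2 x k, h4 x k]⟩
  zero_mem' := ⟨contDiff_const, fun _ _ => rfl⟩
  smul_mem' := by
    rintro c φ ⟨h1, h2⟩
    exact ⟨contDiff_const.smul h1, fun x k => by simp [h2 x k]⟩

/-- `𝒟'(𝕋²)`: the real distributions on the torus, that is, the linear functionals on
`C^∞(𝕋²; ℝ)` that are bounded by finitely many of the seminorms `sup |D^j φ|`. -/
structure TorusDistribution where
  /-- the pairing with test functions -/
  toLinearMap : TestFunction →ₗ[ℝ] ℝ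
  /-- continuity -/
  continuous' : ∃ (m : ℕ) (C : ℝ), ∀ (φ : TestFunction) (M : ℝ),
    (∀ j ≤ m, ∀ x : ℝ × ℝ, ‖iteratedFDeriv ℝ j (φ : ℝ × ℝ → ℝ) x‖ ≤ M) →
      |toLinearMap φ| ≤ C * M

instance : CoeFun TorusDistribution (fun _ => TestFunction → ℝ) := ⟨fun u => u.toLinearMap⟩

instance : Zero TorusDistribution := ⟨⟨0, 0, 0, fun _ _ _ => by simp⟩⟩

/-- The σ-algebra on `𝒟'(𝕋²)` generated by the pairings `u ↦ ⟨u, φ⟩`. -/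
instance : MeasurableSpace TorusDistribution :=
  ⨆ φ : TestFunction, MeasurableSpace.comap (fun u : TorusDistribution => u φ) inferInstance

/-- The fundamental domain `[-π, π)²` of the torus. -/
def cell : Set (ℝ × ℝ) := Ico (-Real.pi) Real.pi ×ˢ Ico (-Real.pi) Real.pi

/-! ### The massive Gaussian free field -/

/-- The Japanese bracket `⟨n⟩ = (1 + |n|²)^{1/2}` on `ℤ²`. -/
def bracket (n : ℤ × ℤ) : ℝ := Real.sqrt (1 + ((n.1 : ℝ) ^ 2 + (n.2 : ℝ) ^ 2))

/-- `e_n(x) = (2π)⁻¹ exp(i n·x)`. -/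
def fourierBasis (n : ℤ × ℤ) (x : ℝ × ℝ) : ℂ :=
  ((2 * Real.pi)⁻¹ : ℝ) * Complex.exp (Complex.I * ((n.1 * x.1 + n.2 * x.2 : ℝ) : ℂ))

/-- The law of a family `(ξ_n)_{n ∈ ℤ²}` of independent real `𝒩(0,1)` random variables. -/
def whiteNoiseLaw : Measure (ℤ × ℤ → ℝ) := Measure.infinitePi (fun _ => gaussianReal 0 1)

/-- The standard complex Gaussian variables `g_n`, independent up to the constraint
`g_{-n} = conj g_n`: the variable `g_0 = ξ_0` is `𝒩(0,1)`, and for `n ≠ 0`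
`Re g_n = (ξ_n + ξ_{-n})/2` and `Im g_n = (ξ_n - ξ_{-n})/2` are independent `𝒩(0,1/2)`. -/
def gaussianCoeff (n : ℤ × ℤ) (ξ : ℤ × ℤ → ℝ) : ℂ :=
  ⟨(ξ n + ξ (-n)) / 2, (ξ n - ξ (-n)) / 2⟩

/-- `u = ∑ₙ (g_n/⟨n⟩) e_n` in `𝒟'(𝕋²)`. -/
def IsFreeFieldSum (ξ : ℤ × ℤ → ℝ) (u : TorusDistribution) : Prop :=
  ∀ φ : TestFunction, HasSum
    (fun n : ℤ × ℤ => gaussianCoeff n ξ / (bracket n : ℂ) *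
      ∫ x in cell, fourierBasis n x * ((φ : ℝ × ℝ → ℝ) x : ℂ)) ((u φ : ℝ) : ℂ)

open Classical in
/-- The random distribution `w₀ = ∑ₙ (g_n/⟨n⟩) e_n`; the series converges almost surely
(`w₀ := 0` on the null set where it does not). -/
def randomField (ξ : ℤ × ℤ → ℝ) : TorusDistribution :=
  if h : ∃ u, IsFreeFieldSum ξ u then h.choose else 0

/-- The massive Gaussian free field `μ₁`, the law of `w₀`. -/
def massiveGFF : Measure TorusDistribution := whiteNoiseLaw.map randomField

/-! ### The smoothing operators `Q_N` -/

/-- A smooth, non-negative, even mollifier, compactly supported in `[-π,π)²`, of integral one. -/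
structure Mollifier where
  /-- the function `ρ` -/
  toFun : ℝ × ℝ → ℝ
  smooth : ContDiff ℝ ∞ toFun
  nonneg : ∀ x, 0 ≤ toFun x
  even : ∀ x, toFun (-x) = toFun x
  support_subset : tsupport toFun ⊆ cell
  integral_eq_one : ∫ x, toFun x = 1

/-- `ρ_N(x) = N² ρ(N x)`. -/
def Mollifier.scaled (ρ : Mollifier) (N : ℕ) (x : ℝ × ℝ) : ℝ :=
  (N : ℝ) ^ 2 * ρ.toFun ((N : ℝ) • x)

/-- The function on the torus induced by a function on `ℝ²`. -/
def periodize (f : ℝ × ℝ → ℝ) (y : ℝ × ℝ) : ℝ := ∑' k : ℤ × ℤ, f (y + latticeVec k)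

lemma periodize_mem {f : ℝ × ℝ → ℝ} (hf : ContDiff ℝ ∞ f) {R : ℝ}
    (hR : ∀ x, R < ‖x‖ → f x = 0) : periodize f ∈ TestFunction := by
  refine ⟨contDiff_iff_contDiffAt.2 fun x₀ => ?_, fun x k => ?_⟩
  · obtain ⟨m, hm⟩ := exists_nat_gt (R + (‖x₀‖ + 1))
    have key : periodize f =ᶠ[𝓝 x₀] fun x =>
        ∑ k ∈ (Finset.Icc (-(m : ℤ)) m ×ˢ Finset.Icc (-(m : ℤ)) m), f (x + latticeVec k) := by
      filter_upwards [Metric.ball_mem_nhds x₀ one_pos] with x hx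
      refine tsum_eq_sum fun k hk => hR _ ?_
      by_contra! hle
      have hx' : ‖x‖ ≤ ‖x₀‖ + 1 := by
        have h1 : ‖x - x₀‖ < 1 := by simpa [dist_eq_norm] using hx
        have h2 := norm_sub_norm_le x x₀
        linarith
      have h3 : ‖latticeVec k‖ < m := by
        have h4 : latticeVec k = (x + latticeVec k) - x := by abel
        have h5 := norm_sub_le (x + latticeVec k) x
        rw [← h4] at h5
        linarith
      have aux : ∀ a : ℤ, |2 * Real.pi * (a : ℝ)| < m → -(m : ℤ) ≤ a ∧ a ≤ m := by
        intro a ha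
        have hpi : (1 : ℝ) ≤ 2 * Real.pi := by linarith [Real.pi_gt_three]
        rw [abs_mul, abs_of_pos (by linarith : 0 < 2 * Real.pi)] at ha
        have h6 : |(a : ℝ)| < m :=
          lt_of_le_of_lt (le_mul_of_one_le_left (abs_nonneg _) hpi) ha
        have h7 := abs_lt.1 h6
        constructor
        · exact_mod_cast h7.1.le
        · exact_mod_cast h7.2.le
      have h8 : |2 * Real.pi * (k.1 : ℝ)| < m :=
        lt_of_le_of_lt (norm_fst_le (latticeVec k)) h3
      have h9 : |2 * Real.pi * (k.2 : ℝ)| < m :=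
        lt_of_le_of_lt (norm_snd_le (latticeVec k)) h3
      exact hk (by simp [Finset.mem_product, aux _ h8, aux _ h9])
    refine ContDiffAt.congr_of_eventuallyEq ?_ key
    exact (ContDiff.sum fun k _ => hf.comp (contDiff_id.add contDiff_const)).contDiffAt
  · unfold periodize
    rw [← (Equiv.addLeft k).tsum_eq (fun l : ℤ × ℤ => f (x + latticeVec l))]
    refine tsum_congr fun l => congrArg f ?_
    ext <;> simp [latticeVec] <;> ring

lemma Mollifier.kernel_mem (ρ : Mollifier) (N : ℕ) (x : ℝ × ℝ) :
    periodize (fun y => ρ.scaled N (x - y)) ∈ TestFunction := by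
  have hsm : ContDiff ℝ ∞ (fun y => ρ.scaled N (x - y)) :=
    contDiff_const.mul (ρ.smooth.comp ((contDiff_const.sub contDiff_id).const_smul (N : ℝ)))
  refine periodize_mem hsm (R := ‖x‖ + Real.pi) fun y hy => ?_
  unfold Mollifier.scaled
  rcases Nat.eq_zero_or_pos N with rfl | hN
  · simp
  have hN' : (1 : ℝ) ≤ N := by exact_mod_cast hN
  have h1 : Real.pi < ‖x - y‖ := by
    have := norm_sub_norm_le y x
    rw [norm_sub_rev] at this
    linarith
  have h2 : Real.pi < ‖(N : ℝ) • (x - y)‖ := by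
    rw [norm_smul, Real.norm_of_nonneg (by linarith)]
    exact lt_of_lt_of_le h1 (le_mul_of_one_le_left (norm_nonneg _) hN')
  rw [image_eq_zero_of_notMem_tsupport (f := ρ.toFun), mul_zero]
  intro h
  have h3 := ρ.support_subset h
  refine absurd h2 (not_lt.2 (norm_prod_le_iff.2 ⟨?_, ?_⟩))
  · exact abs_le.2 ⟨h3.1.1, h3.1.2.le⟩
  · exact abs_le.2 ⟨h3.2.1, h3.2.2.le⟩

/-- The test function `y ↦ ρ_N(x - y)` on the torus. -/
def Mollifier.kernel (ρ : Mollifier) (N : ℕ) (x : ℝ × ℝ) : TestFunction :=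
  ⟨periodize (fun y => ρ.scaled N (x - y)), ρ.kernel_mem N x⟩

/-- `(Q_N u)(x) = (ρ_N * u)(x) = ⟨u, ρ_N(x - ·)⟩`. -/
def smoothing (ρ : Mollifier) (N : ℕ) (u : TorusDistribution) (x : ℝ × ℝ) : ℝ :=
  u (ρ.kernel N x)

/-! ### The truncated Gibbs measures -/

/-- `σ_N = E_{μ₁}[(Q_N u)(x)²]`; as `μ₁` is translation invariant, this does not depend on the
point `x`, taken here to be the origin. -/
def sigma (ρ : Mollifier) (N : ℕ) : ℝ := ∫ u, (smoothing ρ N u 0) ^ 2 ∂massiveGFF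

/-- The renormalization constant `C_N = exp(-β² σ_N / 2)`. -/
def renormConst (ρ : Mollifier) (β : ℝ) (N : ℕ) : ℝ := Real.exp (-(β ^ 2 / 2) * sigma ρ N)

/-- The truncated Gibbs measure
`dρ_{heat,N} = Z_N⁻¹ exp(-λ C_N ∫_{𝕋²} exp(β Q_N u) dx) dμ₁`, where
`Z_N = ∫ exp(-λ C_N ∫_{𝕋²} exp(β Q_N u) dx) dμ₁`. -/
def truncatedGibbs (ρ : Mollifier) (lam β : ℝ) (N : ℕ) : Measure TorusDistribution :=
  massiveGFF.tilted fun u =>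
    -lam * renormConst ρ β N * ∫ x in cell, Real.exp (β * smoothing ρ N u x)

/-- The total variation distance `sup_A |μ(A) - ν(A)|`. -/
def tvDist {X : Type*} [MeasurableSpace X] (μ ν : Measure X) : ℝ≥0∞ :=
  ⨆ (A : Set X) (_ : MeasurableSet A), ENNReal.ofReal |μ.real A - ν.real A|

end ExpGibbs

end

/-!
Write `X_N = λ C_N ∫ exp(β Q_N u) dx` for the exponent of the truncated Gibbs measure. The theorem
reduces to the statement that `X_N` is a Cauchy sequence in `L²(μ₁)`: since `X_N ≥ 0` and
`t ↦ exp(-t)` is `1`-Lipschitz on `[0, ∞)`, the densities `exp(-X_N)` then converge in `L¹(μ₁)` to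
`exp(-X)`, which gives convergence in total variation (`tvDist_tilted_neg_le`), and the limiting
density is strictly positive because `X` is finite, which gives mutual absolute continuity.

Every pairing `u(φ)` is centred Gaussian with variance `cov φ φ = ∑ ⟨n⟩⁻² |φ̂(n)|²`
(`map_eval_massiveGFF`), so that
`E[X_N X_M] = λ² ∫∫ exp(β² Γ_{N,M}(x, y)) dx dy`, where `Γ_{N,M}(x, y) = E[Q_N u(x) Q_M u(y)]`
(`integrable_and_integral_interaction_mul`). It remains to see that these integrals are Cauchy in
`(N, M)` (`exists_abs_correlation_sub_le`). This follows from two facts by Hölder's inequality.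

* The functions `Γ_{N,M}` are Cauchy in `L²(𝕋² × 𝕋²)`, by orthonormality of the exponentials and
  the bound `|ρ̂_N(n) - 1| ≤ C ⟨n⟩ / N` (`integral_sq_mollCov_sub_le`).
* For every `c < 4π` the integrals `∫∫ exp(c Γ_{N,M})` are bounded uniformly in `N` and `M`
  (`integral_exp_mollCov_le`). Summing the series for the Green function of `1 - Δ` over one
  frequency gives the one-dimensional resolvent kernels
  `cosh(a(π - |s|)) / (2a sinh(πa))` with `a = √(1 + k²)`, and summing these over `k` in absolute
  value gives, with the sharp constant, the bound `(1/2π) log(1/|s|) + C` for nonnegative test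
  functions, where `s` is the difference of one coordinate (`cov_le_integral_logKernel_snd`). By
  symmetry the same holds for the other coordinate. Averaging the two bounds and applying Jensen's
  inequality bounds `∫∫ exp(c Γ_{N,M})` by the integral of
  `|x₁ - y₁|^{-c/4π} |x₂ - y₂|^{-c/4π}` (distances on the circle), which is finite exactly when
  `c < 4π`.

Neither the two-dimensional Green function nor its pointwise asymptotics are needed.
-/

noncomputable section

namespace ExpGibbs

/-! ### Periodic functions and Fourier coefficients -/

/-- The Fourier coefficient `∫ e_n φ` of a test function (with the sign convention in which the
free field pairs with `φ` as `∑ (g_n / ⟨n⟩) coeff n φ`). -/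
def coeff (n : ℤ × ℤ) (φ : TestFunction) : ℂ :=
  ∫ x in cell, fourierBasis n x * ((φ : ℝ × ℝ → ℝ) x : ℂ)

lemma contDiff_coe (φ : TestFunction) : ContDiff ℝ ∞ (φ : ℝ × ℝ → ℝ) := φ.2.1

lemma periodic_coe (φ : TestFunction) (x : ℝ × ℝ) (k : ℤ × ℤ) :
    (φ : ℝ × ℝ → ℝ) (x + latticeVec k) = (φ : ℝ × ℝ → ℝ) x := φ.2.2 x k

lemma continuous_coe (φ : TestFunction) : Continuous (φ : ℝ × ℝ → ℝ) :=
  (contDiff_coe φ).continuous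

lemma measurableSet_cell : MeasurableSet cell := measurableSet_Ico.prod measurableSet_Ico

lemma volume_restrict_cell : (volume : Measure (ℝ × ℝ)).restrict cell =
    ((volume : Measure ℝ).restrict (Ico (-Real.pi) Real.pi)).prod
      ((volume : Measure ℝ).restrict (Ico (-Real.pi) Real.pi)) := by
  rw [Measure.prod_restrict]; rfl

instance : IsFiniteMeasure ((volume : Measure (ℝ × ℝ)).restrict cell) := by
  rw [volume_restrict_cell]; infer_instance

lemma exists_add_latticeVec_mem_cell (x : ℝ × ℝ) : ∃ k, x + latticeVec k ∈ cell := by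
  have h2 : (0 : ℝ) < 2 * Real.pi := by positivity
  obtain ⟨a, ha, -⟩ := existsUnique_add_zsmul_mem_Ico h2 x.1 (-Real.pi)
  obtain ⟨b, hb, -⟩ := existsUnique_add_zsmul_mem_Ico h2 x.2 (-Real.pi)
  refine ⟨(a, b), ?_, ?_⟩
  · rw [zsmul_eq_mul, mul_comm] at ha
    convert! ha using 1
    · ring_nf
    · simp [latticeVec]
      ring
  · rw [zsmul_eq_mul, mul_comm] at hb
    convert! hb using 1
    · ring_nf
    · simp [latticeVec]
      ring

lemma cell_subset_Icc : cell ⊆ Icc (-Real.pi) Real.pi ×ˢ Icc (-Real.pi) Real.pi :=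
  prod_mono Ico_subset_Icc_self Ico_subset_Icc_self

lemma exists_bound_of_periodic {E : Type*} [NormedAddCommGroup E] {f : ℝ × ℝ → E}
    (hf : Continuous f) (hper : ∀ x k, f (x + latticeVec k) = f x) :
    ∃ M : ℝ, 0 ≤ M ∧ ∀ x, ‖f x‖ ≤ M := by
  obtain ⟨M, hM⟩ := (isCompact_Icc.prod isCompact_Icc :
    IsCompact (Icc (-Real.pi) Real.pi ×ˢ Icc (-Real.pi) Real.pi)).exists_bound_of_continuousOn
      hf.continuousOn
  have key : ∀ x, ‖f x‖ ≤ M := fun x => by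
    obtain ⟨k, hk⟩ := exists_add_latticeVec_mem_cell x
    rw [← hper x k]
    exact hM _ (cell_subset_Icc hk)
  exact ⟨M, (norm_nonneg _).trans (key 0), key⟩

lemma iteratedFDeriv_periodic {f : ℝ × ℝ → ℝ} (hper : ∀ x k, f (x + latticeVec k) = f x)
    (j : ℕ) (x : ℝ × ℝ) (k : ℤ × ℤ) :
    iteratedFDeriv ℝ j f (x + latticeVec k) = iteratedFDeriv ℝ j f x := by
  rw [← iteratedFDeriv_comp_add_right]
  simp_rw [hper]

lemma integrableOn_cell {E : Type*} [NormedAddCommGroup E] {f : ℝ × ℝ → E} (hf : Continuous f) :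
    IntegrableOn f cell :=
  (hf.continuousOn.integrableOn_compact (isCompact_Icc.prod isCompact_Icc)).mono_set
    cell_subset_Icc

lemma continuous_fourierBasis (n : ℤ × ℤ) : Continuous (fourierBasis n) := by
  unfold fourierBasis; fun_prop

lemma norm_fourierBasis (n : ℤ × ℤ) (x : ℝ × ℝ) : ‖fourierBasis n x‖ = (2 * Real.pi)⁻¹ := by
  unfold fourierBasis
  rw [mul_comm Complex.I, norm_mul, Complex.norm_exp_ofReal_mul_I, mul_one, Complex.norm_real,
    Real.norm_of_nonneg (by positivity)]

lemma one_le_bracket (n : ℤ × ℤ) : 1 ≤ bracket n := by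
  unfold bracket
  rw [Real.one_le_sqrt]
  nlinarith [sq_nonneg (n.1 : ℝ), sq_nonneg (n.2 : ℝ)]

lemma bracket_pos (n : ℤ × ℤ) : 0 < bracket n := one_pos.trans_le (one_le_bracket n)

lemma bracket_sq (n : ℤ × ℤ) : bracket n ^ 2 = 1 + ((n.1 : ℝ) ^ 2 + (n.2 : ℝ) ^ 2) := by
  unfold bracket
  rw [Real.sq_sqrt (by positivity)]

lemma bracket_neg (n : ℤ × ℤ) : bracket (-n) = bracket n := by simp [bracket]

lemma fourierBasis_periodic (n : ℤ × ℤ) (x : ℝ × ℝ) (k : ℤ × ℤ) :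
    fourierBasis n (x + latticeVec k) = fourierBasis n x := by
  unfold fourierBasis
  congr 1
  rw [Complex.exp_eq_exp_iff_exists_int]
  refine ⟨n.1 * k.1 + n.2 * k.2, ?_⟩
  simp [latticeVec]
  ring

/-- Integration by parts in the second variable. -/
lemma integral_cell_deriv_snd {f g : ℝ × ℝ → ℂ} (c : ℂ) (hf : Continuous f) (hg : Continuous g)
    {g' : ℝ × ℝ → ℂ} (hg' : Continuous g')
    (hfd : ∀ x, HasDerivAt (fun t => f (x.1, t)) (c * f x) x.2)
    (hgd : ∀ x, HasDerivAt (fun t => g (x.1, t)) (g' x) x.2)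
    (hfp : ∀ x k, f (x + latticeVec k) = f x) (hgp : ∀ x k, g (x + latticeVec k) = g x) :
    ∫ x in cell, f x * g' x = -c * ∫ x in cell, f x * g x := by
  have hpi : -Real.pi ≤ Real.pi := by linarith [Real.pi_pos]
  have e1 : ∀ h : ℝ × ℝ → ℂ, Continuous h → ∫ x in cell, h x =
      ∫ s in Ico (-Real.pi) Real.pi, ∫ t in (-Real.pi)..Real.pi, h (s, t) := by
    intro h hh
    rw [volume_restrict_cell, integral_prod]
    · simp_rw [intervalIntegral.integral_of_le hpi, integral_Ico_eq_integral_Ioc]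
    · rw [← volume_restrict_cell]; exact integrableOn_cell hh
  rw [e1 (fun x => f x * g' x) (hf.mul hg'), e1 (fun x => f x * g x) (hf.mul hg),
    ← integral_const_mul]
  refine integral_congr_ae (Eventually.of_forall fun s => ?_)
  have hc : ∀ h : ℝ × ℝ → ℂ, Continuous h → Continuous fun t => h (s, t) := fun h hh => by fun_prop
  have := intervalIntegral.integral_mul_deriv_eq_deriv_mul (a := -Real.pi) (b := Real.pi)
    (u := fun t => f (s, t)) (v := fun t => g (s, t)) (u' := fun t => c * f (s, t))
    (v' := fun t => g' (s, t)) (fun t _ => hfd (s, t)) (fun t _ => hgd (s, t))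
    ((continuous_const.mul (hc f hf)).intervalIntegrable _ _) ((hc g' hg').intervalIntegrable _ _)
  have hs : ((s, Real.pi) : ℝ × ℝ) = (s, -Real.pi) + latticeVec (0, 1) := by
    ext <;> simp [latticeVec]
    ring
  simp only [this, hs, hfp, hgp, sub_self, zero_sub, mul_assoc, intervalIntegral.integral_const_mul,
    neg_mul]

/-- Exchange of the two coordinates of a test function. -/
def swapTest (φ : TestFunction) : TestFunction :=
  ⟨fun x => (φ : ℝ × ℝ → ℝ) x.swap, (contDiff_coe φ).comp (contDiff_snd.prodMk contDiff_fst),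
    fun x k => periodic_coe φ x.swap k.swap⟩

lemma integral_cell_swap {E : Type*} [NormedAddCommGroup E] [NormedSpace ℝ E] (f : ℝ × ℝ → E) :
    ∫ x in cell, f x.swap = ∫ x in cell, f x := by
  rw [volume_restrict_cell, integral_prod_swap]

lemma coeff_swapTest (n : ℤ × ℤ) (φ : TestFunction) :
    coeff n (swapTest φ) = coeff n.swap φ := by
  unfold coeff
  rw [← integral_cell_swap]
  refine integral_congr_ae (Eventually.of_forall fun x => ?_)
  simp [swapTest, fourierBasis, add_comm]

/-- The partial derivative of a test function in the second variable. -/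
def partialSnd (φ : TestFunction) : TestFunction :=
  ⟨fun x => fderiv ℝ (φ : ℝ × ℝ → ℝ) x (0, 1), by
    refine ⟨?_, fun x k => ?_⟩
    · exact ((contDiff_coe φ).fderiv_right (m := ∞) le_rfl).clm_apply contDiff_const
    · change fderiv ℝ (φ : ℝ × ℝ → ℝ) (x + latticeVec k) (0, 1) = fderiv ℝ (φ : ℝ × ℝ → ℝ) x (0, 1)
      rw [← fderiv_comp_add_right]
      simp_rw [periodic_coe φ]⟩

lemma hasDerivAt_partialSnd (φ : TestFunction) (x : ℝ × ℝ) :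
    HasDerivAt (fun t => (φ : ℝ × ℝ → ℝ) (x.1, t)) ((partialSnd φ : ℝ × ℝ → ℝ) x) x.2 := by
  have h1 : HasFDerivAt (φ : ℝ × ℝ → ℝ) (fderiv ℝ (φ : ℝ × ℝ → ℝ) x) (x.1, x.2) :=
    ((contDiff_coe φ).differentiable (by simp) x).hasFDerivAt
  have h2 : HasDerivAt (fun t : ℝ => (x.1, t)) ((0, 1) : ℝ × ℝ) x.2 :=
    (hasDerivAt_const _ _).prodMk (hasDerivAt_id _)
  exact h1.comp_hasDerivAt _ h2

lemma hasDerivAt_fourierBasis_snd (n : ℤ × ℤ) (x : ℝ × ℝ) :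
    HasDerivAt (fun t => fourierBasis n (x.1, t)) (Complex.I * n.2 * fourierBasis n x) x.2 := by
  unfold fourierBasis
  have h1 : HasDerivAt (fun t : ℝ => n.1 * x.1 + n.2 * t) ((n.2 : ℝ) * 1) x.2 :=
    ((hasDerivAt_id x.2).const_mul (n.2 : ℝ)).const_add (n.1 * x.1)
  have h2 := ((h1.ofReal_comp.const_mul Complex.I).cexp).const_mul (((2 * Real.pi)⁻¹ : ℝ) : ℂ)
  convert! h2 using 1
  push_cast; ring

lemma coeff_partialSnd (n : ℤ × ℤ) (φ : TestFunction) :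
    coeff n (partialSnd φ) = -(Complex.I * n.2) * coeff n φ :=
  integral_cell_deriv_snd _ (continuous_fourierBasis n)
    (Complex.continuous_ofReal.comp (continuous_coe φ))
    (Complex.continuous_ofReal.comp (continuous_coe (partialSnd φ)))
    (hasDerivAt_fourierBasis_snd n) (fun x => (hasDerivAt_partialSnd φ x).ofReal_comp)
    (fourierBasis_periodic n) (fun x k => by simp [periodic_coe φ])

lemma norm_coeff_le (n : ℤ × ℤ) (φ : TestFunction) {M : ℝ}
    (hM : ∀ x, |(φ : ℝ × ℝ → ℝ) x| ≤ M) : ‖coeff n φ‖ ≤ 2 * Real.pi * M := by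
  have h := norm_setIntegral_le_of_norm_le_const (μ := volume) (s := cell)
    (f := fun x => fourierBasis n x * ((φ : ℝ × ℝ → ℝ) x : ℂ)) (C := (2 * Real.pi)⁻¹ * M)
    (measure_lt_top_of_subset cell_subset_Icc
      (isCompact_Icc.prod isCompact_Icc).measure_lt_top.ne) (fun x _ => by
      rw [norm_mul, norm_fourierBasis, Complex.norm_real]
      exact mul_le_mul_of_nonneg_left (hM x) (by positivity))
  refine h.trans (le_of_eq ?_)
  have : volume.real cell = (2 * Real.pi) * (2 * Real.pi) := by
    rw [measureReal_def, cell, Measure.volume_eq_prod, Measure.prod_prod, Real.volume_Ico,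
      ENNReal.toReal_mul, ENNReal.toReal_ofReal (by linarith [Real.pi_pos])]
    ring
  rw [this]
  field_simp

lemma abs_partialSnd_partialSnd_le (φ : TestFunction) (x : ℝ × ℝ) :
    |(partialSnd (partialSnd φ) : ℝ × ℝ → ℝ) x| ≤ ‖iteratedFDeriv ℝ 2 (φ : ℝ × ℝ → ℝ) x‖ := by
  have h1 : DifferentiableAt ℝ (fderiv ℝ (φ : ℝ × ℝ → ℝ)) x :=
    ((contDiff_coe φ).fderiv_right (m := ∞) le_rfl).differentiable (by simp) x
  have h2 : (partialSnd (partialSnd φ) : ℝ × ℝ → ℝ) x =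
      iteratedFDeriv ℝ 2 (φ : ℝ × ℝ → ℝ) x ![(0, 1), (0, 1)] := by
    rw [iteratedFDeriv_two_apply]
    change fderiv ℝ (fun y => fderiv ℝ (φ : ℝ × ℝ → ℝ) y (0, 1)) x (0, 1) = _
    rw [fderiv_clm_apply h1 (differentiableAt_const _)]
    simp
  rw [h2, ← Real.norm_eq_abs]
  refine (ContinuousMultilinearMap.le_opNorm _ _).trans ?_
  simp [Prod.norm_def]

lemma sq_mul_norm_coeff_le (n : ℤ × ℤ) (φ : TestFunction) {M : ℝ}
    (hM : ∀ x, ‖iteratedFDeriv ℝ 2 (φ : ℝ × ℝ → ℝ) x‖ ≤ M) :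
    (n.2 : ℝ) ^ 2 * ‖coeff n φ‖ ≤ 2 * Real.pi * M := by
  have := norm_coeff_le n (partialSnd (partialSnd φ)) (M := M)
    fun x => (abs_partialSnd_partialSnd_le φ x).trans (hM x)
  rw [coeff_partialSnd, coeff_partialSnd] at this
  convert this using 1
  simp only [norm_mul, norm_neg, Complex.norm_I, one_mul, Complex.norm_intCast]
  rw [← mul_assoc, ← sq, sq_abs]

lemma norm_iteratedFDeriv_swapTest (φ : TestFunction) (j : ℕ) (x : ℝ × ℝ) :
    ‖iteratedFDeriv ℝ j (swapTest φ : ℝ × ℝ → ℝ) x‖ =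
      ‖iteratedFDeriv ℝ j (φ : ℝ × ℝ → ℝ) x.swap‖ := by
  let e : (ℝ × ℝ) ≃ₗᵢ[ℝ] (ℝ × ℝ) :=
    { LinearEquiv.prodComm ℝ ℝ ℝ with norm_map' := fun x => by simp [Prod.norm_def, max_comm] }
  exact e.norm_iteratedFDeriv_comp_right (φ : ℝ × ℝ → ℝ) x j

/-- Fourier coefficients of a test function decay like `⟨n⟩⁻²`, by two integrations by parts. -/
lemma norm_coeff_le_div_bracket_sq (n : ℤ × ℤ) (φ : TestFunction) {M : ℝ}
    (hM : ∀ j ≤ 2, ∀ x, ‖iteratedFDeriv ℝ j (φ : ℝ × ℝ → ℝ) x‖ ≤ M) :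
    ‖coeff n φ‖ ≤ 6 * Real.pi * M / bracket n ^ 2 := by
  have h0 := norm_coeff_le n φ (M := M) fun x => by simpa using hM 0 (by simp) x
  have h1 := sq_mul_norm_coeff_le n φ (M := M) fun x => hM 2 le_rfl x
  have h2 := sq_mul_norm_coeff_le n.swap (swapTest φ) (M := M) fun x => by
    rw [norm_iteratedFDeriv_swapTest]; exact hM 2 le_rfl _
  rw [coeff_swapTest, Prod.swap_swap, Prod.snd_swap] at h2
  rw [le_div_iff₀ (by have := bracket_pos n; positivity), bracket_sq]
  linarith

lemma exists_iteratedFDeriv_bound (φ : TestFunction) (m : ℕ) :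
    ∃ M : ℝ, 0 ≤ M ∧ ∀ j ≤ m, ∀ x, ‖iteratedFDeriv ℝ j (φ : ℝ × ℝ → ℝ) x‖ ≤ M := by
  choose M hM0 hM using fun j : ℕ => exists_bound_of_periodic
    ((contDiff_coe φ).continuous_iteratedFDeriv (m := j) (by exact_mod_cast le_top))
    (iteratedFDeriv_periodic (periodic_coe φ) j)
  refine ⟨∑ j ∈ Finset.range (m + 1), M j, Finset.sum_nonneg fun j _ => hM0 j, fun j hj x => ?_⟩
  exact (hM j x).trans (Finset.single_le_sum (fun i _ => hM0 i) (Finset.mem_range.2 (by omega)))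

lemma exists_coeff_decay (φ : TestFunction) :
    ∃ C : ℝ, 0 ≤ C ∧ ∀ n, ‖coeff n φ‖ ≤ C / bracket n ^ 2 := by
  obtain ⟨M, hM0, hM⟩ := exists_iteratedFDeriv_bound φ 2
  exact ⟨6 * Real.pi * M, by positivity, fun n => norm_coeff_le_div_bracket_sq n φ hM⟩

lemma summable_inv_bracket_pow_three : Summable fun n : ℤ × ℤ => 1 / bracket n ^ 3 := by
  have h1 : Summable fun n : ℤ => (1 + (n : ℝ) ^ 2) ^ (-(3 / 4) : ℝ) := by
    refine Summable.of_norm_bounded_eventually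
      (g := fun n : ℤ => |(n : ℝ)| ^ (-(3 / 2) : ℝ))
      (Real.summable_abs_int_rpow (by norm_num)) ?_
    filter_upwards [(finite_singleton (0 : ℤ)).compl_mem_cofinite] with n hn
    have hn' : 0 < |(n : ℝ)| := abs_pos.2 (by exact_mod_cast hn)
    rw [Real.norm_of_nonneg (by positivity)]
    have : |(n : ℝ)| ^ (-(3 / 2) : ℝ) = (|(n : ℝ)| ^ 2) ^ (-(3 / 4) : ℝ) := by
      rw [← Real.rpow_natCast, ← Real.rpow_mul hn'.le]; norm_num
    rw [this]
    refine Real.rpow_le_rpow_of_nonpos (by positivity) ?_ (by norm_num)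
    rw [sq_abs]; linarith
  have h2 := h1.mul_of_nonneg h1 (fun n => by positivity) (fun n => by positivity)
  refine Summable.of_nonneg_of_le (fun n => by have := bracket_pos n; positivity) (fun n => ?_) h2
  have hb : 1 / bracket n ^ 3 = (bracket n ^ 2 * bracket n ^ 2) ^ (-(3 / 4) : ℝ) := by
    rw [← pow_add, ← Real.rpow_natCast (bracket n) (2 + 2), ← Real.rpow_mul (bracket_pos n).le,
      one_div, ← Real.rpow_natCast (bracket n) 3, ← Real.rpow_neg (bracket_pos n).le]
    norm_num
  rw [hb, ← Real.mul_rpow (by positivity) (by positivity)]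
  refine Real.rpow_le_rpow_of_nonpos (by positivity) ?_ (by norm_num)
  rw [bracket_sq]
  refine mul_le_mul ?_ ?_ (by positivity) (by positivity) <;>
    nlinarith [sq_nonneg (n.1 : ℝ), sq_nonneg (n.2 : ℝ)]

lemma summable_inv_bracket_pow_four : Summable fun n : ℤ × ℤ => 1 / bracket n ^ 4 := by
  refine Summable.of_nonneg_of_le (fun n => by have := bracket_pos n; positivity) (fun n => ?_)
    summable_inv_bracket_pow_three
  have := bracket_pos n
  exact one_div_le_one_div_of_le (by positivity)
    (pow_le_pow_right₀ (one_le_bracket n) (by norm_num))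

/-! ### The free field as a Gaussian family -/

lemma coeff_neg (n : ℤ × ℤ) (φ : TestFunction) :
    coeff (-n) φ = (starRingEnd ℂ) (coeff n φ) := by
  unfold coeff
  rw [← integral_conj]
  refine integral_congr_ae (Eventually.of_forall fun x => ?_)
  simp only [map_mul, Complex.conj_ofReal, fourierBasis, ← Complex.exp_conj, Complex.conj_I]
  congr 3
  push_cast [Prod.fst_neg, Prod.snd_neg]
  ring

lemma coeff_add (n : ℤ × ℤ) (φ ψ : TestFunction) :
    coeff n (φ + ψ) = coeff n φ + coeff n ψ := by
  unfold coeff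
  rw [← integral_add]
  · simp [mul_add]
  · exact integrableOn_cell ((continuous_fourierBasis n).mul
      (Complex.continuous_ofReal.comp (continuous_coe φ)))
  · exact integrableOn_cell ((continuous_fourierBasis n).mul
      (Complex.continuous_ofReal.comp (continuous_coe ψ)))

lemma coeff_smul (n : ℤ × ℤ) (c : ℝ) (φ : TestFunction) :
    coeff n (c • φ) = c * coeff n φ := by
  unfold coeff
  rw [← integral_const_mul]
  refine integral_congr_ae (Eventually.of_forall fun x => ?_)
  simp; ring

/-- The covariance `E[u(φ) u(ψ)] = ∑ₙ ⟨n⟩⁻² φ̂(n) conj ψ̂(n)` of the massive free field. -/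
def cov (φ ψ : TestFunction) : ℝ :=
  ∑' n : ℤ × ℤ, (coeff n φ * (starRingEnd ℂ) (coeff n ψ)).re / bracket n ^ 2

lemma summable_norm_coeff_mul (φ ψ : TestFunction) :
    Summable fun n : ℤ × ℤ => ‖coeff n φ‖ * ‖coeff n ψ‖ / bracket n ^ 2 := by
  obtain ⟨C, hC0, hC⟩ := exists_coeff_decay φ
  obtain ⟨D, hD0, hD⟩ := exists_coeff_decay ψ
  refine Summable.of_nonneg_of_le (fun n => by have := bracket_pos n; positivity) (fun n => ?_)
    (summable_inv_bracket_pow_four.mul_left (C * D))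
  have hb := bracket_pos n
  have h1 : ‖coeff n φ‖ * ‖coeff n ψ‖ ≤ C * D / bracket n ^ 4 := by
    refine (mul_le_mul (hC n) (hD n) (norm_nonneg _) (by positivity)).trans (le_of_eq ?_)
    field_simp
  calc _ ≤ ‖coeff n φ‖ * ‖coeff n ψ‖ :=
        div_le_self (by positivity) (one_le_pow₀ (one_le_bracket n))
    _ ≤ _ := h1.trans (le_of_eq (by field_simp))

lemma summable_cov (φ ψ : TestFunction) : Summable fun n : ℤ × ℤ =>
    (coeff n φ * (starRingEnd ℂ) (coeff n ψ)).re / bracket n ^ 2 := by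
  refine Summable.of_norm_bounded (summable_norm_coeff_mul φ ψ) fun n => ?_
  have hb := bracket_pos n
  rw [norm_div, Real.norm_of_nonneg (by positivity : 0 ≤ bracket n ^ 2)]
  gcongr
  refine (Complex.abs_re_le_norm _).trans (le_of_eq ?_)
  rw [norm_mul, Complex.norm_conj]

lemma cov_add_self (φ ψ : TestFunction) :
    cov (φ + ψ) (φ + ψ) = cov φ φ + cov ψ ψ + 2 * cov φ ψ := by
  unfold cov
  rw [← tsum_mul_left, ← (summable_cov φ φ).tsum_add (summable_cov ψ ψ),
    ← ((summable_cov φ φ).add (summable_cov ψ ψ)).tsum_add ((summable_cov φ ψ).mul_left 2)]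
  refine tsum_congr fun n => ?_
  simp only [coeff_add, map_add, Complex.mul_re, Complex.add_re, Complex.add_im, Complex.conj_re,
    Complex.conj_im]
  ring

lemma cov_self_nonneg (φ : TestFunction) : 0 ≤ cov φ φ :=
  tsum_nonneg fun n => by
    rw [Complex.mul_conj, Complex.ofReal_re]
    exact div_nonneg (Complex.normSq_nonneg _) (sq_nonneg _)

/-- The noise configurations `ξ` with `∑ |ξ_n| ⟨n⟩⁻³ < ∞`. For these the series defining the free
field converges absolutely against every test function. -/
def goodNoise : Set (ℤ × ℤ → ℝ) :=
  {ξ | ∑' n, ENNReal.ofReal (|ξ n| / bracket n ^ 3) ≠ ⊤}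

lemma measurableSet_goodNoise : MeasurableSet goodNoise :=
  (measurableSet_singleton ⊤).compl.preimage (by fun_prop)

instance : IsProbabilityMeasure whiteNoiseLaw := by unfold whiteNoiseLaw; infer_instance

/-- `E ∑ |ξ_n| ⟨n⟩⁻³ < ∞`, as `∑ ⟨n⟩⁻³` converges in dimension two. -/
lemma ae_mem_goodNoise : ∀ᵐ ξ ∂whiteNoiseLaw, ξ ∈ goodNoise := by
  have hm : ∀ n : ℤ × ℤ, Measurable fun ξ : ℤ × ℤ → ℝ =>
      ENNReal.ofReal (|ξ n| / bracket n ^ 3) := fun n => by fun_prop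
  have hK : ∫⁻ x, ENNReal.ofReal |x| ∂(gaussianReal 0 1) ≠ ⊤ := by
    have h := (memLp_id_gaussianReal (μ := 0) (v := 1) 1).integrable (by simp)
    have h2 := h.2
    simp only [HasFiniteIntegral, id, ← ofReal_norm, Real.norm_eq_abs] at h2
    exact h2.ne
  have key : ∫⁻ ξ, ∑' n, ENNReal.ofReal (|ξ n| / bracket n ^ 3) ∂whiteNoiseLaw ≠ ⊤ := by
    rw [lintegral_tsum fun n => (hm n).aemeasurable]
    have : ∀ n : ℤ × ℤ, ∫⁻ ξ, ENNReal.ofReal (|ξ n| / bracket n ^ 3) ∂whiteNoiseLaw =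
        ENNReal.ofReal (1 / bracket n ^ 3) * ∫⁻ x, ENNReal.ofReal |x| ∂(gaussianReal 0 1) := by
      intro n
      have hmp : MeasurePreserving (Function.eval n) whiteNoiseLaw (gaussianReal 0 1) :=
        measurePreserving_eval_infinitePi (fun _ => gaussianReal 0 1) n
      rw [← hmp.lintegral_comp (by fun_prop : Measurable fun x : ℝ => ENNReal.ofReal |x|),
        ← lintegral_const_mul _ (by fun_prop)]
      refine lintegral_congr fun ξ => ?_
      rw [← ENNReal.ofReal_mul (by have := bracket_pos n; positivity)]
      congr 1
      simp only [Function.eval]; ring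
    simp_rw [this]
    rw [ENNReal.tsum_mul_right]
    exact ENNReal.mul_ne_top summable_inv_bracket_pow_three.tsum_ofReal_ne_top hK
  filter_upwards [ae_lt_top (by fun_prop) key] with ξ hξ
  exact hξ.ne

lemma summable_of_mem_goodNoise {ξ : ℤ × ℤ → ℝ} (hξ : ξ ∈ goodNoise) :
    Summable fun n => |ξ n| / bracket n ^ 3 := by
  have h := ENNReal.summable_toReal (mem_ofPred.1 hξ)
  refine h.congr fun n => ?_
  rw [ENNReal.toReal_ofReal (by have := bracket_pos n; positivity)]

lemma summable_neg_of_mem_goodNoise {ξ : ℤ × ℤ → ℝ} (hξ : ξ ∈ goodNoise) :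
    Summable fun n => |ξ (-n)| / bracket n ^ 3 := by
  have h := (Equiv.neg (ℤ × ℤ)).summable_iff.2 (summable_of_mem_goodNoise hξ)
  refine h.congr fun n => ?_
  simp [bracket_neg]

lemma norm_gaussianCoeff_le (n : ℤ × ℤ) (ξ : ℤ × ℤ → ℝ) :
    ‖gaussianCoeff n ξ‖ ≤ |ξ n| + |ξ (-n)| := by
  refine (Complex.norm_le_abs_re_add_abs_im _).trans ?_
  have h1 := abs_add_le (ξ n) (ξ (-n))
  have h2 := abs_sub (ξ n) (ξ (-n))
  simp only [gaussianCoeff, abs_div, abs_two]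
  linarith

/-- The terms of the series `∑ (g_n/⟨n⟩) ⟨e_n, φ⟩`. -/
def fieldTerm (ξ : ℤ × ℤ → ℝ) (φ : TestFunction) (n : ℤ × ℤ) : ℂ :=
  gaussianCoeff n ξ / (bracket n : ℂ) * coeff n φ

lemma norm_fieldTerm_le (ξ : ℤ × ℤ → ℝ) (φ : TestFunction) {C : ℝ} {n : ℤ × ℤ}
    (hC : ‖coeff n φ‖ ≤ C / bracket n ^ 2) :
    ‖fieldTerm ξ φ n‖ ≤ C * (|ξ n| / bracket n ^ 3 + |ξ (-n)| / bracket n ^ 3) := by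
  have hb := bracket_pos n
  rw [fieldTerm, norm_mul, norm_div, Complex.norm_real, Real.norm_of_nonneg hb.le]
  refine (mul_le_mul (div_le_div_of_nonneg_right (norm_gaussianCoeff_le n ξ) hb.le) hC
    (norm_nonneg _) (by positivity)).trans (le_of_eq ?_)
  field_simp

lemma summable_fieldTerm {ξ : ℤ × ℤ → ℝ} (hξ : ξ ∈ goodNoise) (φ : TestFunction) :
    Summable (fieldTerm ξ φ) := by
  obtain ⟨C, hC0, hC⟩ := exists_coeff_decay φ
  exact Summable.of_norm_bounded (((summable_of_mem_goodNoise hξ).add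
    (summable_neg_of_mem_goodNoise hξ)).mul_left C) fun n => norm_fieldTerm_le ξ φ (hC n)

lemma fieldTerm_neg (ξ : ℤ × ℤ → ℝ) (φ : TestFunction) (n : ℤ × ℤ) :
    fieldTerm ξ φ (-n) = (starRingEnd ℂ) (fieldTerm ξ φ n) := by
  have h : gaussianCoeff (-n) ξ = (starRingEnd ℂ) (gaussianCoeff n ξ) := by
    apply Complex.ext <;> simp [gaussianCoeff] <;> ring
  simp [fieldTerm, coeff_neg, bracket_neg, h]

lemma ofReal_re_tsum_fieldTerm (ξ : ℤ × ℤ → ℝ) (φ : TestFunction) :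
    (((∑' n, fieldTerm ξ φ n).re : ℝ) : ℂ) = ∑' n, fieldTerm ξ φ n := by
  rw [← Complex.conj_eq_iff_re, Complex.conj_tsum, ← (Equiv.neg (ℤ × ℤ)).tsum_eq]
  exact tsum_congr fun n => by simp [fieldTerm_neg]

/-- For good noise the series converges to a distribution of order two, because the Fourier
coefficients of a test function decay like `⟨n⟩⁻²`. -/
lemma exists_isFreeFieldSum {ξ : ℤ × ℤ → ℝ} (hξ : ξ ∈ goodNoise) :
    ∃ u, IsFreeFieldSum ξ u := by
  have hs := summable_fieldTerm hξ
  refine ⟨⟨{ toFun := fun φ => (∑' n, fieldTerm ξ φ n).re, map_add' := fun φ ψ => ?_,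
              map_smul' := fun c φ => ?_ }, 2,
    6 * Real.pi * ∑' n, (|ξ n| / bracket n ^ 3 + |ξ (-n)| / bracket n ^ 3), fun φ M hM => ?_⟩,
    fun φ => ?_⟩
  · rw [← Complex.add_re, ← (hs φ).tsum_add (hs ψ)]
    simp only [fieldTerm, coeff_add, mul_add]
  · rw [RingHom.id_apply, smul_eq_mul, ← Complex.re_ofReal_mul, ← tsum_mul_left]
    simp only [fieldTerm, coeff_smul]
    congr 1
    exact tsum_congr fun n => by ring
  · have hsum := (summable_of_mem_goodNoise hξ).add (summable_neg_of_mem_goodNoise hξ)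
    refine (Complex.abs_re_le_norm _).trans ?_
    refine (tsum_of_norm_bounded ((hsum.mul_left (6 * Real.pi * M)).hasSum) fun n =>
      norm_fieldTerm_le ξ φ (norm_coeff_le_div_bracket_sq n φ hM)).trans (le_of_eq ?_)
    rw [tsum_mul_left]; ring
  · change HasSum (fieldTerm ξ φ) (((∑' n, fieldTerm ξ φ n).re : ℝ) : ℂ)
    rw [ofReal_re_tsum_fieldTerm ξ]
    exact (hs φ).hasSum

lemma isFreeFieldSum_randomField {ξ : ℤ × ℤ → ℝ} (hξ : ξ ∈ goodNoise) :
    IsFreeFieldSum ξ (randomField ξ) := by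
  have h := exists_isFreeFieldSum hξ
  rw [randomField, dif_pos h]
  exact h.choose_spec

/-- The coefficient of `ξ_n` in the expansion of `u(φ)` in terms of the independent real noise. -/
def noiseCoeff (φ : TestFunction) (n : ℤ × ℤ) : ℝ :=
  ((coeff n φ).re - (coeff n φ).im) / bracket n

/-- The expansion of `u(φ)` in the independent variables `ξ_n`, obtained by grouping the terms `n`
and `-n` of the complex series. -/
lemma hasSum_randomField {ξ : ℤ × ℤ → ℝ} (hξ : ξ ∈ goodNoise) (φ : TestFunction) :
    HasSum (fun n => noiseCoeff φ n * ξ n) (randomField ξ φ) := by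
  -- The real part of the `n`-th term is `a n + a (-n)`; summing over `n` gives `2 ∑ a`.
  set a : ℤ × ℤ → ℝ := fun n => noiseCoeff φ n * ξ n / 2 with ha
  have h1 : ∀ n, (fieldTerm ξ φ n).re = a n + a (-n) := by
    intro n
    have : fieldTerm ξ φ n = ((bracket n)⁻¹ : ℝ) * (gaussianCoeff n ξ * coeff n φ) := by
      rw [fieldTerm, Complex.ofReal_inv]; ring
    rw [this, Complex.re_ofReal_mul, Complex.mul_re]
    simp only [ha, noiseCoeff, gaussianCoeff, coeff_neg, bracket_neg, Complex.conj_re,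
      Complex.conj_im]
    ring
  obtain ⟨C, hC0, hC⟩ := exists_coeff_decay φ
  have h2 : Summable a := by
    refine Summable.of_norm_bounded ((summable_of_mem_goodNoise hξ).mul_left C) fun n => ?_
    have hb := bracket_pos n
    have h3 : |(coeff n φ).re - (coeff n φ).im| ≤ 2 * (C / bracket n ^ 2) := by
      refine (abs_sub _ _).trans ?_
      linarith [Complex.abs_re_le_norm (coeff n φ), Complex.abs_im_le_norm (coeff n φ), hC n]
    simp only [ha, noiseCoeff, norm_div, norm_mul, Real.norm_eq_abs, abs_two, abs_of_pos hb]
    calc _ ≤ 2 * (C / bracket n ^ 2) / bracket n * |ξ n| / 2 := by gcongr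
      _ = _ := by field_simp
  have h3 := Complex.hasSum_re (isFreeFieldSum_randomField hξ φ)
  rw [Complex.ofReal_re] at h3
  change HasSum (fun n => (fieldTerm ξ φ n).re) _ at h3
  simp_rw [h1] at h3
  have h4 : HasSum (fun n => a (-n)) (∑' n, a n) := (Equiv.neg (ℤ × ℤ)).hasSum_iff.2 h2.hasSum
  rw [h3.unique (h2.hasSum.add h4)]
  convert! h2.hasSum.add h2.hasSum using 2 with n
  simp only [ha]; ring

lemma hasSum_noiseCoeff_sq (φ : TestFunction) :
    HasSum (fun n => noiseCoeff φ n ^ 2) (cov φ φ) := by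
  -- The cross term `-2 Re Im / ⟨n⟩²` is odd in `n`, so its sum vanishes.
  have h1 := (summable_cov φ φ).hasSum
  set b : ℤ × ℤ → ℝ := fun n => (coeff n φ).re * (coeff n φ).im / bracket n ^ 2 with hb
  have h2 : Summable b := by
    refine Summable.of_norm_bounded (summable_norm_coeff_mul φ φ) fun n => ?_
    have := bracket_pos n
    simp only [hb, norm_div, norm_mul, Real.norm_of_nonneg (by positivity : 0 ≤ bracket n ^ 2)]
    gcongr
    · exact Complex.abs_re_le_norm _
    · exact Complex.abs_im_le_norm _
  have h3 : ∑' n, b n = 0 := by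
    have h4 : ∑' n, b n = ∑' n, -b n := by
      rw [← (Equiv.neg (ℤ × ℤ)).tsum_eq]
      refine tsum_congr fun n => ?_
      simp only [hb, Equiv.neg_apply, coeff_neg, bracket_neg, Complex.conj_re, Complex.conj_im]
      ring
    rw [tsum_neg] at h4
    linarith
  have h5 := h1.sub (h2.hasSum.mul_left 2)
  rw [h3, mul_zero, sub_zero] at h5
  convert! h5 using 2 with n
  simp only [noiseCoeff, hb, Complex.mul_re, Complex.conj_re, Complex.conj_im]
  ring

@[fun_prop]
lemma measurable_eval (φ : TestFunction) : Measurable fun u : TorusDistribution => u φ :=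
  (comap_measurable _).mono (le_iSup (fun φ : TestFunction =>
    MeasurableSpace.comap (fun u : TorusDistribution => u φ) inferInstance) φ) le_rfl

lemma measurable_torusDistribution_iff {Ω : Type*} [MeasurableSpace Ω]
    {f : Ω → TorusDistribution} : Measurable f ↔ ∀ φ, Measurable fun a => f a φ := by
  refine ⟨fun h φ => (measurable_eval φ).comp h, fun h => ?_⟩
  rw [measurable_iff_comap_le, instMeasurableSpaceTorusDistribution, MeasurableSpace.comap_iSup]
  refine iSup_le fun φ => ?_
  rw [MeasurableSpace.comap_comp]
  exact measurable_iff_comap_le.1 (h φ)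

open Classical in
/-- On the measurable set of good noise, pairings of the random field are limits of finite sums. -/
lemma aemeasurable_randomField : AEMeasurable randomField whiteNoiseLaw := by
  refine ⟨fun ξ => if ξ ∈ goodNoise then randomField ξ else 0, ?_, ?_⟩
  · refine measurable_torusDistribution_iff.2 fun φ => ?_
    refine measurable_of_tendsto_metrizable' (atTop : Filter (Finset (ℤ × ℤ)))
      (f := fun s => goodNoise.indicator fun ξ => ∑ n ∈ s, noiseCoeff φ n * ξ n)
      (fun s => Measurable.indicator (by fun_prop) measurableSet_goodNoise) ?_
    refine tendsto_pi_nhds.2 fun ξ => ?_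
    by_cases hξ : ξ ∈ goodNoise
    · simp only [hξ, indicator_of_mem, if_true]
      exact hasSum_randomField hξ φ
    · simp only [hξ, not_false_eq_true, indicator_of_notMem, if_false]
      exact tendsto_const_nhds
  · filter_upwards [ae_mem_goodNoise] with ξ hξ
    simp [hξ]

instance : IsProbabilityMeasure massiveGFF :=
  Measure.isProbabilityMeasure_map aemeasurable_randomField

lemma charFun_noise_sum (d : ℤ × ℤ → ℝ) (s : Finset (ℤ × ℤ)) (t : ℝ) :
    ∫ ξ, Complex.exp (t * (∑ n ∈ s, d n * ξ n : ℝ) * Complex.I) ∂whiteNoiseLaw =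
      Complex.exp (-((∑ n ∈ s, d n ^ 2 : ℝ) * t ^ 2 / 2)) := by
  have hind : iIndepFun (fun (n : ℤ × ℤ) (ξ : ℤ × ℤ → ℝ) => d n * ξ n) whiteNoiseLaw :=
    iIndepFun_infinitePi (P := fun _ => gaussianReal 0 1) (X := fun n x => d n * x)
      fun n => by fun_prop
  have hm : ∀ n : ℤ × ℤ, AEMeasurable (fun ξ : ℤ × ℤ → ℝ => d n * ξ n) whiteNoiseLaw :=
    fun n => ((measurable_pi_apply n).const_mul _).aemeasurable
  have h := (hind.precomp (g := ((↑) : s → ℤ × ℤ)) Subtype.val_injective)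
  have h2 := iIndepFun.charFun_map_fun_finsetSum_eq_prod (s := s) (P := whiteNoiseLaw)
    (X := fun (n : ℤ × ℤ) (ξ : ℤ × ℤ → ℝ) => d n * ξ n)  (fun n _ => hm n) h
  have h3 := congrFun h2 t
  rw [charFun_apply_real, integral_map (Finset.aemeasurable_fun_sum s fun n _ => hm n) (by fun_prop), Finset.prod_apply] at h3
  rw [h3]
  have h4 : ∀ n : ℤ × ℤ, whiteNoiseLaw.map (fun ξ : ℤ × ℤ → ℝ => d n * ξ n) =
      gaussianReal 0 (d n ^ 2).toNNReal := by
    intro n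
    have hmp : MeasurePreserving (Function.eval n) whiteNoiseLaw (gaussianReal 0 1) :=
      measurePreserving_eval_infinitePi (fun _ => gaussianReal 0 1) n
    have : (fun ξ : ℤ × ℤ → ℝ => d n * ξ n) = (fun x => d n * x) ∘ Function.eval n := rfl
    rw [this, ← Measure.map_map (by fun_prop) (by fun_prop), hmp.map_eq,
      gaussianReal_map_const_mul, mul_zero, mul_one]
    congr 1
    ext
    simp [Real.coe_toNNReal _ (sq_nonneg (d n))]
  simp_rw [h4, charFun_gaussianReal]
  rw [← Complex.exp_sum]
  congr 1
  push_cast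
  rw [Finset.sum_mul, Finset.sum_div, ← Finset.sum_neg_distrib]
  exact Finset.sum_congr rfl fun n _ => by
    simp [Real.coe_toNNReal _ (sq_nonneg (d n))]

/-- Under `massiveGFF` every pairing `u(φ)` is centred Gaussian with variance `cov φ φ`. -/
theorem map_eval_massiveGFF (φ : TestFunction) :
    massiveGFF.map (fun u => u φ) = gaussianReal 0 (cov φ φ).toNNReal := by
  have : IsProbabilityMeasure (massiveGFF.map (fun u : TorusDistribution => u φ)) :=
    Measure.isProbabilityMeasure_map (by fun_prop)
  refine Measure.ext_of_charFun (funext fun t => ?_)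
  have hm : AEMeasurable (fun ξ => (randomField ξ) φ) whiteNoiseLaw :=
    (measurable_eval φ).comp_aemeasurable aemeasurable_randomField
  rw [charFun_apply_real, massiveGFF, AEMeasurable.map_map_of_aemeasurable (by fun_prop)
    aemeasurable_randomField, Function.comp_def, integral_map hm (by fun_prop), charFun_gaussianReal]
  refine tendsto_nhds_unique (f := fun s : Finset (ℤ × ℤ) =>
    ∫ ξ, Complex.exp (t * (∑ n ∈ s, noiseCoeff φ n * ξ n : ℝ) * Complex.I) ∂whiteNoiseLaw)
    (l := atTop) ?_ ?_
  · refine tendsto_integral_filter_of_dominated_convergence (fun _ => 1)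
      (Eventually.of_forall fun s => ?_) (Eventually.of_forall fun s =>
        Eventually.of_forall fun ξ => ?_) (integrable_const _) ?_
    · have : Measurable fun ξ : ℤ × ℤ → ℝ => ∑ n ∈ s, noiseCoeff φ n * ξ n := by fun_prop
      exact Measurable.aestronglyMeasurable (by fun_prop)
    · rw [← Complex.ofReal_mul, Complex.norm_exp_ofReal_mul_I]
    · filter_upwards [ae_mem_goodNoise] with ξ hξ
      have h := hasSum_randomField hξ φ
      have hc : Continuous fun x : ℝ => Complex.exp (t * (x : ℂ) * Complex.I) := by fun_prop
      exact (hc.tendsto _).comp h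
  · simp_rw [charFun_noise_sum]
    have h := hasSum_noiseCoeff_sq φ
    have hc : Continuous fun x : ℝ => Complex.exp (-((x : ℂ) * t ^ 2 / 2)) := by fun_prop
    have := (hc.tendsto _).comp h
    convert! this using 2
    simp [Real.coe_toNNReal _ (cov_self_nonneg φ)]

lemma integrable_exp_eval (φ : TestFunction) (t : ℝ) :
    Integrable (fun u : TorusDistribution => Real.exp (t * u φ)) massiveGFF := by
  have h : Integrable (fun x => Real.exp (t * x)) (massiveGFF.map (fun u => u φ)) := by
    rw [map_eval_massiveGFF]
    exact integrable_exp_mul_gaussianReal t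
  exact h.comp_measurable (by fun_prop)

lemma integral_exp_eval (φ : TestFunction) (t : ℝ) :
    ∫ u : TorusDistribution, Real.exp (t * u φ) ∂massiveGFF =
      Real.exp (t ^ 2 / 2 * cov φ φ) := by
  have h : mgf id (massiveGFF.map (fun u => u φ)) t = Real.exp (cov φ φ * t ^ 2 / 2) := by
    rw [map_eval_massiveGFF, mgf_id_gaussianReal]
    simp [Real.coe_toNNReal _ (cov_self_nonneg φ)]
  rw [mgf, integral_map (by fun_prop) (by fun_prop)] at h
  simp only [id] at h
  rw [h]
  congr 1; ring

lemma integral_eval_sq (φ : TestFunction) :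
    ∫ u : TorusDistribution, (u φ) ^ 2 ∂massiveGFF = cov φ φ := by
  have h : ∫ x, x ^ 2 ∂(massiveGFF.map (fun u => u φ)) = cov φ φ := by
    rw [map_eval_massiveGFF]
    have h1 := variance_id_gaussianReal (μ := 0) (v := (cov φ φ).toNNReal)
    rw [variance_eq_integral (by fun_prop)] at h1
    rw [Real.coe_toNNReal _ (cov_self_nonneg φ)] at h1
    simpa using h1
  rwa [integral_map (by fun_prop) (by fun_prop)] at h

/-! ### The one-dimensional resolvent kernel -/

/-- The Green function at distance `s ∈ [0, 2π]` of `a² - d²/ds²` on the circle `ℝ/2πℤ`. -/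
def resolventKernel (a s : ℝ) : ℝ :=
  Real.cosh (a * (Real.pi - s)) / (2 * a * Real.sinh (Real.pi * a))

lemma resolventKernel_nonneg {a : ℝ} (ha : 0 < a) (s : ℝ) : 0 ≤ resolventKernel a s := by
  have h : 0 < Real.sinh (Real.pi * a) := Real.sinh_pos_iff.2 (by positivity)
  have := Real.cosh_pos (a * (Real.pi - s))
  unfold resolventKernel
  positivity

lemma continuous_resolventKernel (a : ℝ) : Continuous (resolventKernel a) := by
  unfold resolventKernel
  exact (Real.continuous_cosh.comp (by fun_prop)).div_const _

/-- The Fourier coefficients of `cosh (a (π - s))` on `[0, 2π]`. -/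
lemma integral_exp_mul_cosh {a : ℝ} (ha : 0 < a) (n : ℤ) :
    ∫ s in (0 : ℝ)..(2 * Real.pi), Complex.exp (-(Complex.I * n * s)) *
      Complex.cosh (a * (Real.pi - s)) =
      2 * a * Complex.sinh (Real.pi * a) / (a ^ 2 + n ^ 2) := by
  have hd : (a : ℂ) ^ 2 + n ^ 2 ≠ 0 := by
    have : (a ^ 2 + (n : ℝ) ^ 2 : ℝ) ≠ 0 := by positivity
    exact_mod_cast this
  -- An explicit primitive `e^{-ins} (A cosh + B sinh)(a (π - s))`.
  set A : ℂ := Complex.I * n / (a ^ 2 + n ^ 2) with hA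
  set B : ℂ := -a / (a ^ 2 + n ^ 2) with hB
  have hF : ∀ s : ℝ, HasDerivAt (fun s : ℝ => Complex.exp (-(Complex.I * n * s)) *
      (A * Complex.cosh (a * (Real.pi - s)) + B * Complex.sinh (a * (Real.pi - s))))
      (Complex.exp (-(Complex.I * n * s)) * Complex.cosh (a * (Real.pi - s))) s := by
    intro s
    have h0 : HasDerivAt (fun s : ℝ => (s : ℂ)) 1 s := Complex.ofRealCLM.hasDerivAt
    have h1 : HasDerivAt (fun s : ℝ => -(Complex.I * n * s)) (-(Complex.I * n * 1)) s :=
      (h0.const_mul _).neg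
    have h2 : HasDerivAt (fun s : ℝ => (a : ℂ) * (Real.pi - s)) (a * -1) s := by
      convert! ((h0.const_sub (Real.pi : ℂ)).const_mul (a : ℂ)) using 1
    have hc := (Complex.hasDerivAt_cosh _).comp s h2
    have hs := (Complex.hasDerivAt_sinh _).comp s h2
    have h3 := h1.cexp.mul ((hc.const_mul A).add (hs.const_mul B))
    convert! h3 using 1
    have e1 : -(Complex.I * n) * A + -a * B = 1 := by
      rw [hA, hB]; field_simp; ring_nf; simp [Complex.I_sq]
    have e2 : -(Complex.I * n) * B + -a * A = 0 := by
      rw [hA, hB]; field_simp; ring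
    simp only [Pi.add_apply, Function.comp_apply]
    linear_combination (-Complex.exp (-(Complex.I * n * s)) *
      Complex.cosh (a * (Real.pi - s))) * e1 - Complex.exp (-(Complex.I * n * s)) *
      Complex.sinh (a * (Real.pi - s)) * e2
  rw [intervalIntegral.integral_eq_sub_of_hasDerivAt (fun s _ => hF s)
    (Continuous.intervalIntegrable (by fun_prop) _ _)]
  have e3 : Complex.exp (-(Complex.I * n * ((2 * Real.pi : ℝ) : ℂ))) = 1 := by
    rw [Complex.exp_eq_one_iff]
    exact ⟨-n, by push_cast; ring⟩
  have e4 : (a : ℂ) * (Real.pi - ((2 * Real.pi : ℝ) : ℂ)) = -(Real.pi * a) := by push_cast; ring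
  have e5 : (a : ℂ) * (Real.pi - ((0 : ℝ) : ℂ)) = Real.pi * a := by push_cast; ring
  rw [e3, e4, e5, Complex.cosh_neg, Complex.sinh_neg, hB]
  simp
  ring

lemma hasSum_resolventKernel_of_mem {a : ℝ} (ha : 0 < a) {s : ℝ} (hs : s ∈ Ico 0 (2 * Real.pi)) :
    HasSum (fun m : ℤ => Complex.exp (Complex.I * ((m * s : ℝ) : ℂ)) / ((a ^ 2 + m ^ 2 : ℝ) : ℂ))
      ((2 * Real.pi * resolventKernel a s : ℝ) : ℂ) := by
  have hT : (0 : ℝ) < 2 * Real.pi := by positivity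
  have : Fact ((0 : ℝ) < 2 * Real.pi) := ⟨hT⟩
  set f : ℝ → ℂ := fun s => Complex.cosh (a * (Real.pi - s)) with hf
  have hsinh : 0 < Real.sinh (Real.pi * a) := Real.sinh_pos_iff.2 (by positivity)
  have hfc : Continuous f := by fun_prop
  have hper : f 0 = f (2 * Real.pi) := by
    simp only [hf]
    rw [← Complex.cosh_neg]
    congr 1
    push_cast; ring
  let F : C(AddCircle (2 * Real.pi), ℂ) :=
    ⟨AddCircle.liftIco (2 * Real.pi) 0 f, AddCircle.liftIco_zero_continuous hper hfc.continuousOn⟩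
  have hcoeff : ∀ n : ℤ, fourierCoeff F n =
      2 * a * Complex.sinh (Real.pi * a) / (2 * Real.pi) * (1 / ((a ^ 2 + n ^ 2 : ℝ) : ℂ)) := by
    intro n
    change fourierCoeff (AddCircle.liftIco (2 * Real.pi) 0 f) n = _
    rw [fourierCoeff_liftIco_eq, fourierCoeffOn_eq_integral]
    have : ∀ x : ℝ, (fourier (-n)) ((x : ℝ) : AddCircle (0 + 2 * Real.pi - 0)) • f x =
        Complex.exp (-(Complex.I * n * x)) * Complex.cosh (a * (Real.pi - x)) := by
      intro x
      rw [fourier_coe_apply, smul_eq_mul]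
      congr 2
      have : (Real.pi : ℂ) ≠ 0 := by exact_mod_cast Real.pi_ne_zero
      push_cast
      field_simp
      ring
    simp_rw [this, zero_add, sub_zero]
    rw [integral_exp_mul_cosh ha, Complex.real_smul]
    push_cast
    ring
  have hsum : Summable (fourierCoeff F) := by
    rw [funext hcoeff]
    refine Summable.mul_left _ ?_
    refine Summable.of_norm_bounded_eventually (g := fun m : ℤ => 1 / (m : ℝ) ^ 2)
      (Real.summable_one_div_int_pow.2 (by norm_num)) ?_
    filter_upwards [(finite_singleton (0 : ℤ)).compl_mem_cofinite] with m hm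
    have hm' : (m : ℝ) ≠ 0 := by exact_mod_cast hm
    rw [norm_div, norm_one, Complex.norm_real, Real.norm_of_nonneg (by positivity)]
    exact one_div_le_one_div_of_le (by positivity) (by nlinarith)
  have h := has_pointwise_sum_fourier_series_of_summable hsum (s : AddCircle (2 * Real.pi))
  have hFs : F (s : AddCircle (2 * Real.pi)) = f s := by
    change AddCircle.liftIco (2 * Real.pi) 0 f s = f s
    exact AddCircle.liftIco_coe_apply (show s ∈ Ico 0 (0 + 2 * Real.pi) by rwa [zero_add])
  rw [hFs] at h
  have h2 := h.mul_left (2 * Real.pi / (2 * a * Complex.sinh (Real.pi * a)))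
  have hsinh' : Complex.sinh (Real.pi * a) ≠ 0 := by exact_mod_cast hsinh.ne'
  have hpi : (Real.pi : ℂ) ≠ 0 := by exact_mod_cast Real.pi_ne_zero
  have ha' : (a : ℂ) ≠ 0 := by exact_mod_cast ha.ne'
  convert! h2 using 1
  · funext m
    rw [hcoeff, smul_eq_mul, fourier_coe_apply]
    have e1 : (2 * Real.pi * Complex.I * m * s / ((2 * Real.pi : ℝ) : ℂ)) =
        Complex.I * ((m * s : ℝ) : ℂ) := by
      push_cast; field_simp
    rw [e1]
    field_simp
  · simp only [hf, resolventKernel]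
    push_cast
    ring

lemma hasSum_resolventKernel {a : ℝ} (ha : 0 < a) {s : ℝ} (hs : |s| < 2 * Real.pi) :
    HasSum (fun m : ℤ => Complex.exp (Complex.I * ((m * s : ℝ) : ℂ)) / ((a ^ 2 + m ^ 2 : ℝ) : ℂ))
      ((2 * Real.pi * resolventKernel a |s| : ℝ) : ℂ) := by
  have h := hasSum_resolventKernel_of_mem ha (s := |s|) ⟨abs_nonneg s, hs⟩
  rcases abs_cases s with ⟨h1, -⟩ | ⟨h1, -⟩
  · rwa [h1] at h ⊢
  · rw [h1] at h ⊢
    have h2 := (Equiv.neg ℤ).hasSum_iff.2 h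
    convert! h2 using 2 with m
    simp

lemma resolventKernel_le {a s : ℝ} (ha : 1 ≤ a) (hs0 : 0 ≤ s) (hs : s ≤ 2 * Real.pi) :
    resolventKernel a s ≤ Real.exp (-(a * s)) / (2 * a) +
      Real.exp (-(a * (2 * Real.pi - s))) / (2 * a) + 2 * Real.exp (-a) := by
  have ha0 : 0 < a := by linarith
  have hpi := Real.pi_gt_three
  set q := Real.exp (-(2 * Real.pi * a)) with hq
  have hq0 : 0 < q := Real.exp_pos _
  have hqa : q ≤ Real.exp (-a) := Real.exp_le_exp.2 (by nlinarith)
  have hq1 : q ≤ 1 / 2 := by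
    have h1 : q ≤ Real.exp (-1) := Real.exp_le_exp.2 (by nlinarith)
    have h2 : Real.exp (-1) ≤ 1 / 2 := by
      rw [Real.exp_neg, ← one_div]
      exact one_div_le_one_div_of_le (by norm_num) (by linarith [Real.add_one_le_exp 1])
    linarith
  set x := Real.exp (-(a * s)) with hx
  set y := Real.exp (-(a * (2 * Real.pi - s))) with hy
  have hx1 : x ≤ 1 := Real.exp_le_one_iff.2 (by nlinarith)
  have hy1 : y ≤ 1 := Real.exp_le_one_iff.2 (by nlinarith)
  have hx0 : 0 < x := Real.exp_pos _
  have hy0 : 0 < y := Real.exp_pos _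
  have key : resolventKernel a s = (x + y) / (2 * a) * (1 / (1 - q)) := by
    rw [resolventKernel, Real.cosh_eq, Real.sinh_eq]
    have e1 : x = Real.exp (a * (Real.pi - s)) * Real.exp (-(Real.pi * a)) := by
      rw [← Real.exp_add, hx]; congr 1; ring
    have e2 : y = Real.exp (-(a * (Real.pi - s))) * Real.exp (-(Real.pi * a)) := by
      rw [← Real.exp_add, hy]; congr 1; ring
    have e3 : 1 - q =
        (Real.exp (Real.pi * a) - Real.exp (-(Real.pi * a))) * Real.exp (-(Real.pi * a)) := by
      rw [sub_mul, ← Real.exp_add, ← Real.exp_add, hq, add_neg_cancel, Real.exp_zero]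
      congr 2; ring
    have e4 : 0 < Real.exp (Real.pi * a) - Real.exp (-(Real.pi * a)) :=
      sub_pos.2 (Real.exp_lt_exp.2 (by nlinarith))
    have e5 := Real.exp_pos (-(Real.pi * a))
    rw [e1, e2, e3]
    field_simp
  have h1 : 1 / (1 - q) ≤ 1 + 2 * q := by
    rw [div_le_iff₀ (by linarith)]
    nlinarith
  have h2 : (x + y) / (2 * a) ≤ 1 := by
    rw [div_le_one (by linarith)]
    linarith
  have h3 : 0 ≤ (x + y) / (2 * a) := by positivity
  rw [key, ← add_div]
  nlinarith [mul_le_mul_of_nonneg_left h1 h3]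

/-- The `n`-th term of the series `∑_{n ≠ 0} e^{-|n| s} / (2 |n|) = -log (1 - e^{-s})`; at `n = 0`
division by zero makes it vanish. -/
def logTerm (s : ℝ) (n : ℤ) : ℝ := Real.exp (-(|(n : ℝ)| * s)) / (2 * |(n : ℝ)|)

lemma hasSum_logTerm {s : ℝ} (hs : 0 < s) :
    HasSum (logTerm s) (-Real.log (1 - Real.exp (-s))) := by
  have h := Real.hasSum_pow_div_log_of_abs_lt_one (x := Real.exp (-s)) (by
    rw [abs_of_pos (Real.exp_pos _)]; simpa using hs)
  have h1 : HasSum (fun n : ℕ => logTerm s ((n : ℤ) + 1))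
      (-Real.log (1 - Real.exp (-s)) / 2) := by
    convert! h.div_const 2 using 2 with n
    have : |(((n : ℤ) + 1 : ℤ) : ℝ)| = n + 1 := by
      push_cast; exact abs_of_nonneg (by positivity)
    rw [logTerm, this, ← Real.exp_nat_mul]
    push_cast
    rw [div_div, mul_comm (2 : ℝ)]
    congr 2; ring
  have h2 : HasSum (fun n : ℕ => logTerm s (n : ℤ)) (-Real.log (1 - Real.exp (-s)) / 2) := by
    refine (hasSum_nat_add_iff' 1).1 ?_
    simpa [logTerm] using h1
  have h3 : HasSum (fun n : ℕ => logTerm s (-((n : ℤ) + 1)))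
      (-Real.log (1 - Real.exp (-s)) / 2) := by
    convert! h1 using 2 with n
    rw [logTerm, logTerm, Int.cast_neg, abs_neg]
  convert! HasSum.of_nat_of_neg_add_one h2 h3 using 1
  ring

lemma summable_exp_neg_abs_int : Summable fun n : ℤ => Real.exp (-|(n : ℝ)|) := by
  refine summable_int_iff_summable_nat_and_neg.2 ⟨?_, ?_⟩ <;> simpa using Real.summable_exp_neg_nat

lemma neg_log_one_sub_exp_le {s : ℝ} (hs : 0 < s) (hs2 : s < 2 * Real.pi) :
    -Real.log (1 - Real.exp (-s)) ≤ 2 * Real.pi - Real.log s := by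
  have h1 : s * Real.exp (-(2 * Real.pi)) ≤ 1 - Real.exp (-s) := by
    have h2 : Real.exp (-(2 * Real.pi)) ≤ Real.exp (-s) := Real.exp_le_exp.2 (by linarith)
    have h3 : (s + 1) * Real.exp (-s) ≤ Real.exp s * Real.exp (-s) :=
      mul_le_mul_of_nonneg_right (Real.add_one_le_exp s) (Real.exp_pos _).le
    rw [← Real.exp_add, add_neg_cancel, Real.exp_zero] at h3
    nlinarith
  have h4 := Real.log_le_log (by positivity) h1
  rw [Real.log_mul hs.ne' (Real.exp_pos _).ne', Real.log_exp] at h4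
  linarith

/-- The frequency `√(1 + n²)` of the one-dimensional resolvent in the `n`-th Fourier mode. -/
def modeFreq (n : ℤ) : ℝ := Real.sqrt (1 + (n : ℝ) ^ 2)

lemma modeFreq_sq (n : ℤ) : modeFreq n ^ 2 = 1 + (n : ℝ) ^ 2 := Real.sq_sqrt (by positivity)

lemma one_le_modeFreq (n : ℤ) : 1 ≤ modeFreq n := by
  rw [modeFreq, Real.one_le_sqrt]; nlinarith [sq_nonneg (n : ℝ)]

lemma abs_le_modeFreq (n : ℤ) : |(n : ℝ)| ≤ modeFreq n :=
  Real.abs_le_sqrt (by linarith)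

lemma resolventKernel_modeFreq_le (n : ℤ) {s : ℝ} (hs0 : 0 < s) (hs : s < 2 * Real.pi) :
    resolventKernel (modeFreq n) s ≤
      logTerm s n + logTerm (2 * Real.pi - s) n + 3 * Real.exp (-|(n : ℝ)|) := by
  have ha := one_le_modeFreq n
  have hn := abs_le_modeFreq n
  refine (resolventKernel_le ha hs0.le hs.le).trans ?_
  rcases eq_or_ne n 0 with rfl | h0
  · have : modeFreq 0 = 1 := by simp [modeFreq]
    rw [this]
    have h1 : Real.exp (-(1 * s)) ≤ 1 := Real.exp_le_one_iff.2 (by linarith)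
    have h2 : Real.exp (-(1 * (2 * Real.pi - s))) ≤ 1 := Real.exp_le_one_iff.2 (by linarith)
    have h3 : Real.exp (-1) ≤ 1 := Real.exp_le_one_iff.2 (by linarith)
    simp only [logTerm, Int.cast_zero, abs_zero, mul_zero, div_zero, neg_zero, Real.exp_zero]
    linarith
  · have hn0 : 0 < |(n : ℝ)| := abs_pos.2 (by exact_mod_cast h0)
    have mono : ∀ r : ℝ, 0 ≤ r →
        Real.exp (-(modeFreq n * r)) / (2 * modeFreq n) ≤ logTerm r n := by
      intro r hr
      unfold logTerm
      gcongr
    have h1 := mono s hs0.le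
    have h2 := mono (2 * Real.pi - s) (by linarith)
    have h3 : Real.exp (-modeFreq n) ≤ Real.exp (-|(n : ℝ)|) := Real.exp_le_exp.2 (by linarith)
    linarith [Real.exp_pos (-|(n : ℝ)|)]

/-- A bound for the covariance of the massive free field with the sharp constant `1/2π` in front of
the logarithm, as a function of the difference `s ∈ (-2π, 2π)` of one of the coordinates. Two
logarithms occur because `s` is close to zero on the circle also when `|s|` is close to `2π`. -/
def logKernel (s : ℝ) : ℝ :=
  (2 * Real.pi)⁻¹ * (4 * Real.pi + 3 * ∑' n : ℤ, Real.exp (-|(n : ℝ)|)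
    - Real.log |s| - Real.log (2 * Real.pi - |s|))

/-- Up to exponentially small corrections the `n`-th kernel is `e^{-|n| |s|} / (2|n|)`, and these
add up to a logarithm. -/
lemma sum_resolventKernel_le_logKernel (F : Finset ℤ) {s : ℝ} (hs0 : s ≠ 0)
    (hs : |s| < 2 * Real.pi) :
    ∑ n ∈ F, (2 * Real.pi)⁻¹ * resolventKernel (modeFreq n) |s| ≤ logKernel s := by
  have hs0' : 0 < |s| := abs_pos.2 hs0
  rw [← Finset.mul_sum, logKernel]
  refine mul_le_mul_of_nonneg_left ?_ (by positivity)
  refine (Finset.sum_le_sum fun n _ => resolventKernel_modeFreq_le n hs0' hs).trans ?_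
  have hpos : ∀ r n, 0 ≤ logTerm r n := fun r n => by unfold logTerm; positivity
  have hsum := ((hasSum_logTerm hs0').add (hasSum_logTerm (sub_pos.2 hs))).add
    (summable_exp_neg_abs_int.hasSum.mul_left 3)
  refine (sum_le_hasSum F (fun n _ => by
    have := hpos |s| n; have := hpos (2 * Real.pi - |s|) n; positivity) hsum).trans ?_
  have h1 := neg_log_one_sub_exp_le hs0' hs
  have h2 := neg_log_one_sub_exp_le (sub_pos.2 hs) (by linarith)
  linarith

lemma measurable_logKernel : Measurable logKernel := by
  unfold logKernel
  fun_prop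

lemma logKernel_ge (s : ℝ) (hs : |s| < 2 * Real.pi) :
    -(2 * Real.pi)⁻¹ * (2 * Real.log (2 * Real.pi)) ≤ logKernel s := by
  have hpi := Real.pi_gt_three
  have hlog : ∀ r : ℝ, 0 ≤ r → r ≤ 2 * Real.pi → Real.log r ≤ Real.log (2 * Real.pi) := by
    intro r h0 h1
    rcases h0.eq_or_lt with rfl | h0
    · rw [Real.log_zero]; exact Real.log_nonneg (by linarith)
    · exact Real.log_le_log h0 h1
  have h1 := hlog |s| (abs_nonneg s) hs.le
  have h2 := hlog (2 * Real.pi - |s|) (by linarith) (by linarith [abs_nonneg s])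
  have h3 : 0 ≤ ∑' n : ℤ, Real.exp (-|(n : ℝ)|) := tsum_nonneg fun n => (Real.exp_pos _).le
  rw [neg_mul, ← mul_neg, logKernel]
  refine mul_le_mul_of_nonneg_left ?_ (by positivity)
  linarith

lemma intervalIntegrable_abs_rpow_neg {γ : ℝ} (hγ : γ < 1) (a b : ℝ) :
    IntervalIntegrable (fun s : ℝ => |s| ^ (-γ)) volume a b := by
  have h1 : ∀ T : ℝ, 0 ≤ T → IntervalIntegrable (fun s : ℝ => |s| ^ (-γ)) volume 0 T := by
    intro T hT
    refine (intervalIntegral.intervalIntegrable_rpow' (r := -γ) (by linarith)).congr_ae ?_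
    refine (ae_restrict_iff' measurableSet_uIoc).2 (Eventually.of_forall fun s hs => ?_)
    rw [uIoc_of_le hT] at hs
    simp only [abs_of_pos hs.1]
  have h2 : ∀ T : ℝ, IntervalIntegrable (fun s : ℝ => |s| ^ (-γ)) volume 0 T := by
    intro T
    rcases le_total 0 T with hT | hT
    · exact h1 T hT
    · have := (h1 (-T) (by linarith)).comp_mul_left (c := -1)
      simpa using this
  exact (h2 a).symm.trans (h2 b)

/-- The borderline `c = 4π` is where `exp (c logKernel / 2) ≈ |s|^{-c/4π}` stops being
integrable. -/
lemma integrableOn_exp_logKernel {c : ℝ} (hc0 : 0 < c) (hc : c < 4 * Real.pi) :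
    IntegrableOn (fun s => Real.exp (c / 2 * logKernel s)) (Ioo (-(2 * Real.pi)) (2 * Real.pi)) := by
  have hpi := Real.pi_pos
  set γ := c / (4 * Real.pi) with hγ
  have hγ0 : 0 < γ := by positivity
  have hγ1 : γ < 1 := by rw [hγ, div_lt_one (by positivity)]; exact hc
  set K := Real.exp (γ * (4 * Real.pi + 3 * ∑' n : ℤ, Real.exp (-|(n : ℝ)|))) with hK
  have hint : ∀ {f : ℝ → ℝ}, IntervalIntegrable f volume (-(2 * Real.pi)) (2 * Real.pi) →
      IntegrableOn f (Ioo (-(2 * Real.pi)) (2 * Real.pi)) := fun {f} hf =>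
    ((intervalIntegrable_iff_integrableOn_Ioo_of_le (by linarith)).1 hf)
  have i1 := hint (intervalIntegrable_abs_rpow_neg hγ1 (-(2 * Real.pi)) (2 * Real.pi))
  have i2 : IntegrableOn (fun s : ℝ => |s + 2 * Real.pi| ^ (-γ))
      (Ioo (-(2 * Real.pi)) (2 * Real.pi)) := by
    refine hint ?_
    have := (intervalIntegrable_abs_rpow_neg hγ1 0 (4 * Real.pi)).comp_add_right (2 * Real.pi)
    convert! this using 1 <;> ring
  have i3 : IntegrableOn (fun s : ℝ => |s - 2 * Real.pi| ^ (-γ))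
      (Ioo (-(2 * Real.pi)) (2 * Real.pi)) := by
    refine hint ?_
    have := (intervalIntegrable_abs_rpow_neg hγ1 (-(4 * Real.pi)) 0).comp_sub_right (2 * Real.pi)
    convert! this using 1 <;> ring
  refine Integrable.mono' (((i1.add i2).add i3).const_mul (K * Real.pi ^ (-γ)))
    (Measurable.aestronglyMeasurable (by have := measurable_logKernel; fun_prop)) ?_
  have hne : ∀ᵐ s : ℝ, s ≠ 0 := Measure.ae_ne volume 0
  filter_upwards [ae_restrict_mem measurableSet_Ioo, ae_restrict_of_ae hne] with s hs hs0
  have hs0' : 0 < |s| := abs_pos.2 hs0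
  have hs1 : |s| < 2 * Real.pi := abs_lt.2 hs
  have hd : 0 < 2 * Real.pi - |s| := by linarith
  rw [Real.norm_of_nonneg (Real.exp_pos _).le]
  have e1 : Real.exp (c / 2 * logKernel s) = K * (|s| ^ (-γ) * (2 * Real.pi - |s|) ^ (-γ)) := by
    rw [Real.rpow_def_of_pos hs0', Real.rpow_def_of_pos hd, ← Real.exp_add, hK, ← Real.exp_add]
    congr 1
    rw [logKernel, hγ]
    field_simp
    ring
  have hP : ∀ r : ℝ, Real.pi ≤ r → r ^ (-γ) ≤ Real.pi ^ (-γ) := fun r hr =>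
    Real.rpow_le_rpow_of_nonpos hpi hr (by linarith)
  have e2 : |s| ^ (-γ) * (2 * Real.pi - |s|) ^ (-γ) ≤
      Real.pi ^ (-γ) * (|s| ^ (-γ) + (2 * Real.pi - |s|) ^ (-γ)) := by
    have p1 : 0 < |s| ^ (-γ) := Real.rpow_pos_of_pos hs0' _
    have p2 : 0 < (2 * Real.pi - |s|) ^ (-γ) := Real.rpow_pos_of_pos hd _
    have p3 : 0 < Real.pi ^ (-γ) := Real.rpow_pos_of_pos hpi _
    rcases le_total Real.pi |s| with h | h
    · nlinarith [hP _ h, mul_pos p3 p1]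
    · nlinarith [hP (2 * Real.pi - |s|) (by linarith), mul_pos p3 p2]
  have e3 : (2 * Real.pi - |s|) ^ (-γ) ≤ |s + 2 * Real.pi| ^ (-γ) + |s - 2 * Real.pi| ^ (-γ) := by
    have p1 : 0 ≤ |s + 2 * Real.pi| ^ (-γ) := by positivity
    have p2 : 0 ≤ |s - 2 * Real.pi| ^ (-γ) := by positivity
    rcases abs_cases s with ⟨h, h'⟩ | ⟨h, h'⟩
    · have : |s - 2 * Real.pi| = 2 * Real.pi - |s| := by
        rw [abs_of_nonpos (by linarith), h]; ring
      rw [← this]; linarith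
    · have : |s + 2 * Real.pi| = 2 * Real.pi - |s| := by
        rw [abs_of_nonneg (by linarith), h]; ring
      rw [← this]; linarith
  rw [e1, mul_assoc]
  refine mul_le_mul_of_nonneg_left (e2.trans ?_) (Real.exp_pos _).le
  simp only [Pi.add_apply]
  exact mul_le_mul_of_nonneg_left (by linarith) (by positivity)

/-! ### Logarithmic bounds for the covariance -/

/-- Lebesgue measure on the fundamental domain of the torus. -/
abbrev cellMeasure : Measure (ℝ × ℝ) := (volume : Measure (ℝ × ℝ)).restrict cell

lemma ae_mem_cell : ∀ᵐ x ∂cellMeasure, x ∈ cell := ae_restrict_mem measurableSet_cell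

lemma ae_prod_mem_cell : ∀ᵐ p ∂(cellMeasure.prod cellMeasure), p.1 ∈ cell ∧ p.2 ∈ cell := by
  filter_upwards [Measure.quasiMeasurePreserving_fst.ae ae_mem_cell,
    Measure.quasiMeasurePreserving_snd.ae ae_mem_cell] with p h1 h2 using ⟨h1, h2⟩

lemma abs_sub_lt_two_pi {s t : ℝ} (hs : s ∈ Ico (-Real.pi) Real.pi)
    (ht : t ∈ Ico (-Real.pi) Real.pi) : |s - t| < 2 * Real.pi := by
  rw [abs_lt]
  constructor <;> linarith [hs.1, hs.2, ht.1, ht.2]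

lemma integrable_prod_cell {E : Type*} [NormedAddCommGroup E] [SecondCountableTopology E]
    {f : (ℝ × ℝ) × (ℝ × ℝ) → E} (hf : Continuous f) :
    Integrable f (cellMeasure.prod cellMeasure) := by
  rw [Measure.prod_restrict]
  have hK : IsCompact (Icc (-Real.pi) Real.pi ×ˢ Icc (-Real.pi) Real.pi) :=
    isCompact_Icc.prod isCompact_Icc
  exact (hf.continuousOn.integrableOn_compact (hK.prod hK)).mono_set
    (prod_mono cell_subset_Icc cell_subset_Icc)

lemma setLIntegral_comp_sub_le {f : ℝ → ℝ≥0∞} {s : ℝ} (hs : s ∈ Ico (-Real.pi) Real.pi) :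
    ∫⁻ t in Ico (-Real.pi) Real.pi, f (s - t) ≤
      ∫⁻ r in Ioo (-(2 * Real.pi)) (2 * Real.pi), f r := by
  rw [← lintegral_indicator measurableSet_Ico, ← lintegral_indicator measurableSet_Ioo,
    ← lintegral_sub_left_eq_self ((Ioo (-(2 * Real.pi)) (2 * Real.pi)).indicator f) s]
  refine lintegral_mono fun t => ?_
  by_cases ht : t ∈ Ico (-Real.pi) Real.pi
  · have := abs_lt.1 (abs_sub_lt_two_pi hs ht)
    rw [indicator_of_mem ht, indicator_of_mem (show s - t ∈ Ioo _ _ from this)]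
  · rw [indicator_of_notMem ht]; exact zero_le

lemma integrable_comp_sub_mul_comp_sub {f g : ℝ → ℝ} (hfm : Measurable f) (hgm : Measurable g)
    (hf : IntegrableOn f (Ioo (-(2 * Real.pi)) (2 * Real.pi)))
    (hg : IntegrableOn g (Ioo (-(2 * Real.pi)) (2 * Real.pi))) :
    Integrable (fun p : (ℝ × ℝ) × (ℝ × ℝ) => f (p.1.1 - p.2.1) * g (p.1.2 - p.2.2))
      (cellMeasure.prod cellMeasure) := by
  refine ⟨Measurable.aestronglyMeasurable (by fun_prop), ?_⟩
  rw [HasFiniteIntegral, lintegral_prod _ (by fun_prop)]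
  have h1 : ∀ᵐ x ∂cellMeasure, ∫⁻ y, ‖f (x.1 - y.1) * g (x.2 - y.2)‖ₑ ∂cellMeasure ≤
      (∫⁻ r in Ioo (-(2 * Real.pi)) (2 * Real.pi), ‖f r‖ₑ) *
        ∫⁻ r in Ioo (-(2 * Real.pi)) (2 * Real.pi), ‖g r‖ₑ := by
    filter_upwards [ae_mem_cell] with x hx
    simp_rw [enorm_mul]
    rw [cellMeasure, volume_restrict_cell,
      lintegral_prod_mul (f := fun t => ‖f (x.1 - t)‖ₑ) (g := fun t => ‖g (x.2 - t)‖ₑ)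
        (by fun_prop) (by fun_prop)]
    exact mul_le_mul' (setLIntegral_comp_sub_le (f := fun r => ‖f r‖ₑ) hx.1)
      (setLIntegral_comp_sub_le (f := fun r => ‖g r‖ₑ) hx.2)
  refine (lintegral_mono_ae h1).trans_lt ?_
  rw [lintegral_const]
  exact ENNReal.mul_lt_top (ENNReal.mul_lt_top hf.2 hg.2) (measure_lt_top _ _)

lemma integrableOn_logKernel : IntegrableOn logKernel (Ioo (-(2 * Real.pi)) (2 * Real.pi)) := by
  have hpi := Real.pi_gt_three
  have h1 := integrableOn_exp_logKernel (c := 2) (by norm_num) (by linarith)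
  have h2 : IntegrableOn (fun _ : ℝ => |(2 * Real.pi)⁻¹ * (2 * Real.log (2 * Real.pi))|)
      (Ioo (-(2 * Real.pi)) (2 * Real.pi)) := integrableOn_const (by simp)
  refine Integrable.mono' (h1.add h2) measurable_logKernel.aestronglyMeasurable ?_
  filter_upwards [ae_restrict_mem measurableSet_Ioo] with s hs
  have h3 := logKernel_ge s (abs_lt.2 hs)
  have h4 := Real.add_one_le_exp (2 / 2 * logKernel s)
  have h5 := le_abs_self ((2 * Real.pi)⁻¹ * (2 * Real.log (2 * Real.pi)))
  have h6 := abs_nonneg ((2 * Real.pi)⁻¹ * (2 * Real.log (2 * Real.pi)))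
  have h7 := Real.exp_pos (2 / 2 * logKernel s)
  simp only [Pi.add_apply, Real.norm_eq_abs]
  rw [abs_le]
  constructor <;> linarith

lemma integrable_mul_of_continuous {F : (ℝ × ℝ) × (ℝ × ℝ) → ℝ} (φ ψ : TestFunction)
    (hF : Integrable F (cellMeasure.prod cellMeasure)) :
    Integrable (fun p => (φ : ℝ × ℝ → ℝ) p.1 * (ψ : ℝ × ℝ → ℝ) p.2 * F p)
      (cellMeasure.prod cellMeasure) := by
  have hφ := continuous_coe φ
  have hψ := continuous_coe ψ
  obtain ⟨M, hM0, hM⟩ := exists_bound_of_periodic hφ (periodic_coe φ)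
  obtain ⟨K, hK0, hK⟩ := exists_bound_of_periodic hψ (periodic_coe ψ)
  refine hF.bdd_mul (c := M * K) (Continuous.aestronglyMeasurable (by fun_prop))
    (Eventually.of_forall fun p => ?_)
  rw [norm_mul]
  exact mul_le_mul (hM _) (hK _) (norm_nonneg _) hM0

lemma integrable_logKernel_snd : Integrable (fun p : (ℝ × ℝ) × (ℝ × ℝ) =>
    logKernel (p.1.2 - p.2.2)) (cellMeasure.prod cellMeasure) := by
  simpa using integrable_comp_sub_mul_comp_sub (f := fun _ => 1) measurable_const
    measurable_logKernel (integrableOn_const (by simp)) integrableOn_logKernel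

lemma integrable_logKernel_fst : Integrable (fun p : (ℝ × ℝ) × (ℝ × ℝ) =>
    logKernel (p.1.1 - p.2.1)) (cellMeasure.prod cellMeasure) := by
  simpa using integrable_comp_sub_mul_comp_sub (g := fun _ => 1) measurable_logKernel
    measurable_const integrableOn_logKernel (integrableOn_const (by simp))

lemma fourierBasis_mul_conj (k m : ℤ) (x y : ℝ × ℝ) :
    fourierBasis (k, m) x * (starRingEnd ℂ) (fourierBasis (k, m) y) =
      (((2 * Real.pi)⁻¹ ^ 2 : ℝ) : ℂ) * Complex.exp (Complex.I * ((k * (x.1 - y.1) : ℝ) : ℂ)) *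
        Complex.exp (Complex.I * ((m * (x.2 - y.2) : ℝ) : ℂ)) := by
  simp only [fourierBasis, map_mul, Complex.conj_ofReal, ← Complex.exp_conj, Complex.conj_I]
  rw [mul_mul_mul_comm, ← Complex.exp_add, mul_assoc (((2 * Real.pi)⁻¹ ^ 2 : ℝ) : ℂ),
    ← Complex.exp_add]
  push_cast
  congr 1
  · ring
  · congr 1; ring

lemma coeff_mul_conj_coeff (n : ℤ × ℤ) (φ ψ : TestFunction) :
    coeff n φ * (starRingEnd ℂ) (coeff n ψ) =
      ∫ p : (ℝ × ℝ) × (ℝ × ℝ), fourierBasis n p.1 * (starRingEnd ℂ) (fourierBasis n p.2) *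
        ((φ : ℝ × ℝ → ℝ) p.1 * (ψ : ℝ × ℝ → ℝ) p.2 : ℝ) ∂(cellMeasure.prod cellMeasure) := by
  rw [coeff, coeff, ← integral_conj, ← integral_prod_mul]
  refine integral_congr_ae (Eventually.of_forall fun p => ?_)
  simp only [map_mul, Complex.conj_ofReal]
  push_cast
  ring

/-- Summation over the second frequency for a fixed first frequency `k` produces the
one-dimensional resolvent kernel of frequency `√(1 + k²)`. -/
lemma hasSum_coeff_row (k : ℤ) (φ ψ : TestFunction) :
    HasSum (fun m : ℤ => coeff (k, m) φ * (starRingEnd ℂ) (coeff (k, m) ψ) /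
        ((bracket (k, m) ^ 2 : ℝ) : ℂ))
      (∫ p : (ℝ × ℝ) × (ℝ × ℝ), ((φ : ℝ × ℝ → ℝ) p.1 * (ψ : ℝ × ℝ → ℝ) p.2 *
        ((2 * Real.pi)⁻¹ * resolventKernel (modeFreq k) |p.1.2 - p.2.2|) : ℝ) *
          Complex.exp (Complex.I * ((k * (p.1.1 - p.2.1) : ℝ) : ℂ))
            ∂(cellMeasure.prod cellMeasure)) := by
  have ha : 0 < modeFreq k := one_pos.trans_le (one_le_modeFreq k)
  have hbr : ∀ m : ℤ, bracket (k, m) ^ 2 = modeFreq k ^ 2 + (m : ℝ) ^ 2 := fun m => by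
    rw [bracket_sq, modeFreq_sq]; ring
  have hφ := continuous_coe φ
  have hψ := continuous_coe ψ
  set F : ℤ → (ℝ × ℝ) × (ℝ × ℝ) → ℂ := fun m p =>
    fourierBasis (k, m) p.1 * (starRingEnd ℂ) (fourierBasis (k, m) p.2) *
      ((φ : ℝ × ℝ → ℝ) p.1 * (ψ : ℝ × ℝ → ℝ) p.2 : ℝ) / ((bracket (k, m) ^ 2 : ℝ) : ℂ) with hF
  have hFint : ∀ m, Integrable (F m) (cellMeasure.prod cellMeasure) := fun m => by
    refine integrable_prod_cell ?_
    have h1 := continuous_fourierBasis (k, m)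
    have h2 : Continuous fun p : (ℝ × ℝ) × (ℝ × ℝ) =>
        (starRingEnd ℂ) (fourierBasis (k, m) p.2) :=
      Complex.continuous_conj.comp (h1.comp continuous_snd)
    simp only [hF]
    fun_prop
  have hnorm : ∀ m p, ‖F m p‖ = |(φ : ℝ × ℝ → ℝ) p.1 * (ψ : ℝ × ℝ → ℝ) p.2| *
      ((2 * Real.pi)⁻¹ ^ 2 * (1 / (modeFreq k ^ 2 + (m : ℝ) ^ 2))) := fun m p => by
    simp only [hF]
    rw [norm_div, norm_mul, norm_mul, Complex.norm_conj, norm_fourierBasis, norm_fourierBasis,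
      Complex.norm_real, Complex.norm_real, hbr,
      Real.norm_of_nonneg (by positivity : 0 ≤ modeFreq k ^ 2 + (m : ℝ) ^ 2), Real.norm_eq_abs]
    ring
  have hsum1 : Summable fun m : ℤ => 1 / (modeFreq k ^ 2 + (m : ℝ) ^ 2) := by
    have h := (hasSum_resolventKernel ha (s := 0) (by simpa using Real.pi_pos)).summable.norm
    refine h.congr fun m => ?_
    rw [norm_div, Complex.norm_real, Real.norm_of_nonneg (by positivity)]
    simp
  have hsum : Summable fun m => ∫ p, ‖F m p‖ ∂(cellMeasure.prod cellMeasure) := by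
    simp_rw [hnorm, integral_mul_const]
    exact (hsum1.mul_left _).mul_left _
  have h := hasSum_integral_of_summable_integral_norm hFint hsum
  convert! h using 1
  · funext m
    rw [coeff_mul_conj_coeff, ← integral_div]
  · refine integral_congr_ae ?_
    filter_upwards [ae_prod_mem_cell] with p hp
    have h1 := (hasSum_resolventKernel ha (abs_sub_lt_two_pi hp.1.2 hp.2.2)).mul_left
      ((((2 * Real.pi)⁻¹ ^ 2 : ℝ) : ℂ) * Complex.exp (Complex.I * ((k * (p.1.1 - p.2.1) : ℝ) : ℂ)) *
        ((φ : ℝ × ℝ → ℝ) p.1 * (ψ : ℝ × ℝ → ℝ) p.2 : ℝ))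
    refine Eq.symm (HasSum.tsum_eq ?_)
    convert! h1 using 1
    · funext m
      simp only [hF]
      rw [fourierBasis_mul_conj, hbr]
      ring
    · push_cast
      have hpi : (Real.pi : ℂ) ≠ 0 := by exact_mod_cast Real.pi_ne_zero
      field_simp

/-- The phases `e^{ik(x₁ - y₁)}` are estimated by one, which is lossless at `x₁ = y₁`. -/
lemma cov_le_integral_logKernel_snd {φ ψ : TestFunction} (hφ : ∀ x, 0 ≤ (φ : ℝ × ℝ → ℝ) x)
    (hψ : ∀ x, 0 ≤ (ψ : ℝ × ℝ → ℝ) x) :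
    cov φ ψ ≤ ∫ p : (ℝ × ℝ) × (ℝ × ℝ), (φ : ℝ × ℝ → ℝ) p.1 * (ψ : ℝ × ℝ → ℝ) p.2 *
      logKernel (p.1.2 - p.2.2) ∂(cellMeasure.prod cellMeasure) := by
  have hφc := continuous_coe φ
  have hψc := continuous_coe ψ
  set R : ℤ → (ℝ × ℝ) × (ℝ × ℝ) → ℝ := fun k p => (φ : ℝ × ℝ → ℝ) p.1 * (ψ : ℝ × ℝ → ℝ) p.2 *
    ((2 * Real.pi)⁻¹ * resolventKernel (modeFreq k) |p.1.2 - p.2.2|) with hR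
  have ha : ∀ k, 0 < modeFreq k := fun k => one_pos.trans_le (one_le_modeFreq k)
  have hR0 : ∀ k p, 0 ≤ R k p := fun k p =>
    mul_nonneg (mul_nonneg (hφ _) (hψ _)) (mul_nonneg (by positivity)
      (resolventKernel_nonneg (ha k) _))
  have hRint : ∀ k, Integrable (R k) (cellMeasure.prod cellMeasure) := fun k => by
    refine integrable_prod_cell ?_
    have := continuous_resolventKernel (modeFreq k)
    simp only [hR]
    fun_prop
  have hs := summable_cov φ ψ
  rw [cov, hs.tsum_prod]
  have hrow : ∀ k, ∑' m, (coeff (k, m) φ * (starRingEnd ℂ) (coeff (k, m) ψ)).re /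
      bracket (k, m) ^ 2 ≤ ∫ p, R k p ∂(cellMeasure.prod cellMeasure) := by
    intro k
    have h1 := Complex.hasSum_re (hasSum_coeff_row k φ ψ)
    simp_rw [Complex.div_ofReal_re] at h1
    rw [h1.tsum_eq]
    refine (Complex.re_le_norm _).trans ((norm_integral_le_integral_norm _).trans (le_of_eq ?_))
    refine integral_congr_ae (Eventually.of_forall fun p => ?_)
    simp only
    rw [norm_mul, Complex.norm_real, mul_comm Complex.I, Complex.norm_exp_ofReal_mul_I, mul_one,
      Real.norm_of_nonneg (hR0 k p)]
  have hsr := hs.prod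
  refine hsr.tsum_le_of_sum_le fun F => (Finset.sum_le_sum fun k _ => hrow k).trans ?_
  rw [← integral_finsetSum _ fun k _ => hRint k]
  refine integral_mono_ae (integrable_finsetSum _ fun k _ => hRint k)
    (integrable_mul_of_continuous φ ψ integrable_logKernel_snd) ?_
  have hne : ∀ᵐ p ∂(cellMeasure.prod cellMeasure), p.1.2 - p.2.2 ≠ 0 := by
    have hm : MeasurableSet {p : (ℝ × ℝ) × (ℝ × ℝ) | p.1.2 - p.2.2 ≠ 0} :=
      (measurableSet_singleton (0 : ℝ)).compl.preimage
        (f := fun p : (ℝ × ℝ) × (ℝ × ℝ) => p.1.2 - p.2.2) (by fun_prop)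
    refine (Measure.ae_prod_iff_ae_ae hm).2 (Eventually.of_forall fun x => ?_)
    have h1 : ∀ᵐ y : ℝ × ℝ, y.2 ≠ x.2 :=
      Measure.quasiMeasurePreserving_snd.ae (Measure.ae_ne volume x.2)
    filter_upwards [ae_restrict_of_ae h1] with y hy
    exact sub_ne_zero.2 hy.symm
  filter_upwards [ae_prod_mem_cell, hne] with p hp hp0
  simp only [hR]
  rw [← Finset.mul_sum]
  exact mul_le_mul_of_nonneg_left
    (sum_resolventKernel_le_logKernel F hp0 (abs_sub_lt_two_pi hp.1.2 hp.2.2))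
    (mul_nonneg (hφ _) (hψ _))

lemma cov_swapTest (φ ψ : TestFunction) : cov (swapTest φ) (swapTest ψ) = cov φ ψ := by
  unfold cov
  rw [← (Equiv.prodComm ℤ ℤ).tsum_eq]
  refine tsum_congr fun n => ?_
  simp only [coeff_swapTest, Equiv.prodComm_apply, Prod.swap_swap]
  congr 2
  simp [bracket, add_comm]

lemma cov_le_integral_logKernel_fst {φ ψ : TestFunction} (hφ : ∀ x, 0 ≤ (φ : ℝ × ℝ → ℝ) x)
    (hψ : ∀ x, 0 ≤ (ψ : ℝ × ℝ → ℝ) x) :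
    cov φ ψ ≤ ∫ p : (ℝ × ℝ) × (ℝ × ℝ), (φ : ℝ × ℝ → ℝ) p.1 * (ψ : ℝ × ℝ → ℝ) p.2 *
      logKernel (p.1.1 - p.2.1) ∂(cellMeasure.prod cellMeasure) := by
  have h := cov_le_integral_logKernel_snd (φ := swapTest φ) (ψ := swapTest ψ)
    (fun x => hφ x.swap) (fun x => hψ x.swap)
  rw [cov_swapTest] at h
  refine h.trans (le_of_eq ?_)
  have hmp : MeasurePreserving (Prod.swap : ℝ × ℝ → ℝ × ℝ) cellMeasure cellMeasure := by
    rw [cellMeasure, volume_restrict_cell]; exact Measure.measurePreserving_swap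
  have he : MeasurableEmbedding (Prod.map Prod.swap Prod.swap :
      (ℝ × ℝ) × (ℝ × ℝ) → (ℝ × ℝ) × (ℝ × ℝ)) :=
    (MeasurableEquiv.prodCongr MeasurableEquiv.prodComm MeasurableEquiv.prodComm).measurableEmbedding
  exact (hmp.prod hmp).integral_comp he (fun p : (ℝ × ℝ) × (ℝ × ℝ) =>
    (φ : ℝ × ℝ → ℝ) p.1 * (ψ : ℝ × ℝ → ℝ) p.2 * logKernel (p.1.1 - p.2.1))

/-- The majorant of the exponential of `c` times the covariance of the field: up to bounded factors,
`|x₁ - y₁|^{-c/4π} |x₂ - y₂|^{-c/4π}` with distances taken on the circle. -/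
def expKernel (c : ℝ) (p : (ℝ × ℝ) × (ℝ × ℝ)) : ℝ :=
  Real.exp (c / 2 * logKernel (p.1.1 - p.2.1)) * Real.exp (c / 2 * logKernel (p.1.2 - p.2.2))

lemma expKernel_nonneg (c : ℝ) (p : (ℝ × ℝ) × (ℝ × ℝ)) : 0 ≤ expKernel c p := by
  unfold expKernel; positivity

lemma measurable_expKernel (c : ℝ) : Measurable (expKernel c) := by
  have := measurable_logKernel
  unfold expKernel
  fun_prop

lemma integrable_expKernel {c : ℝ} (hc0 : 0 < c) (hc : c < 4 * Real.pi) :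
    Integrable (expKernel c) (cellMeasure.prod cellMeasure) := by
  have hm := measurable_logKernel
  exact integrable_comp_sub_mul_comp_sub (by fun_prop) (by fun_prop)
    (integrableOn_exp_logKernel hc0 hc) (integrableOn_exp_logKernel hc0 hc)

/-- Jensen's inequality for the average of the logarithmic bounds in the two coordinates. -/
lemma exp_cov_le {φ ψ : TestFunction} (hφ : ∀ x, 0 ≤ (φ : ℝ × ℝ → ℝ) x)
    (hψ : ∀ x, 0 ≤ (ψ : ℝ × ℝ → ℝ) x) (hφ1 : ∫ x in cell, (φ : ℝ × ℝ → ℝ) x = 1)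
    (hψ1 : ∫ x in cell, (ψ : ℝ × ℝ → ℝ) x = 1) {c : ℝ} (hc0 : 0 < c) (hc : c < 4 * Real.pi) :
    Real.exp (c * cov φ ψ) ≤ ∫ p : (ℝ × ℝ) × (ℝ × ℝ),
      (φ : ℝ × ℝ → ℝ) p.1 * (ψ : ℝ × ℝ → ℝ) p.2 * expKernel c p
        ∂(cellMeasure.prod cellMeasure) := by
  set m : ℝ := c * cov φ ψ with hm
  set W : (ℝ × ℝ) × (ℝ × ℝ) → ℝ := fun p => (φ : ℝ × ℝ → ℝ) p.1 * (ψ : ℝ × ℝ → ℝ) p.2 with hW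
  have i0 : Integrable W (cellMeasure.prod cellMeasure) := by
    have h1 := continuous_coe φ
    have h2 := continuous_coe ψ
    exact integrable_prod_cell (by fun_prop)
  have i1 : Integrable (fun p => c / 2 * (W p * logKernel (p.1.1 - p.2.1)))
    (cellMeasure.prod cellMeasure) :=
    (integrable_mul_of_continuous φ ψ integrable_logKernel_fst).const_mul _
  have i2 : Integrable (fun p => c / 2 * (W p * logKernel (p.1.2 - p.2.2)))
    (cellMeasure.prod cellMeasure) :=
    (integrable_mul_of_continuous φ ψ integrable_logKernel_snd).const_mul _
  have i12 : Integrable (fun p => c / 2 * (W p * logKernel (p.1.1 - p.2.1)) +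
    c / 2 * (W p * logKernel (p.1.2 - p.2.2))) (cellMeasure.prod cellMeasure) := i1.add i2
  have iE := integrable_mul_of_continuous φ ψ (integrable_expKernel hc0 hc)
  have hW1 : ∫ p, W p ∂(cellMeasure.prod cellMeasure) = 1 := by
    rw [hW, integral_prod_mul, hφ1, hψ1, mul_one]
  have b1 := cov_le_integral_logKernel_fst hφ hψ
  have b2 := cov_le_integral_logKernel_snd hφ hψ
  -- The tangent line `e^m (1 + A - m) ≤ e^A`, integrated against the probability weight `W`.
  have key : ∫ p, Real.exp m * ((1 - m) * W p + (c / 2 * (W p * logKernel (p.1.1 - p.2.1)) +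
      c / 2 * (W p * logKernel (p.1.2 - p.2.2)))) ∂(cellMeasure.prod cellMeasure) ≤
      ∫ p, W p * expKernel c p ∂(cellMeasure.prod cellMeasure) := by
    refine integral_mono (((i0.const_mul _).add i12).const_mul _)
      iE fun p => ?_
    have h1 : Real.exp m * (1 - m + (c / 2 * logKernel (p.1.1 - p.2.1) +
        c / 2 * logKernel (p.1.2 - p.2.2))) ≤ expKernel c p := by
      rw [expKernel, ← Real.exp_add]
      set A := c / 2 * logKernel (p.1.1 - p.2.1) + c / 2 * logKernel (p.1.2 - p.2.2)
      have h2 : Real.exp A = Real.exp m * Real.exp (A - m) := by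
        rw [← Real.exp_add]; congr 1; ring
      rw [h2]
      exact mul_le_mul_of_nonneg_left (by linarith [Real.add_one_le_exp (A - m)])
        (Real.exp_pos m).le
    have h2 := mul_le_mul_of_nonneg_left h1 (mul_nonneg (hφ p.1) (hψ p.2))
    simp only [hW]
    linarith
  refine le_trans ?_ key
  rw [integral_const_mul, integral_add (i0.const_mul _) i12, integral_add i1 i2, integral_const_mul, integral_const_mul,
    integral_const_mul, hW1]
  have h3 : m ≤ c / 2 * ∫ p, W p * logKernel (p.1.1 - p.2.1) ∂(cellMeasure.prod cellMeasure) +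
      c / 2 * ∫ p, W p * logKernel (p.1.2 - p.2.2) ∂(cellMeasure.prod cellMeasure) := by
    have := mul_le_mul_of_nonneg_left b1 (by positivity : 0 ≤ c / 2)
    have := mul_le_mul_of_nonneg_left b2 (by positivity : 0 ≤ c / 2)
    rw [hm]
    linarith
  refine le_mul_of_one_le_right (Real.exp_pos m).le ?_
  linarith

/-- Mollified covariances have exponential moments bounded uniformly in the mollification. -/
lemma lintegral_exp_cov_le {k l : ℝ × ℝ → TestFunction}
    (hk0 : ∀ x y, 0 ≤ (k x : ℝ × ℝ → ℝ) y) (hl0 : ∀ x y, 0 ≤ (l x : ℝ × ℝ → ℝ) y)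
    (hkc : Continuous fun p : (ℝ × ℝ) × (ℝ × ℝ) => (k p.1 : ℝ × ℝ → ℝ) p.2)
    (hlc : Continuous fun p : (ℝ × ℝ) × (ℝ × ℝ) => (l p.1 : ℝ × ℝ → ℝ) p.2)
    (hk1 : ∀ x, ∫ y in cell, (k x : ℝ × ℝ → ℝ) y = 1)
    (hl1 : ∀ x, ∫ y in cell, (l x : ℝ × ℝ → ℝ) y = 1)
    (hk2 : ∀ y, ∫ x in cell, (k x : ℝ × ℝ → ℝ) y = 1)
    (hl2 : ∀ y, ∫ x in cell, (l x : ℝ × ℝ → ℝ) y = 1)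
    {c : ℝ} (hc0 : 0 < c) (hc : c < 4 * Real.pi) :
    ∫⁻ q, ENNReal.ofReal (Real.exp (c * cov (k q.1) (l q.2))) ∂(cellMeasure.prod cellMeasure) ≤
      ∫⁻ p, ENNReal.ofReal (expKernel c p) ∂(cellMeasure.prod cellMeasure) := by
  have hmE := measurable_expKernel c
  have hkm : Measurable fun p : (ℝ × ℝ) × (ℝ × ℝ) => (k p.1 : ℝ × ℝ → ℝ) p.2 := hkc.measurable
  have hlm : Measurable fun p : (ℝ × ℝ) × (ℝ × ℝ) => (l p.1 : ℝ × ℝ → ℝ) p.2 := hlc.measurable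
  have h1 : ∀ q : (ℝ × ℝ) × (ℝ × ℝ), ENNReal.ofReal (Real.exp (c * cov (k q.1) (l q.2))) ≤
      ∫⁻ p, ENNReal.ofReal ((k q.1 : ℝ × ℝ → ℝ) p.1) * ENNReal.ofReal ((l q.2 : ℝ × ℝ → ℝ) p.2) *
        ENNReal.ofReal (expKernel c p) ∂(cellMeasure.prod cellMeasure) := by
    intro q
    refine (ENNReal.ofReal_le_ofReal (exp_cov_le (hk0 q.1) (hl0 q.2) (hk1 q.1) (hl1 q.2)
      hc0 hc)).trans (le_of_eq ?_)
    rw [ofReal_integral_eq_lintegral_ofReal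
      (integrable_mul_of_continuous _ _ (integrable_expKernel hc0 hc))
      (Eventually.of_forall fun p => mul_nonneg (mul_nonneg (hk0 _ _) (hl0 _ _))
        (expKernel_nonneg c p))]
    refine lintegral_congr fun p => ?_
    rw [ENNReal.ofReal_mul (mul_nonneg (hk0 _ _) (hl0 _ _)), ENNReal.ofReal_mul (hk0 _ _)]
  have hunit : ∀ {h : ℝ × ℝ → ℝ}, Continuous h → (∀ x, 0 ≤ h x) → ∫ x in cell, h x = 1 →
      ∫⁻ x, ENNReal.ofReal (h x) ∂cellMeasure = 1 := by
    intro h hc h0 h1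
    rw [← ofReal_integral_eq_lintegral_ofReal (integrableOn_cell hc) (Eventually.of_forall h0), h1,
      ENNReal.ofReal_one]
  have hk3 : ∀ y, Continuous fun x => (k x : ℝ × ℝ → ℝ) y := fun y =>
    hkc.comp (continuous_id.prodMk continuous_const)
  have hl3 : ∀ y, Continuous fun x => (l x : ℝ × ℝ → ℝ) y := fun y =>
    hlc.comp (continuous_id.prodMk continuous_const)
  refine (lintegral_mono h1).trans ?_
  rw [lintegral_lintegral_swap]
  · refine lintegral_mono fun p => ?_
    rw [lintegral_mul_const]
    · rw [lintegral_prod_mul (f := fun x => ENNReal.ofReal ((k x : ℝ × ℝ → ℝ) p.1))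
        (g := fun x => ENNReal.ofReal ((l x : ℝ × ℝ → ℝ) p.2))
        (hk3 p.1).measurable.ennreal_ofReal.aemeasurable
        (hl3 p.2).measurable.ennreal_ofReal.aemeasurable,
        hunit (hk3 p.1) (fun x => hk0 x _) (hk2 p.1), hunit (hl3 p.2) (fun x => hl0 x _) (hl2 p.2)]
      simp
    · exact (((hk3 p.1).measurable.comp measurable_fst).ennreal_ofReal).mul
        (((hl3 p.2).measurable.comp measurable_snd).ennreal_ofReal)
  · refine Measurable.aemeasurable ?_
    refine ((Measurable.ennreal_ofReal ?_).mul (Measurable.ennreal_ofReal ?_)).mul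
      (hmE.comp measurable_snd).ennreal_ofReal
    · exact hkm.comp (by fun_prop : Measurable fun z :
        ((ℝ × ℝ) × (ℝ × ℝ)) × ((ℝ × ℝ) × (ℝ × ℝ)) => (z.1.1, z.2.1))
    · exact hlm.comp (by fun_prop : Measurable fun z :
        ((ℝ × ℝ) × (ℝ × ℝ)) × ((ℝ × ℝ) × (ℝ × ℝ)) => (z.1.2, z.2.2))

/-! ### Mollification in Fourier variables -/

lemma latticeVec_neg (k : ℤ × ℤ) : latticeVec (-k) = -latticeVec k := by
  ext <;> simp [latticeVec]

lemma periodize_neg_arg (f : ℝ × ℝ → ℝ) (hf : ∀ x, f (-x) = f x) (x : ℝ × ℝ) :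
    periodize f (-x) = periodize f x := by
  unfold periodize
  rw [← (Equiv.neg (ℤ × ℤ)).tsum_eq]
  refine tsum_congr fun k => ?_
  rw [Equiv.neg_apply, latticeVec_neg, ← neg_add, hf]

lemma kernel_apply (ρ : Mollifier) (N : ℕ) (x y : ℝ × ℝ) :
    (ρ.kernel N x : ℝ × ℝ → ℝ) y = periodize (ρ.scaled N) (x - y) := by
  change periodize (fun y => ρ.scaled N (x - y)) y = _
  unfold periodize
  rw [← (Equiv.neg (ℤ × ℤ)).tsum_eq]
  refine tsum_congr fun k => ?_
  rw [Equiv.neg_apply, latticeVec_neg]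
  exact congrArg (ρ.scaled N) (by abel)

lemma scaled_neg (ρ : Mollifier) (N : ℕ) (x : ℝ × ℝ) : ρ.scaled N (-x) = ρ.scaled N x := by
  rw [Mollifier.scaled, smul_neg, ρ.even, Mollifier.scaled]

lemma kernel_symm (ρ : Mollifier) (N : ℕ) (x y : ℝ × ℝ) :
    (ρ.kernel N x : ℝ × ℝ → ℝ) y = (ρ.kernel N y : ℝ × ℝ → ℝ) x := by
  rw [kernel_apply, kernel_apply, ← periodize_neg_arg _ (scaled_neg ρ N), neg_sub]

lemma kernel_eq_translate (ρ : Mollifier) (N : ℕ) (x y : ℝ × ℝ) :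
    (ρ.kernel N x : ℝ × ℝ → ℝ) y = (ρ.kernel N 0 : ℝ × ℝ → ℝ) (y - x) := by
  rw [kernel_apply, kernel_apply, zero_sub, neg_sub]

lemma kernel_nonneg (ρ : Mollifier) (N : ℕ) (x y : ℝ × ℝ) :
    0 ≤ (ρ.kernel N x : ℝ × ℝ → ℝ) y :=
  tsum_nonneg fun _ => mul_nonneg (sq_nonneg _) (ρ.nonneg _)

lemma continuous_kernel (ρ : Mollifier) (N : ℕ) :
    Continuous fun p : (ℝ × ℝ) × (ℝ × ℝ) => (ρ.kernel N p.1 : ℝ × ℝ → ℝ) p.2 := by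
  rw [show (fun p : (ℝ × ℝ) × (ℝ × ℝ) => (ρ.kernel N p.1 : ℝ × ℝ → ℝ) p.2) =
    fun p => (ρ.kernel N 0 : ℝ × ℝ → ℝ) (p.2 - p.1) from
      funext fun p => kernel_eq_translate ρ N p.1 p.2]
  exact (continuous_coe _).comp (by fun_prop)

/-- A periodization integrated over the cell against a periodic function unfolds to an integral over
the plane. -/
lemma integral_cell_mul_periodize {e : ℝ × ℝ → ℂ} {f : ℝ × ℝ → ℝ}
    (hper : ∀ x k, e (x + latticeVec k) = e x)
    (hint : Integrable fun y => e y * (f y : ℂ)) :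
    ∫ y in cell, e y * (periodize f y : ℂ) = ∫ y, e y * (f y : ℂ) := by
  set s : ℤ × ℤ → Set (ℝ × ℝ) := fun k => (fun y => y + latticeVec k) ⁻¹' cell with hs
  have hsm : ∀ k, MeasurableSet (s k) := fun k =>
    measurableSet_cell.preimage (measurable_add_const _)
  have hU : ⋃ k, s k = univ := eq_univ_of_forall fun x => by
    obtain ⟨k, hk⟩ := exists_add_latticeVec_mem_cell x
    exact mem_iUnion.2 ⟨k, hk⟩
  have hdisj : Pairwise (Function.onFun Disjoint s) := by
    intro k l hkl
    refine disjoint_left.2 fun x hk hl => hkl ?_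
    have h2 : (0 : ℝ) < 2 * Real.pi := by positivity
    have uniq : ∀ (r : ℝ) (a b : ℤ), r + 2 * Real.pi * a ∈ Ico (-Real.pi) Real.pi →
        r + 2 * Real.pi * b ∈ Ico (-Real.pi) Real.pi → a = b := by
      intro r a b ha hb
      have hIco : Ico (-Real.pi) Real.pi = Ico (-Real.pi) (-Real.pi + 2 * Real.pi) := by
        congr 1; ring
      rw [hIco] at ha hb
      refine (existsUnique_add_zsmul_mem_Ico h2 r (-Real.pi)).unique ?_ ?_
      · rwa [zsmul_eq_mul, mul_comm (a : ℝ)]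
      · rwa [zsmul_eq_mul, mul_comm (b : ℝ)]
    exact Prod.ext (uniq _ _ _ hk.1 hl.1) (uniq _ _ _ hk.2 hl.2)
  have hshift : ∀ {E : Type} [NormedAddCommGroup E] [NormedSpace ℝ E] (G : ℝ × ℝ → E)
      (k : ℤ × ℤ), ∫ y in s k, G (y + latticeVec k) = ∫ y in cell, G y := fun G k =>
    (measurePreserving_add_right volume (latticeVec k)).setIntegral_preimage_emb
      (measurableEmbedding_addRight _) G cell
  have hmain : ∀ {E : Type} [NormedAddCommGroup E] [NormedSpace ℝ E] {G : ℝ × ℝ → E},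
      Integrable G → HasSum (fun k => ∫ y in cell, G (y + latticeVec k)) (∫ y, G y) := by
    intro E _ _ G hG
    have h := hasSum_integral_iUnion hsm hdisj (f := G) (by rw [hU]; exact hG.integrableOn)
    rw [hU, setIntegral_univ] at h
    have h2 := (Equiv.neg (ℤ × ℤ)).hasSum_iff.2 h
    convert! h2 using 2 with k
    rw [Function.comp_apply, Equiv.neg_apply, ← hshift _ (-k)]
    simp [latticeVec_neg]
  have hG1 := hmain hint
  have hG2 := hmain hint.norm
  have h3 := hasSum_integral_of_summable_integral_norm (μ := volume.restrict cell)
    (F := fun k y => e (y + latticeVec k) * (f (y + latticeVec k) : ℂ))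
    (fun k => (hint.comp_add_right (latticeVec k)).integrableOn) hG2.summable
  rw [← h3.unique hG1]
  refine integral_congr_ae (Eventually.of_forall fun y => ?_)
  simp only [hper]
  rw [tsum_mul_left, periodize, Complex.ofReal_tsum]

/-- The Fourier multiplier `∫ ρ(y) e^{-i n·y/N} dy` of the smoothing operator `Q_N`. -/
def mollMultiplier (ρ : Mollifier) (N : ℕ) (n : ℤ × ℤ) : ℂ :=
  ∫ y : ℝ × ℝ, Complex.exp (-(Complex.I * ((n.1 * y.1 + n.2 * y.2 : ℝ) / N : ℝ))) * (ρ.toFun y : ℂ)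

lemma Mollifier.hasCompactSupport (ρ : Mollifier) : HasCompactSupport ρ.toFun :=
  HasCompactSupport.of_support_subset_isCompact
    (isCompact_Icc.prod isCompact_Icc : IsCompact (Icc (-Real.pi) Real.pi ×ˢ Icc (-Real.pi) Real.pi))
    ((subset_tsupport _).trans (ρ.support_subset.trans cell_subset_Icc))

lemma Mollifier.integrable (ρ : Mollifier) : Integrable ρ.toFun :=
  ρ.smooth.continuous.integrable_of_hasCompactSupport ρ.hasCompactSupport

lemma Mollifier.integrable_ofReal (ρ : Mollifier) : Integrable fun y => (ρ.toFun y : ℂ) :=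
  ρ.integrable.ofReal

lemma norm_exp_neg_I_mul (t : ℝ) : ‖Complex.exp (-(Complex.I * t))‖ = 1 := by
  rw [← mul_neg, ← Complex.ofReal_neg, mul_comm, Complex.norm_exp_ofReal_mul_I]

lemma integrable_exp_mul_mollifier (ρ : Mollifier) {θ : ℝ × ℝ → ℝ} (hθ : Continuous θ) :
    Integrable fun y => Complex.exp (-(Complex.I * (θ y : ℂ))) * (ρ.toFun y : ℂ) :=
  ρ.integrable_ofReal.bdd_mul (c := 1) (Continuous.aestronglyMeasurable (by fun_prop))
    (Eventually.of_forall fun y => (norm_exp_neg_I_mul _).le)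

lemma norm_mollMultiplier_le_one (ρ : Mollifier) (N : ℕ) (n : ℤ × ℤ) :
    ‖mollMultiplier ρ N n‖ ≤ 1 := by
  refine (norm_integral_le_integral_norm _).trans (le_of_eq ?_)
  rw [← ρ.integral_eq_one]
  refine integral_congr_ae (Eventually.of_forall fun y => ?_)
  simp only [norm_mul, norm_exp_neg_I_mul, one_mul, Complex.norm_real]
  exact Real.norm_of_nonneg (ρ.nonneg y)

lemma norm_mollMultiplier_sub_one_le (ρ : Mollifier) {N : ℕ} (hN : 1 ≤ N) (n : ℤ × ℤ) :
    ‖mollMultiplier ρ N n - 1‖ ≤ 2 * Real.pi * bracket n / N := by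
  have hN0 : (0 : ℝ) < N := by exact_mod_cast hN
  have hb := bracket_pos n
  have h1 : (1 : ℂ) = ∫ y, (ρ.toFun y : ℂ) := by
    rw [integral_complex_ofReal, ρ.integral_eq_one, Complex.ofReal_one]
  rw [mollMultiplier, h1, ← integral_sub (integrable_exp_mul_mollifier ρ
    (θ := fun y => (n.1 * y.1 + n.2 * y.2) / N) (by fun_prop))
    ρ.integrable_ofReal]
  have h2 : 2 * Real.pi * bracket n / N = ∫ y, 2 * Real.pi * bracket n / N * ρ.toFun y := by
    rw [integral_const_mul, ρ.integral_eq_one, mul_one]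
  rw [h2]
  refine norm_integral_le_of_norm_le (ρ.integrable.const_mul _) (Eventually.of_forall fun y => ?_)
  by_cases hy : ρ.toFun y = 0
  · simp [hy]
  have hmem := cell_subset_Icc (ρ.support_subset (subset_tsupport _ hy))
  rw [← sub_one_mul, norm_mul, Complex.norm_real, Real.norm_of_nonneg (ρ.nonneg y)]
  refine mul_le_mul_of_nonneg_right ?_ (ρ.nonneg y)
  rw [← mul_neg, ← Complex.ofReal_neg]
  refine (Real.norm_exp_I_mul_ofReal_sub_one_le).trans ?_
  rw [norm_neg, norm_div, Real.norm_of_nonneg hN0.le, Real.norm_eq_abs]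
  refine div_le_div_of_nonneg_right ?_ hN0.le
  have a1 : |(n.1 : ℝ)| ≤ bracket n := Real.abs_le_sqrt (by nlinarith [sq_nonneg (n.2 : ℝ)])
  have a2 : |(n.2 : ℝ)| ≤ bracket n := Real.abs_le_sqrt (by nlinarith [sq_nonneg (n.1 : ℝ)])
  refine (abs_add_le _ _).trans ?_
  rw [abs_mul, abs_mul]
  have b1 : |y.1| ≤ Real.pi := abs_le.2 hmem.1
  have b2 : |y.2| ≤ Real.pi := abs_le.2 hmem.2
  have c1 := mul_le_mul a1 b1 (abs_nonneg _) hb.le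
  have c2 := mul_le_mul a2 b2 (abs_nonneg _) hb.le
  linarith

lemma integral_exp_mul_scaled (ρ : Mollifier) {N : ℕ} (hN : 1 ≤ N) (n : ℤ × ℤ) :
    ∫ z : ℝ × ℝ, Complex.exp (-(Complex.I * ((n.1 * z.1 + n.2 * z.2 : ℝ) : ℂ))) *
      (ρ.scaled N z : ℂ) = mollMultiplier ρ N n := by
  have hN0 : (N : ℝ) ≠ 0 := by exact_mod_cast (by omega : N ≠ 0)
  have h := Measure.integral_comp_smul (volume : Measure (ℝ × ℝ))
    (fun y : ℝ × ℝ => Complex.exp (-(Complex.I * ((n.1 * y.1 + n.2 * y.2 : ℝ) / N : ℝ))) *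
      (ρ.toFun y : ℂ)) (N : ℝ)
  have hfr : Module.finrank ℝ (ℝ × ℝ) = 2 := by simp
  rw [hfr, abs_of_nonneg (by positivity)] at h
  change _ = _ • mollMultiplier ρ N n at h
  have h2 : mollMultiplier ρ N n = ((N : ℝ) ^ 2) • ((((N : ℝ) ^ 2)⁻¹) • mollMultiplier ρ N n) := by
    rw [smul_smul, mul_inv_cancel₀ (by positivity), one_smul]
  rw [h2, ← h, ← integral_smul]
  refine integral_congr_ae (Eventually.of_forall fun z => ?_)
  simp only [Mollifier.scaled, Prod.smul_fst, Prod.smul_snd, smul_eq_mul, Complex.real_smul]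
  have e1 : (n.1 * (N * z.1) + n.2 * (N * z.2)) / (N : ℝ) = n.1 * z.1 + n.2 * z.2 := by
    field_simp
  rw [e1]
  push_cast
  ring

lemma integrable_scaled (ρ : Mollifier) {N : ℕ} (hN : 1 ≤ N) : Integrable (ρ.scaled N) := by
  have hN0 : (N : ℝ) ≠ 0 := by exact_mod_cast (by omega : N ≠ 0)
  exact (ρ.integrable.comp_smul hN0).const_mul _

lemma coeff_kernel (ρ : Mollifier) {N : ℕ} (hN : 1 ≤ N) (x : ℝ × ℝ) (n : ℤ × ℤ) :
    coeff n (ρ.kernel N x) = fourierBasis n x * mollMultiplier ρ N n := by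
  have hint : Integrable fun y => fourierBasis n y * (ρ.scaled N (x - y) : ℂ) :=
    (((integrable_scaled ρ hN).comp_sub_left x).ofReal).bdd_mul (c := (2 * Real.pi)⁻¹)
      (continuous_fourierBasis n).aestronglyMeasurable
      (Eventually.of_forall fun y => (norm_fourierBasis n y).le)
  have h1 := integral_cell_mul_periodize (fourierBasis_periodic n) hint
  change coeff n (ρ.kernel N x) = _ at h1
  rw [h1, ← integral_exp_mul_scaled ρ hN, ← integral_const_mul,
    ← integral_sub_left_eq_self _ volume x]
  refine integral_congr_ae (Eventually.of_forall fun z => ?_)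
  simp only [sub_sub_cancel, fourierBasis, Prod.fst_sub, Prod.snd_sub]
  rw [mul_assoc, mul_assoc, ← mul_assoc (Complex.exp _) (Complex.exp _), ← Complex.exp_add]
  congr 3
  push_cast
  ring_nf

lemma integral_kernel (ρ : Mollifier) {N : ℕ} (hN : 1 ≤ N) (x : ℝ × ℝ) :
    ∫ y in cell, (ρ.kernel N x : ℝ × ℝ → ℝ) y = 1 := by
  have h1 := coeff_kernel ρ hN x 0
  have h2 : mollMultiplier ρ N 0 = 1 := by
    simp [mollMultiplier, integral_complex_ofReal, ρ.integral_eq_one]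
  have h3 : ∀ y, fourierBasis 0 y = ((2 * Real.pi)⁻¹ : ℝ) := fun y => by simp [fourierBasis]
  rw [h2, coeff] at h1
  simp_rw [h3] at h1
  rw [integral_const_mul, integral_complex_ofReal] at h1
  have h4 : (((2 * Real.pi)⁻¹ : ℝ) : ℂ) ≠ 0 := by
    have : (2 * Real.pi)⁻¹ ≠ 0 := by positivity
    exact_mod_cast this
  exact_mod_cast mul_left_cancel₀ h4 h1

lemma integral_kernel_fst (ρ : Mollifier) {N : ℕ} (hN : 1 ≤ N) (y : ℝ × ℝ) :
    ∫ x in cell, (ρ.kernel N x : ℝ × ℝ → ℝ) y = 1 := by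
  simp_rw [kernel_symm ρ N _ y]
  exact integral_kernel ρ hN y

/-- The covariance of the mollified fields `Q_N u (x)` and `Q_M u (y)`. -/
def mollCov (ρ : Mollifier) (N M : ℕ) (p : (ℝ × ℝ) × (ℝ × ℝ)) : ℝ :=
  cov (ρ.kernel N p.1) (ρ.kernel M p.2)

/-- The variance of `Q_N u (x)` does not depend on `x`. -/
lemma cov_kernel_self (ρ : Mollifier) {N : ℕ} (hN : 1 ≤ N) (x : ℝ × ℝ) :
    cov (ρ.kernel N x) (ρ.kernel N x) = sigma ρ N := by
  rw [sigma]
  simp only [smoothing]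
  rw [integral_eval_sq]
  refine tsum_congr fun n => ?_
  simp only [Complex.mul_conj, Complex.normSq_eq_norm_sq, coeff_kernel ρ hN, norm_mul,
    norm_fourierBasis]

/-! ### Square-mean convergence of the mollified covariances -/

lemma integral_fourierBasis_eq_zero {n : ℤ × ℤ} (hn : n ≠ 0) :
    ∫ x in cell, fourierBasis n x = 0 := by
  have key : ∀ m : ℤ × ℤ, m.2 ≠ 0 → ∫ x in cell, fourierBasis m x = 0 := by
    intro m hm
    have h := integral_cell_deriv_snd (f := fourierBasis m) (g := fun _ => 1) (g' := fun _ => 0)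
      _ (continuous_fourierBasis m) continuous_const continuous_const
      (hasDerivAt_fourierBasis_snd m) (fun x => hasDerivAt_const _ _) (fourierBasis_periodic m)
      (fun _ _ => rfl)
    simp only [mul_zero, integral_zero, mul_one] at h
    have hc : -(Complex.I * (m.2 : ℂ)) ≠ 0 :=
      neg_ne_zero.2 (mul_ne_zero Complex.I_ne_zero (by exact_mod_cast hm))
    exact (mul_eq_zero.1 h.symm).resolve_left hc
  by_cases h2 : n.2 = 0
  · have h1 : n.1 ≠ 0 := fun h1 => hn (Prod.ext h1 h2)
    rw [← integral_cell_swap, ← key n.swap h1]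
    refine integral_congr_ae (Eventually.of_forall fun x => ?_)
    simp [fourierBasis, add_comm]
  · exact key n h2

lemma integral_fourierBasis_mul_conj (n m : ℤ × ℤ) :
    ∫ x in cell, fourierBasis n x * (starRingEnd ℂ) (fourierBasis m x) = if n = m then 1 else 0 := by
  have h1 : ∀ x, fourierBasis n x * (starRingEnd ℂ) (fourierBasis m x) =
      (((2 * Real.pi)⁻¹ : ℝ) : ℂ) * fourierBasis (n - m) x := by
    intro x
    simp only [fourierBasis, map_mul, Complex.conj_ofReal, ← Complex.exp_conj, Complex.conj_I]
    rw [mul_mul_mul_comm, ← Complex.exp_add, mul_assoc]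
    congr 3
    push_cast [Prod.fst_sub, Prod.snd_sub]
    ring
  simp_rw [h1]
  rw [integral_const_mul]
  split_ifs with h
  · have h2 : ∀ x, fourierBasis (n - m) x = (((2 * Real.pi)⁻¹ : ℝ) : ℂ) := fun x => by
      simp [fourierBasis, h]
    have h3 : volume.real cell = (2 * Real.pi) * (2 * Real.pi) := by
      rw [measureReal_def, cell, Measure.volume_eq_prod, Measure.prod_prod, Real.volume_Ico,
        ENNReal.toReal_mul, ENNReal.toReal_ofReal (by linarith [Real.pi_pos])]
      ring
    simp_rw [h2]
    rw [setIntegral_const, h3, Complex.real_smul]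
    have hpi : (Real.pi : ℂ) ≠ 0 := by exact_mod_cast Real.pi_ne_zero
    push_cast
    field_simp
  · rw [integral_fourierBasis_eq_zero (sub_ne_zero.2 h), mul_zero]

/-- The function `e_n(x) conj e_n(y)` on the square of the torus. -/
def doubleBasis (n : ℤ × ℤ) (p : (ℝ × ℝ) × (ℝ × ℝ)) : ℂ :=
  fourierBasis n p.1 * (starRingEnd ℂ) (fourierBasis n p.2)

lemma continuous_doubleBasis (n : ℤ × ℤ) : Continuous (doubleBasis n) :=
  ((continuous_fourierBasis n).comp continuous_fst).mul
    (Complex.continuous_conj.comp ((continuous_fourierBasis n).comp continuous_snd))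

lemma norm_doubleBasis_le (n : ℤ × ℤ) (p : (ℝ × ℝ) × (ℝ × ℝ)) : ‖doubleBasis n p‖ ≤ 1 := by
  rw [doubleBasis, norm_mul, Complex.norm_conj, norm_fourierBasis, norm_fourierBasis]
  have : (2 * Real.pi)⁻¹ ≤ 1 := inv_le_one_of_one_le₀ (by linarith [Real.pi_gt_three])
  exact mul_le_one₀ this (by positivity) this

lemma integral_doubleBasis_mul_conj (n m : ℤ × ℤ) :
    ∫ p, doubleBasis n p * (starRingEnd ℂ) (doubleBasis m p) ∂(cellMeasure.prod cellMeasure) =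
      if n = m then 1 else 0 := by
  have h1 : ∀ p, doubleBasis n p * (starRingEnd ℂ) (doubleBasis m p) =
      (fourierBasis n p.1 * (starRingEnd ℂ) (fourierBasis m p.1)) *
        (fourierBasis m p.2 * (starRingEnd ℂ) (fourierBasis n p.2)) := fun p => by
    simp only [doubleBasis, map_mul, Complex.conj_conj]
    ring
  simp_rw [h1]
  rw [integral_prod_mul (f := fun x => fourierBasis n x * (starRingEnd ℂ) (fourierBasis m x))
    (g := fun x => fourierBasis m x * (starRingEnd ℂ) (fourierBasis n x)),
    integral_fourierBasis_mul_conj, integral_fourierBasis_mul_conj]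
  by_cases h : n = m
  · simp [h]
  · simp [h]

lemma integral_norm_sq_sum_doubleBasis (d : ℤ × ℤ → ℂ) (s : Finset (ℤ × ℤ)) :
    ∫ p, ‖∑ n ∈ s, d n * doubleBasis n p‖ ^ 2 ∂(cellMeasure.prod cellMeasure) =
      ∑ n ∈ s, ‖d n‖ ^ 2 := by
  have h1 : ∀ p, ((‖∑ n ∈ s, d n * doubleBasis n p‖ ^ 2 : ℝ) : ℂ) = ∑ n ∈ s, ∑ m ∈ s,
      d n * (starRingEnd ℂ) (d m) * (doubleBasis n p * (starRingEnd ℂ) (doubleBasis m p)) := by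
    intro p
    rw [← Complex.normSq_eq_norm_sq, ← Complex.mul_conj, map_sum, Finset.sum_mul_sum]
    refine Finset.sum_congr rfl fun n _ => Finset.sum_congr rfl fun m _ => ?_
    rw [map_mul]; ring
  have hint : ∀ n m : ℤ × ℤ, Integrable (fun p => d n * (starRingEnd ℂ) (d m) *
      (doubleBasis n p * (starRingEnd ℂ) (doubleBasis m p))) (cellMeasure.prod cellMeasure) :=
    fun n m => integrable_prod_cell (continuous_const.mul ((continuous_doubleBasis n).mul
      (Complex.continuous_conj.comp (continuous_doubleBasis m))))
  apply Complex.ofReal_injective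
  rw [← integral_complex_ofReal]
  simp_rw [h1]
  rw [integral_finsetSum _ fun n _ => integrable_finsetSum _ fun m _ => hint n m]
  push_cast
  refine Finset.sum_congr rfl fun n hn => ?_
  rw [integral_finsetSum _ fun m _ => hint n m]
  simp_rw [integral_const_mul, integral_doubleBasis_mul_conj]
  simp only [mul_ite, mul_one, mul_zero, Finset.sum_ite_eq, hn, if_true]
  rw [Complex.mul_conj, Complex.normSq_eq_norm_sq]
  push_cast; rfl

/-- Bessel's inequality for an absolutely convergent double Fourier series. -/
lemma integral_norm_sq_tsum_doubleBasis_le {d : ℤ × ℤ → ℂ} (hd : Summable fun n => ‖d n‖)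
    {B : ℝ} (hB : ∀ s : Finset (ℤ × ℤ), ∑ n ∈ s, ‖d n‖ ^ 2 ≤ B) :
    ∫ p, ‖∑' n, d n * doubleBasis n p‖ ^ 2 ∂(cellMeasure.prod cellMeasure) ≤ B := by
  have hb : ∀ n p, ‖d n * doubleBasis n p‖ ≤ ‖d n‖ := fun n p => by
    rw [norm_mul]
    exact mul_le_of_le_one_right (norm_nonneg _) (norm_doubleBasis_le n p)
  have hlim : Tendsto (fun s : Finset (ℤ × ℤ) =>
      ∫ p, ‖∑ n ∈ s, d n * doubleBasis n p‖ ^ 2 ∂(cellMeasure.prod cellMeasure)) atTop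
      (𝓝 (∫ p, ‖∑' n, d n * doubleBasis n p‖ ^ 2 ∂(cellMeasure.prod cellMeasure))) := by
    refine tendsto_integral_filter_of_dominated_convergence (fun _ => (∑' n, ‖d n‖) ^ 2)
      (Eventually.of_forall fun s => ?_) (Eventually.of_forall fun s =>
        Eventually.of_forall fun p => ?_) (integrable_const _) (Eventually.of_forall fun p => ?_)
    · have := continuous_doubleBasis
      exact Continuous.aestronglyMeasurable (by fun_prop)
    · rw [norm_pow, norm_norm]
      refine pow_le_pow_left₀ (norm_nonneg _) ((norm_sum_le _ _).trans ?_) 2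
      exact (Finset.sum_le_sum fun n _ => hb n p).trans
        (hd.sum_le_tsum s fun n _ => norm_nonneg _)
    · exact ((Summable.of_norm_bounded hd fun n => hb n p).hasSum.norm).pow 2
  refine le_of_tendsto' hlim fun s => ?_
  rw [integral_norm_sq_sum_doubleBasis]
  exact hB s

lemma summable_norm_mollMultiplier (ρ : Mollifier) {N : ℕ} (hN : 1 ≤ N) (M : ℕ) :
    Summable fun n => ‖mollMultiplier ρ N n * (starRingEnd ℂ) (mollMultiplier ρ M n) /
      ((bracket n ^ 2 : ℝ) : ℂ)‖ := by
  obtain ⟨C, hC0, hC⟩ := exists_coeff_decay (ρ.kernel N 0)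
  refine Summable.of_nonneg_of_le (fun n => norm_nonneg _) (fun n => ?_)
    (summable_inv_bracket_pow_four.mul_left (2 * Real.pi * C))
  have hb := bracket_pos n
  have h1 := hC n
  rw [coeff_kernel ρ hN, norm_mul, norm_fourierBasis, inv_mul_le_iff₀ (by positivity)] at h1
  have h2 := norm_mollMultiplier_le_one ρ M n
  rw [norm_div, norm_mul, Complex.norm_conj, Complex.norm_real,
    Real.norm_of_nonneg (by positivity : 0 ≤ bracket n ^ 2)]
  calc _ ≤ (2 * Real.pi * (C / bracket n ^ 2)) * 1 / bracket n ^ 2 := by gcongr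
    _ = _ := by field_simp

lemma mollCov_eq_re_tsum (ρ : Mollifier) {N M : ℕ} (hN : 1 ≤ N) (hM : 1 ≤ M)
    (p : (ℝ × ℝ) × (ℝ × ℝ)) :
    mollCov ρ N M p = (∑' n, mollMultiplier ρ N n * (starRingEnd ℂ) (mollMultiplier ρ M n) /
      ((bracket n ^ 2 : ℝ) : ℂ) * doubleBasis n p).re := by
  have hs : Summable fun n => mollMultiplier ρ N n * (starRingEnd ℂ) (mollMultiplier ρ M n) /
      ((bracket n ^ 2 : ℝ) : ℂ) * doubleBasis n p :=
    Summable.of_norm_bounded (summable_norm_mollMultiplier ρ hN M) fun n => by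
      rw [norm_mul]
      exact mul_le_of_le_one_right (norm_nonneg _) (norm_doubleBasis_le n p)
  rw [Complex.re_tsum hs, mollCov, cov]
  refine tsum_congr fun n => ?_
  rw [coeff_kernel ρ hN, coeff_kernel ρ hM, ← Complex.div_ofReal_re, doubleBasis]
  congr 1
  rw [map_mul]
  ring

lemma continuous_mollCov (ρ : Mollifier) {N M : ℕ} (hN : 1 ≤ N) (hM : 1 ≤ M) :
    Continuous (mollCov ρ N M) := by
  rw [funext (mollCov_eq_re_tsum ρ hN hM)]
  refine Complex.continuous_re.comp (continuous_tsum (fun n => continuous_const.mul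
    (continuous_doubleBasis n)) (summable_norm_mollMultiplier ρ hN M) fun n p => ?_)
  rw [norm_mul]
  exact mul_le_of_le_one_right (norm_nonneg _) (norm_doubleBasis_le n p)

/-- The mollified covariances form a Cauchy family in `L²(𝕋² × 𝕋²)`, with a rate. -/
lemma integral_sq_mollCov_sub_le (ρ : Mollifier) {N M N' M' : ℕ} (hN : 1 ≤ N) (hM : 1 ≤ M)
    (hN' : 1 ≤ N') (hM' : 1 ≤ M') :
    ∫ p, (mollCov ρ N M p - mollCov ρ N' M' p) ^ 2 ∂(cellMeasure.prod cellMeasure) ≤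
      4 * Real.pi * (1 / N + 1 / M + 1 / N' + 1 / M') * ∑' n : ℤ × ℤ, 1 / bracket n ^ 3 := by
  set δ : ℝ := 1 / N + 1 / M + 1 / N' + 1 / M' with hδ
  set d₁ : ℤ × ℤ → ℂ := fun n => mollMultiplier ρ N n * (starRingEnd ℂ) (mollMultiplier ρ M n) /
      ((bracket n ^ 2 : ℝ) : ℂ) with hd₁
  set d₂ : ℤ × ℤ → ℂ := fun n => mollMultiplier ρ N' n * (starRingEnd ℂ) (mollMultiplier ρ M' n) /
      ((bracket n ^ 2 : ℝ) : ℂ) with hd₂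
  have s₁ : Summable fun n => ‖d₁ n‖ := summable_norm_mollMultiplier ρ hN M
  have s₂ : Summable fun n => ‖d₂ n‖ := summable_norm_mollMultiplier ρ hN' M'
  have s : Summable fun n => ‖d₁ n - d₂ n‖ :=
    Summable.of_nonneg_of_le (fun n => norm_nonneg _) (fun n => norm_sub_le _ _) (s₁.add s₂)
  have hmul : ∀ {d : ℤ × ℤ → ℂ}, (Summable fun n => ‖d n‖) → ∀ p,
      Summable fun n => d n * doubleBasis n p := fun hd p =>
    Summable.of_norm_bounded hd fun n => by
      rw [norm_mul]
      exact mul_le_of_le_one_right (norm_nonneg _) (norm_doubleBasis_le n p)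
  have hpt : ∀ p, (mollCov ρ N M p - mollCov ρ N' M' p) ^ 2 ≤
      ‖∑' n, (d₁ n - d₂ n) * doubleBasis n p‖ ^ 2 := by
    intro p
    rw [mollCov_eq_re_tsum ρ hN hM, mollCov_eq_re_tsum ρ hN' hM', ← Complex.sub_re,
      ← (hmul s₁ p).tsum_sub (hmul s₂ p)]
    simp_rw [← sub_mul]
    rw [← sq_abs]
    exact pow_le_pow_left₀ (abs_nonneg _) (Complex.abs_re_le_norm _) 2
  have hcont : Continuous fun p => ‖∑' n, (d₁ n - d₂ n) * doubleBasis n p‖ ^ 2 := by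
    refine (Continuous.norm (continuous_tsum (fun n => continuous_const.mul
      (continuous_doubleBasis n)) s fun n p => ?_)).pow 2
    change ‖(d₁ n - d₂ n) * doubleBasis n p‖ ≤ _
    rw [norm_mul]
    exact mul_le_of_le_one_right (norm_nonneg _) (norm_doubleBasis_le n p)
  refine (integral_mono (integrable_prod_cell (((continuous_mollCov ρ hN hM).sub
    (continuous_mollCov ρ hN' hM')).pow 2)) (integrable_prod_cell hcont) hpt).trans ?_
  refine integral_norm_sq_tsum_doubleBasis_le s fun F => ?_
  have hδ0 : 0 ≤ δ := by positivity
  have hterm : ∀ n, ‖d₁ n - d₂ n‖ ^ 2 ≤ 4 * Real.pi * δ * (1 / bracket n ^ 3) := by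
    intro n
    have hb := bracket_pos n
    have q1 := norm_mollMultiplier_sub_one_le ρ hN n
    have q2 := norm_mollMultiplier_sub_one_le ρ hM n
    have q3 := norm_mollMultiplier_sub_one_le ρ hN' n
    have q4 := norm_mollMultiplier_sub_one_le ρ hM' n
    have hprod : ∀ a b : ℂ, ‖a‖ ≤ 1 → ‖a * (starRingEnd ℂ) b - 1‖ ≤ ‖a - 1‖ + ‖b - 1‖ := by
      intro a b ha
      have : a * (starRingEnd ℂ) b - 1 = a * (starRingEnd ℂ) (b - 1) + (a - 1) := by
        rw [map_sub, map_one]; ring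
      rw [this]
      refine (norm_add_le _ _).trans ?_
      rw [norm_mul, Complex.norm_conj]
      linarith [mul_le_of_le_one_left (norm_nonneg (b - 1)) ha]
    have hone : ∀ a b : ℂ, ‖a‖ ≤ 1 → ‖b‖ ≤ 1 → ‖a * (starRingEnd ℂ) b‖ ≤ 1 := by
      intro a b ha hb
      rw [norm_mul, Complex.norm_conj]
      exact mul_le_one₀ ha (norm_nonneg _) hb
    have r := fun K => norm_mollMultiplier_le_one ρ K n
    set A := mollMultiplier ρ N n * (starRingEnd ℂ) (mollMultiplier ρ M n) with hA
    set B := mollMultiplier ρ N' n * (starRingEnd ℂ) (mollMultiplier ρ M' n) with hB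
    have t1 : ‖A - B‖ ≤ 2 := (norm_sub_le _ _).trans (by
      linarith [hone _ _ (r N) (r M), hone _ _ (r N') (r M')])
    have t2 : ‖A - B‖ ≤ 2 * Real.pi * bracket n * δ := by
      have : A - B = (A - 1) - (B - 1) := by ring
      rw [this]
      refine (norm_sub_le _ _).trans ?_
      have u1 := hprod _ (mollMultiplier ρ M n) (r N)
      have u2 := hprod _ (mollMultiplier ρ M' n) (r N')
      have : 2 * Real.pi * bracket n * δ = 2 * Real.pi * bracket n / N +
          2 * Real.pi * bracket n / M + 2 * Real.pi * bracket n / N' +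
          2 * Real.pi * bracket n / M' := by rw [hδ]; ring
      linarith
    -- Only a factor `⟨n⟩ / N` is affordable: with its square the sum over `n` would diverge.
    have t3 : ‖A - B‖ ^ 2 ≤ 2 * (2 * Real.pi * bracket n * δ) := by
      rw [sq]; exact mul_le_mul t1 t2 (norm_nonneg _) (by norm_num)
    have : d₁ n - d₂ n = (A - B) / ((bracket n ^ 2 : ℝ) : ℂ) := by
      simp only [hd₁, hd₂, hA, hB]; ring
    rw [this, norm_div, Complex.norm_real, Real.norm_of_nonneg (by positivity : 0 ≤ bracket n ^ 2),
      div_pow, div_le_iff₀ (by positivity)]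
    refine t3.trans (le_of_eq ?_)
    field_simp
    ring
  refine (Finset.sum_le_sum fun n _ => hterm n).trans ?_
  rw [← Finset.mul_sum]
  exact mul_le_mul_of_nonneg_left (summable_inv_bracket_pow_three.sum_le_tsum F fun n _ => by
    have := bracket_pos n; positivity) (by positivity)

/-! ### Regularity of the mollified field -/

/-- Translates of a test function depend on the translation in a Lipschitz way in every `C^m`
seminorm, so that a distribution evaluated on them is continuous. -/
lemma continuous_smoothing (ρ : Mollifier) (N : ℕ) (u : TorusDistribution) :
    Continuous (smoothing ρ N u) := by
  obtain ⟨m, C, hC⟩ := u.continuous'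
  set h : TestFunction := ρ.kernel N 0 with hh
  obtain ⟨K, hK0, hK⟩ := exists_iteratedFDeriv_bound h (m + 1)
  have hker : ∀ x, (ρ.kernel N x : ℝ × ℝ → ℝ) = fun y => (h : ℝ × ℝ → ℝ) (y - x) := fun x =>
    funext fun y => kernel_eq_translate ρ N x y
  have key : ∀ x x', |smoothing ρ N u x - smoothing ρ N u x'| ≤ |C| * K * ‖x - x'‖ := by
    intro x x'
    have h1 : smoothing ρ N u x - smoothing ρ N u x' = u (ρ.kernel N x - ρ.kernel N x') :=
      (map_sub u.toLinearMap _ _).symm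
    rw [h1]
    refine (hC _ (K * ‖x - x'‖) fun j hj y => ?_).trans ?_
    · have hd : ∀ x, ContDiff ℝ ∞ (ρ.kernel N x : ℝ × ℝ → ℝ) := fun x => contDiff_coe _
      have e1 : iteratedFDeriv ℝ j ((ρ.kernel N x - ρ.kernel N x' : TestFunction) : ℝ × ℝ → ℝ) y =
          iteratedFDeriv ℝ j (h : ℝ × ℝ → ℝ) (y - x) -
            iteratedFDeriv ℝ j (h : ℝ × ℝ → ℝ) (y - x') := by
        have e2 : ((ρ.kernel N x - ρ.kernel N x' : TestFunction) : ℝ × ℝ → ℝ) =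
          (ρ.kernel N x : ℝ × ℝ → ℝ) - (ρ.kernel N x' : ℝ × ℝ → ℝ) := rfl
        rw [e2, iteratedFDeriv_sub_apply ((hd x).of_le (by exact_mod_cast le_top)).contDiffAt
          ((hd x').of_le (by exact_mod_cast le_top)).contDiffAt, hker x, hker x',
          iteratedFDeriv_comp_sub, iteratedFDeriv_comp_sub]
      rw [e1]
      have hdiff : ∀ z, DifferentiableAt ℝ (iteratedFDeriv ℝ j (h : ℝ × ℝ → ℝ)) z := fun z =>
        (contDiff_coe h).differentiable_iteratedFDeriv (by exact_mod_cast WithTop.coe_lt_top j) z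
      have := convex_univ.norm_image_sub_le_of_norm_fderiv_le (𝕜 := ℝ)
        (f := iteratedFDeriv ℝ j (h : ℝ × ℝ → ℝ)) (C := K) (fun z _ => hdiff z)
        (fun z _ => by rw [norm_fderiv_iteratedFDeriv]; exact hK _ (by omega) z)
        (mem_univ (y - x')) (mem_univ (y - x))
      refine this.trans (le_of_eq ?_)
      rw [sub_sub_sub_cancel_left, norm_sub_rev]
    · rw [mul_assoc]
      exact mul_le_mul_of_nonneg_right (le_abs_self C) (by positivity)
  refine (LipschitzWith.of_dist_le_mul (K := ⟨|C| * K, by positivity⟩) fun x x' => ?_).continuous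
  rw [Real.dist_eq, dist_eq_norm]
  exact key x x'

lemma measurable_smoothing_uncurry (ρ : Mollifier) (N : ℕ) :
    Measurable fun q : TorusDistribution × (ℝ × ℝ) => smoothing ρ N q.1 q.2 := by
  have h := measurable_uncurry_of_continuous_of_measurable
    (u := fun (x : ℝ × ℝ) (u : TorusDistribution) => smoothing ρ N u x)
    (fun u => continuous_smoothing ρ N u) (fun x => measurable_eval _)
  exact h.comp measurable_swap

/-! ### Second moments of the renormalized exponentials -/

/-- The renormalized interaction `λ C_N ∫ exp(β Q_N u) dx`. -/
def interaction (ρ : Mollifier) (lam β : ℝ) (N : ℕ) (u : TorusDistribution) : ℝ :=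
  lam * renormConst ρ β N * ∫ x in cell, Real.exp (β * smoothing ρ N u x)

lemma interaction_nonneg (ρ : Mollifier) {lam : ℝ} (hlam : 0 < lam) (β : ℝ) (N : ℕ)
    (u : TorusDistribution) : 0 ≤ interaction ρ lam β N u :=
  mul_nonneg (mul_nonneg hlam.le (Real.exp_pos _).le)
    (integral_nonneg fun _ => (Real.exp_pos _).le)

lemma measurable_interaction (ρ : Mollifier) (lam β : ℝ) (N : ℕ) :
    Measurable (interaction ρ lam β N) := by
  have h := measurable_smoothing_uncurry ρ N
  have h2 : StronglyMeasurable fun q : TorusDistribution × (ℝ × ℝ) =>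
      Real.exp (β * smoothing ρ N q.1 q.2) := Measurable.stronglyMeasurable (by fun_prop)
  exact (h2.integral_prod_right' (ν := cellMeasure)).measurable.const_mul _

lemma truncatedGibbs_eq_tilted (ρ : Mollifier) (lam β : ℝ) (N : ℕ) :
    truncatedGibbs ρ lam β N = massiveGFF.tilted fun u => -interaction ρ lam β N u := by
  unfold truncatedGibbs interaction
  congr 1
  funext u
  ring

lemma integral_exp_mul_exp (β : ℝ) (φ ψ : TestFunction) :
    ∫ u : TorusDistribution, Real.exp (β * u φ) * Real.exp (β * u ψ) ∂massiveGFF =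
      Real.exp (β ^ 2 / 2 * (cov φ φ + cov ψ ψ + 2 * cov φ ψ)) := by
  rw [← cov_add_self, ← integral_exp_eval]
  refine integral_congr_ae (Eventually.of_forall fun u => ?_)
  have h : u (φ + ψ) = u φ + u ψ := map_add u.toLinearMap φ ψ
  simp only
  rw [← Real.exp_add, h]
  congr 1; ring

lemma integrable_exp_mul_exp (β : ℝ) (φ ψ : TestFunction) :
    Integrable (fun u : TorusDistribution => Real.exp (β * u φ) * Real.exp (β * u ψ))
      massiveGFF := by
  refine (integrable_exp_eval (φ + ψ) β).congr (Eventually.of_forall fun u => ?_)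
  have h : u (φ + ψ) = u φ + u ψ := map_add u.toLinearMap φ ψ
  simp only
  rw [← Real.exp_add, h]
  congr 1; ring

/-- The correlation integral `∫∫ exp(β² E[Q_N u(x) Q_M u(y)]) dx dy`. -/
def correlation (ρ : Mollifier) (β : ℝ) (N M : ℕ) : ℝ :=
  ∫ p, Real.exp (β ^ 2 * mollCov ρ N M p) ∂(cellMeasure.prod cellMeasure)

/-- The renormalization constants cancel the diagonal terms `β² σ_N / 2` and `β² σ_M / 2` of the
Gaussian exponential moment. -/
lemma integrable_and_integral_interaction_mul (ρ : Mollifier) (lam β : ℝ) {N M : ℕ}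
    (hN : 1 ≤ N) (hM : 1 ≤ M) :
    Integrable (fun u => interaction ρ lam β N u * interaction ρ lam β M u) massiveGFF ∧
      ∫ u, interaction ρ lam β N u * interaction ρ lam β M u ∂massiveGFF =
        lam ^ 2 * correlation ρ β N M := by
  set c : ℝ := lam * renormConst ρ β N * (lam * renormConst ρ β M) with hc
  set H : TorusDistribution × ((ℝ × ℝ) × (ℝ × ℝ)) → ℝ := fun q =>
    Real.exp (β * smoothing ρ N q.1 q.2.1) * Real.exp (β * smoothing ρ M q.1 q.2.2) with hH
  have hHm : Measurable H := by
    have h1 : Measurable fun q : TorusDistribution × ((ℝ × ℝ) × (ℝ × ℝ)) =>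
        smoothing ρ N q.1 q.2.1 := (measurable_smoothing_uncurry ρ N).comp
      (measurable_fst.prodMk (measurable_fst.comp measurable_snd))
    have h2 : Measurable fun q : TorusDistribution × ((ℝ × ℝ) × (ℝ × ℝ)) =>
        smoothing ρ M q.1 q.2.2 := (measurable_smoothing_uncurry ρ M).comp
      (measurable_fst.prodMk (measurable_snd.comp measurable_snd))
    fun_prop
  have hHint : ∀ p, ∫ u, H (u, p) ∂massiveGFF =
      Real.exp (β ^ 2 / 2 * (sigma ρ N + sigma ρ M)) * Real.exp (β ^ 2 * mollCov ρ N M p) := by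
    intro p
    simp only [hH, smoothing]
    rw [integral_exp_mul_exp, cov_kernel_self ρ hN, cov_kernel_self ρ hM, ← Real.exp_add, mollCov]
    congr 1; ring
  have hI : Integrable H (massiveGFF.prod (cellMeasure.prod cellMeasure)) := by
    refine (integrable_prod_iff' hHm.aestronglyMeasurable).2
      ⟨Eventually.of_forall fun p =>
        integrable_exp_mul_exp β (ρ.kernel N p.1) (ρ.kernel M p.2), ?_⟩
    have : ∀ u p, ‖H (u, p)‖ = H (u, p) := fun u p =>
      Real.norm_of_nonneg (mul_pos (Real.exp_pos _) (Real.exp_pos _)).le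
    simp_rw [this, hHint]
    have := continuous_mollCov ρ hN hM
    exact integrable_prod_cell (by fun_prop)
  have hprod : ∀ u, interaction ρ lam β N u * interaction ρ lam β M u =
      c * ∫ p, H (u, p) ∂(cellMeasure.prod cellMeasure) := by
    intro u
    simp only [hH]
    rw [integral_prod_mul (f := fun x => Real.exp (β * smoothing ρ N u x))
      (g := fun x => Real.exp (β * smoothing ρ M u x)), hc, interaction, interaction]
    ring
  simp_rw [hprod]
  refine ⟨hI.integral_prod_left.const_mul c, ?_⟩
  rw [integral_const_mul, integral_integral_swap (f := fun u p => H (u, p)) hI]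
  simp_rw [hHint]
  rw [integral_const_mul, correlation, ← mul_assoc, hc, renormConst, renormConst]
  congr 1
  have : lam * Real.exp (-(β ^ 2 / 2) * sigma ρ N) * (lam * Real.exp (-(β ^ 2 / 2) * sigma ρ M)) *
      Real.exp (β ^ 2 / 2 * (sigma ρ N + sigma ρ M)) =
      lam ^ 2 * (Real.exp (-(β ^ 2 / 2) * sigma ρ N) * Real.exp (-(β ^ 2 / 2) * sigma ρ M) *
      Real.exp (β ^ 2 / 2 * (sigma ρ N + sigma ρ M))) := by ring
  rw [this, ← Real.exp_add, ← Real.exp_add]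
  have h0 : -(β ^ 2 / 2) * sigma ρ N + -(β ^ 2 / 2) * sigma ρ M +
      β ^ 2 / 2 * (sigma ρ N + sigma ρ M) = 0 := by ring
  rw [h0, Real.exp_zero, mul_one]

lemma integral_exp_mollCov_le (ρ : Mollifier) {N M : ℕ} (hN : 1 ≤ N) (hM : 1 ≤ M) {c : ℝ}
    (hc0 : 0 < c) (hc : c < 4 * Real.pi) :
    ∫ p, Real.exp (c * mollCov ρ N M p) ∂(cellMeasure.prod cellMeasure) ≤
      ∫ p, expKernel c p ∂(cellMeasure.prod cellMeasure) := by
  have hcont := continuous_mollCov ρ hN hM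
  have h := lintegral_exp_cov_le (k := ρ.kernel N) (l := ρ.kernel M) (kernel_nonneg ρ N)
    (kernel_nonneg ρ M) (continuous_kernel ρ N) (continuous_kernel ρ M) (integral_kernel ρ hN)
    (integral_kernel ρ hM) (integral_kernel_fst ρ hN) (integral_kernel_fst ρ hM) hc0 hc
  rw [← ofReal_integral_eq_lintegral_ofReal (integrable_expKernel hc0 hc)
    (Eventually.of_forall (expKernel_nonneg c)), ← ofReal_integral_eq_lintegral_ofReal] at h
  · exact (ENNReal.ofReal_le_ofReal_iff (integral_nonneg (expKernel_nonneg c))).1 h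
  · exact integrable_prod_cell (f := fun p => Real.exp (c * mollCov ρ N M p)) (by fun_prop)
  · exact Eventually.of_forall fun p => (Real.exp_pos _).le

lemma abs_exp_sub_exp_le {θ : ℝ} (hθ0 : 0 < θ) (hθ1 : θ ≤ 1) (a b : ℝ) :
    |Real.exp a - Real.exp b| ≤ Real.exp a * |a - b| ^ θ + Real.exp b * |a - b| ^ θ := by
  wlog hab : b ≤ a generalizing a b
  · have := this b a (le_of_not_ge hab)
    rw [abs_sub_comm, abs_sub_comm a b]
    linarith
  have hea := Real.exp_pos a
  have heb := Real.exp_pos b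
  rw [abs_of_nonneg (sub_nonneg.2 (Real.exp_le_exp.2 hab)), abs_of_nonneg (sub_nonneg.2 hab)]
  have hp : 0 ≤ (a - b) ^ θ := Real.rpow_nonneg (by linarith) _
  rcases le_total 1 (a - b) with h | h
  · have : 1 ≤ (a - b) ^ θ := Real.one_le_rpow h hθ0.le
    nlinarith
  · have h1 : a - b ≤ (a - b) ^ θ := by
      have := Real.rpow_le_rpow_of_exponent_ge' (sub_nonneg.2 hab) h hθ0.le hθ1
      rwa [Real.rpow_one] at this
    have h2 : Real.exp b = Real.exp a * Real.exp (-(a - b)) := by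
      rw [← Real.exp_add]; congr 1; ring
    have h3 := Real.add_one_le_exp (-(a - b))
    have h4 : Real.exp a - Real.exp b ≤ Real.exp a * (a - b) := by rw [h2]; nlinarith
    nlinarith

lemma memLp_prod_cell {f : (ℝ × ℝ) × (ℝ × ℝ) → ℝ} (hf : Continuous f) (p : ℝ≥0∞) :
    MemLp f p (cellMeasure.prod cellMeasure) := by
  have hK : IsCompact (Icc (-Real.pi) Real.pi ×ˢ Icc (-Real.pi) Real.pi) :=
    isCompact_Icc.prod isCompact_Icc
  obtain ⟨C, hC⟩ := (hK.prod hK).exists_bound_of_continuousOn hf.continuousOn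
  refine MemLp.of_bound hf.aestronglyMeasurable C ?_
  filter_upwards [ae_prod_mem_cell] with q hq
  exact hC q ⟨cell_subset_Icc hq.1, cell_subset_Icc hq.2⟩

/-- The correlation integrals form a Cauchy family. The slack `β² < 4π` is spent on an exponent
`p > 1` in Hölder's inequality. -/
lemma exists_abs_correlation_sub_le (ρ : Mollifier) {β : ℝ} (hβ0 : 0 < β ^ 2)
    (hβ : β ^ 2 < 4 * Real.pi) :
    ∃ R r : ℝ, 0 ≤ R ∧ 0 < r ∧ ∀ N M N' M' : ℕ, 1 ≤ N → 1 ≤ M → 1 ≤ N' → 1 ≤ M' →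
      |correlation ρ β N M - correlation ρ β N' M'| ≤
        R * (1 / N + 1 / M + 1 / N' + 1 / M') ^ r := by
  obtain ⟨p, hp1, hp2, hpβ⟩ : ∃ p : ℝ, 1 < p ∧ p ≤ 2 ∧ p * β ^ 2 < 4 * Real.pi := by
    have ht : 1 < 4 * Real.pi / β ^ 2 := (one_lt_div hβ0).2 hβ
    obtain ⟨p, h1, h2⟩ := exists_between (lt_min ht (by norm_num : (1 : ℝ) < 2))
    exact ⟨p, h1, (h2.trans_le (min_le_right _ _)).le,
      (lt_div_iff₀ hβ0).1 (h2.trans_le (min_le_left _ _))⟩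
  set q := p.conjExponent with hq
  have hpq : p.HolderConjugate q := Real.HolderConjugate.conjExponent hp1
  have hq0 : 0 < q := hpq.symm.pos
  have hq2 : 2 ≤ q := by
    rw [hq, Real.conjExponent, le_div_iff₀ (by linarith)]
    linarith
  set K := ∫ z, expKernel (p * β ^ 2) z ∂(cellMeasure.prod cellMeasure) with hK
  have hK0 : 0 ≤ K := integral_nonneg (expKernel_nonneg _)
  set S := ∑' n : ℤ × ℤ, 1 / bracket n ^ 3 with hS
  have hS0 : 0 ≤ S := tsum_nonneg fun n => by have := bracket_pos n; positivity
  refine ⟨2 * K ^ (1 / p) * ((β ^ 2) ^ 2 * (4 * Real.pi * S)) ^ (1 / q), 1 / q, by positivity,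
    by positivity, fun N M N' M' hN hM hN' hM' => ?_⟩
  set δ : ℝ := 1 / N + 1 / M + 1 / N' + 1 / M' with hδ
  have hδ0 : 0 ≤ δ := by positivity
  have c1 := continuous_mollCov ρ hN hM
  have c2 := continuous_mollCov ρ hN' hM'
  set a : (ℝ × ℝ) × (ℝ × ℝ) → ℝ := fun z => β ^ 2 * mollCov ρ N M z with ha
  set b : (ℝ × ℝ) × (ℝ × ℝ) → ℝ := fun z => β ^ 2 * mollCov ρ N' M' z with hb
  have hac : Continuous a := by fun_prop
  have hbc : Continuous b := by fun_prop
  set g : (ℝ × ℝ) × (ℝ × ℝ) → ℝ := fun z => |a z - b z| ^ (2 / q) with hg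
  have hgc : Continuous g :=
    (hac.sub hbc).abs.rpow_const fun z => Or.inr (by positivity)
  have hgq : ∀ z, g z ^ q = (a z - b z) ^ 2 := fun z => by
    simp only [hg]
    rw [← Real.rpow_mul (abs_nonneg _), div_mul_cancel₀ _ hq0.ne', Real.rpow_two, sq_abs]
  have hgint : ∫ z, g z ^ q ∂(cellMeasure.prod cellMeasure) ≤
      (β ^ 2) ^ 2 * (4 * Real.pi * S) * δ := by
    simp_rw [hgq, ha, hb, ← mul_sub, mul_pow]
    rw [integral_const_mul, mul_assoc]
    refine mul_le_mul_of_nonneg_left ?_ (by positivity)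
    refine (integral_sq_mollCov_sub_le ρ hN hM hN' hM').trans (le_of_eq ?_)
    ring
  have holder : ∀ (L L' : ℕ), 1 ≤ L → 1 ≤ L' →
      ∫ z, Real.exp (β ^ 2 * mollCov ρ L L' z) * g z ∂(cellMeasure.prod cellMeasure) ≤
        K ^ (1 / p) * ((β ^ 2) ^ 2 * (4 * Real.pi * S) * δ) ^ (1 / q) := by
    intro L L' hL hL'
    have c3 := continuous_mollCov ρ hL hL'
    have h := integral_mul_le_Lp_mul_Lq_of_nonneg (μ := cellMeasure.prod cellMeasure) hpq
      (f := fun z => Real.exp (β ^ 2 * mollCov ρ L L' z)) (g := g)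
      (Eventually.of_forall fun z => (Real.exp_pos _).le)
      (Eventually.of_forall fun z => Real.rpow_nonneg (abs_nonneg _) _)
      (memLp_prod_cell (by fun_prop) _) (memLp_prod_cell hgc _)
    refine h.trans (mul_le_mul (Real.rpow_le_rpow (integral_nonneg fun z => by positivity) ?_
      (by positivity)) (Real.rpow_le_rpow (integral_nonneg fun z => ?_) hgint (by positivity))
      (Real.rpow_nonneg (integral_nonneg fun z => ?_) _) (by positivity))
    · refine le_trans (le_of_eq ?_) (integral_exp_mollCov_le ρ hL hL' (c := p * β ^ 2)
        (by positivity) hpβ)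
      refine integral_congr_ae (Eventually.of_forall fun z => ?_)
      simp only
      rw [← Real.exp_mul]
      congr 1; ring
    · rw [hgq]; positivity
    · rw [hgq]; positivity
  have i1 : Integrable (fun z => Real.exp (a z) * g z) (cellMeasure.prod cellMeasure) :=
    integrable_prod_cell (by fun_prop)
  have i2 : Integrable (fun z => Real.exp (b z) * g z) (cellMeasure.prod cellMeasure) :=
    integrable_prod_cell (by fun_prop)
  have j1 : Integrable (fun z => Real.exp (a z)) (cellMeasure.prod cellMeasure) :=
    integrable_prod_cell (by fun_prop)
  have j2 : Integrable (fun z => Real.exp (b z)) (cellMeasure.prod cellMeasure) :=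
    integrable_prod_cell (by fun_prop)
  have hθ : 2 / q ≤ 1 := by rw [div_le_one hq0]; exact hq2
  calc |correlation ρ β N M - correlation ρ β N' M'|
      = |∫ z, (Real.exp (a z) - Real.exp (b z)) ∂(cellMeasure.prod cellMeasure)| := by
        rw [integral_sub j1 j2]; rfl
    _ ≤ ∫ z, |Real.exp (a z) - Real.exp (b z)| ∂(cellMeasure.prod cellMeasure) :=
        abs_integral_le_integral_abs
    _ ≤ ∫ z, (Real.exp (a z) * g z + Real.exp (b z) * g z) ∂(cellMeasure.prod cellMeasure) :=
        integral_mono (j1.sub j2).abs (i1.add i2) fun z =>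
          abs_exp_sub_exp_le (by positivity) hθ (a z) (b z)
    _ ≤ K ^ (1 / p) * ((β ^ 2) ^ 2 * (4 * Real.pi * S) * δ) ^ (1 / q) +
        K ^ (1 / p) * ((β ^ 2) ^ 2 * (4 * Real.pi * S) * δ) ^ (1 / q) := by
        rw [integral_add i1 i2]
        exact add_le_add (holder N M hN hM) (holder N' M' hN' hM')
    _ = _ := by
        rw [Real.mul_rpow (by positivity) hδ0]; ring

lemma integral_sq_interaction_sub (ρ : Mollifier) (lam β : ℝ) {N M : ℕ} (hN : 1 ≤ N)
    (hM : 1 ≤ M) :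
    Integrable (fun u => (interaction ρ lam β N u - interaction ρ lam β M u) ^ 2) massiveGFF ∧
    ∫ u, (interaction ρ lam β N u - interaction ρ lam β M u) ^ 2 ∂massiveGFF =
      lam ^ 2 * ((correlation ρ β N N - correlation ρ β N M) +
        (correlation ρ β M M - correlation ρ β N M)) := by
  obtain ⟨i1, e1⟩ := integrable_and_integral_interaction_mul ρ lam β hN hN
  obtain ⟨i2, e2⟩ := integrable_and_integral_interaction_mul ρ lam β hM hM
  obtain ⟨i3, e3⟩ := integrable_and_integral_interaction_mul ρ lam β hN hM
  have h : ∀ u, (interaction ρ lam β N u - interaction ρ lam β M u) ^ 2 =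
      (interaction ρ lam β N u * interaction ρ lam β N u +
        interaction ρ lam β M u * interaction ρ lam β M u) -
          2 * (interaction ρ lam β N u * interaction ρ lam β M u) := fun u => by ring
  have i12 : Integrable (fun u => interaction ρ lam β N u * interaction ρ lam β N u +
    interaction ρ lam β M u * interaction ρ lam β M u) massiveGFF := i1.add i2
  simp_rw [h]
  refine ⟨i12.sub (i3.const_mul 2), ?_⟩
  rw [integral_sub i12 (i3.const_mul 2), integral_add i1 i2, integral_const_mul, e1, e2, e3]
  ring

lemma integrable_interaction (ρ : Mollifier) (lam β : ℝ) {N : ℕ} (hN : 1 ≤ N) :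
    Integrable (interaction ρ lam β N) massiveGFF := by
  have h := (integrable_and_integral_interaction_mul ρ lam β hN hN).1
  refine ((integrable_const (1 : ℝ)).add h).mono'
    (measurable_interaction ρ lam β N).aestronglyMeasurable (Eventually.of_forall fun u => ?_)
  rw [Real.norm_eq_abs]
  simp only [Pi.add_apply]
  rw [abs_le]
  constructor <;>
    nlinarith [sq_nonneg (interaction ρ lam β N u - 1), sq_nonneg (interaction ρ lam β N u + 1)]

lemma exists_integral_abs_interaction_sub_le (ρ : Mollifier) (lam : ℝ) {β : ℝ}
    (hβ0 : 0 < β ^ 2) (hβ : β ^ 2 < 4 * Real.pi) {ε : ℝ} (hε : 0 < ε) :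
    ∃ K : ℕ, 1 ≤ K ∧ ∀ N M, K ≤ N → K ≤ M →
      ∫ u, |interaction ρ lam β N u - interaction ρ lam β M u| ∂massiveGFF ≤ ε := by
  obtain ⟨R, r, hR, hr, hRr⟩ := exists_abs_correlation_sub_le ρ hβ0 hβ
  have hlim : Tendsto (fun K : ℕ => lam ^ 2 * (2 * (R * (4 * (1 / (K : ℝ))) ^ r))) atTop (𝓝 0) := by
    have h1 : Tendsto (fun K : ℕ => 4 * (1 / (K : ℝ))) atTop (𝓝 (4 * 0)) :=
      tendsto_one_div_atTop_nhds_zero_nat.const_mul 4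
    rw [mul_zero] at h1
    have h2 := h1.rpow_const (p := r) (Or.inr hr.le)
    rw [Real.zero_rpow hr.ne'] at h2
    simpa using ((h2.const_mul R).const_mul 2).const_mul (lam ^ 2)
  obtain ⟨K, hK⟩ := ((hlim.eventually (ge_mem_nhds (by positivity : (0 : ℝ) < ε ^ 2))).and
    (eventually_ge_atTop 1)).exists
  refine ⟨K, hK.2, fun N M hN hM => ?_⟩
  have hK0 : (0 : ℝ) < K := by exact_mod_cast hK.2
  have hN1 : 1 ≤ N := hK.2.trans hN
  have hM1 : 1 ≤ M := hK.2.trans hM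
  obtain ⟨i, e⟩ := integral_sq_interaction_sub ρ lam β hN1 hM1
  have hdiv : ∀ L : ℕ, K ≤ L → 1 / (L : ℝ) ≤ 1 / K := fun L hL =>
    one_div_le_one_div_of_le hK0 (by exact_mod_cast hL)
  have hcorr : ∀ L : ℕ, K ≤ L →
      |correlation ρ β L L - correlation ρ β N M| ≤ R * (4 * (1 / (K : ℝ))) ^ r := by
    intro L hL
    refine (hRr L L N M (hK.2.trans hL) (hK.2.trans hL) hN1 hM1).trans ?_
    refine mul_le_mul_of_nonneg_left (Real.rpow_le_rpow (by positivity) ?_ hr.le) hR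
    linarith [hdiv L hL, hdiv N hN, hdiv M hM]
  have h2 : ∫ u, (interaction ρ lam β N u - interaction ρ lam β M u) ^ 2 ∂massiveGFF ≤ ε ^ 2 := by
    rw [e]
    refine le_trans (mul_le_mul_of_nonneg_left ?_ (sq_nonneg lam)) hK.1
    linarith [le_of_abs_le (hcorr N hN), le_of_abs_le (hcorr M hM)]
  -- `|f| ≤ (ε + f²/ε)/2` turns the bound on the second moment into one on the first.
  have h3 : ∫ u, |interaction ρ lam β N u - interaction ρ lam β M u| ∂massiveGFF ≤
      ∫ u, (ε / 2 + (2 * ε)⁻¹ * (interaction ρ lam β N u - interaction ρ lam β M u) ^ 2)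
        ∂massiveGFF := by
    refine integral_mono ((integrable_interaction ρ lam β hN1).sub
      (integrable_interaction ρ lam β hM1)).abs ((integrable_const _).add (i.const_mul _))
      fun u => ?_
    simp only
    rw [← sq_abs (interaction ρ lam β N u - interaction ρ lam β M u)]
    set t := |interaction ρ lam β N u - interaction ρ lam β M u|
    have : ε / 2 + (2 * ε)⁻¹ * t ^ 2 - t = (2 * ε)⁻¹ * (t - ε) ^ 2 := by
      field_simp; ring
    nlinarith [mul_nonneg (by positivity : 0 ≤ (2 * ε)⁻¹) (sq_nonneg (t - ε))]
  refine h3.trans ?_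
  rw [integral_add (integrable_const _) (i.const_mul _), integral_const, integral_const_mul,
    probReal_univ, one_smul]
  have : (2 * ε)⁻¹ * ε ^ 2 = ε / 2 := by field_simp
  linarith [mul_le_mul_of_nonneg_left h2 (by positivity : 0 ≤ (2 * ε)⁻¹)]

/-! ### Total variation distance of tilted measures -/

lemma integrable_exp_neg {Ω : Type*} [MeasurableSpace Ω] {μ : Measure Ω} [IsFiniteMeasure μ]
    {X : Ω → ℝ} (hX : AEStronglyMeasurable X μ) (hX0 : ∀ a, 0 ≤ X a) :
    Integrable (fun a => Real.exp (-X a)) μ :=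
  (integrable_const (1 : ℝ)).mono' (Real.continuous_exp.comp_aestronglyMeasurable hX.neg)
    (Eventually.of_forall fun a => by
      rw [Real.norm_of_nonneg (Real.exp_pos _).le, Real.exp_le_one_iff]
      linarith [hX0 a])

lemma abs_exp_neg_sub_exp_neg_le {x y : ℝ} (hx : 0 ≤ x) (hy : 0 ≤ y) :
    |Real.exp (-x) - Real.exp (-y)| ≤ |x - y| := by
  wlog h : x ≤ y generalizing x y
  · rw [abs_sub_comm, abs_sub_comm x]
    exact this hy hx (le_of_not_ge h)
  rw [abs_of_nonneg (sub_nonneg.2 (Real.exp_le_exp.2 (by linarith))), abs_sub_comm,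
    abs_of_nonneg (sub_nonneg.2 h)]
  have h1 : Real.exp (-y) = Real.exp (-x) * Real.exp (-(y - x)) := by
    rw [← Real.exp_add]; congr 1; ring
  have h2 := Real.add_one_le_exp (-(y - x))
  have h3 : Real.exp (-x) ≤ 1 := Real.exp_le_one_iff.2 (by linarith)
  have h4 := Real.exp_pos (-x)
  rw [h1]
  nlinarith

lemma tvDist_tilted_neg_le {Ω : Type*} [MeasurableSpace Ω] {μ : Measure Ω}
    [IsProbabilityMeasure μ] {X Y : Ω → ℝ} (hX : Integrable X μ) (hY : Integrable Y μ)
    (hX0 : ∀ a, 0 ≤ X a) (hY0 : ∀ a, 0 ≤ Y a) :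
    tvDist (μ.tilted fun a => -X a) (μ.tilted fun a => -Y a) ≤
      ENNReal.ofReal (2 / (∫ a, Real.exp (-Y a) ∂μ) * ∫ a, |X a - Y a| ∂μ) := by
  have iX := integrable_exp_neg hX.1 hX0
  have iY := integrable_exp_neg hY.1 hY0
  set ZX := ∫ a, Real.exp (-X a) ∂μ with hZX
  set ZY := ∫ a, Real.exp (-Y a) ∂μ with hZY
  have hZX0 : 0 < ZX := integral_exp_pos iX
  have hZY0 : 0 < ZY := integral_exp_pos iY
  set D := ∫ a, |Real.exp (-X a) - Real.exp (-Y a)| ∂μ with hD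
  have hDle : D ≤ ∫ a, |X a - Y a| ∂μ :=
    integral_mono (iX.sub iY).abs (hX.sub hY).abs fun a =>
      abs_exp_neg_sub_exp_neg_le (hX0 a) (hY0 a)
  have hZ : |ZY - ZX| ≤ D := by
    rw [abs_sub_comm, hZX, hZY, ← integral_sub iX iY]
    exact abs_integral_le_integral_abs
  refine iSup₂_le fun A hA => ENNReal.ofReal_le_ofReal ?_
  have hreal : ∀ {W : Ω → ℝ}, (μ.tilted fun a => -W a).real A =
      ∫ a in A, Real.exp (-W a) / ∫ b, Real.exp (-W b) ∂μ ∂μ := by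
    intro W
    rw [measureReal_def, tilted_apply_eq_ofReal_integral' _ hA, ENNReal.toReal_ofReal]
    exact integral_nonneg fun a => div_nonneg (Real.exp_pos _).le
      (integral_nonneg fun _ => (Real.exp_pos _).le)
  have iXY : Integrable (fun a => |Real.exp (-X a) - Real.exp (-Y a)|) μ := (iX.sub iY).abs
  have jX := iX.div_const ZX
  have jY := iY.div_const ZY
  rw [hreal, hreal, ← integral_sub jX.integrableOn jY.integrableOn]
  calc _ ≤ ∫ a in A, |Real.exp (-X a) / ZX - Real.exp (-Y a) / ZY| ∂μ :=
        abs_integral_le_integral_abs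
    _ ≤ ∫ a, |Real.exp (-X a) / ZX - Real.exp (-Y a) / ZY| ∂μ :=
        setIntegral_le_integral (jX.sub jY).abs (Eventually.of_forall fun a => abs_nonneg _)
    _ ≤ ∫ a, (ZY⁻¹ * |Real.exp (-X a) - Real.exp (-Y a)| +
          |ZY - ZX| / (ZX * ZY) * Real.exp (-X a)) ∂μ := by
        refine integral_mono (jX.sub jY).abs ((iXY.const_mul _).add
          (iX.const_mul _)) fun a => ?_
        have h1 : Real.exp (-X a) / ZX - Real.exp (-Y a) / ZY =
            ZY⁻¹ * (Real.exp (-X a) - Real.exp (-Y a)) +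
              (ZY - ZX) / (ZX * ZY) * Real.exp (-X a) := by
          field_simp; ring
        simp only
        rw [h1]
        refine (abs_add_le _ _).trans (le_of_eq ?_)
        rw [abs_mul, abs_mul, abs_div, abs_of_pos (inv_pos.2 hZY0), abs_of_pos (Real.exp_pos _),
          abs_of_pos (mul_pos hZX0 hZY0)]
    _ = ZY⁻¹ * D + |ZY - ZX| / (ZX * ZY) * ZX := by
        rw [integral_add (iXY.const_mul _) (iX.const_mul _), integral_const_mul,
          integral_const_mul]
    _ = ZY⁻¹ * D + ZY⁻¹ * |ZY - ZX| := by
        congr 1; field_simp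
    _ ≤ ZY⁻¹ * D + ZY⁻¹ * D := by gcongr
    _ = 2 / ZY * D := by ring
    _ ≤ _ := by gcongr

/-- Completeness of `L¹`, with the limit chosen nonnegative everywhere. -/
lemma exists_integrable_limit {Ω : Type*} [MeasurableSpace Ω] {μ : Measure Ω} {X : ℕ → Ω → ℝ}
    (hX : ∀ N, Integrable (X N) μ) (hX0 : ∀ N a, 0 ≤ X N a)
    (hcau : ∀ ε > 0, ∃ K, ∀ N M, K ≤ N → K ≤ M → ∫ a, |X N a - X M a| ∂μ ≤ ε) :
    ∃ Y : Ω → ℝ, Integrable Y μ ∧ (∀ a, 0 ≤ Y a) ∧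
      Tendsto (fun N => ∫ a, |X N a - Y a| ∂μ) atTop (𝓝 0) := by
  have hdist : ∀ {f g : Ω → ℝ} (hf : Integrable f μ) (hg : Integrable g μ),
      dist (hf.toL1 f) (hg.toL1 g) = ∫ a, |f a - g a| ∂μ := by
    intro f g hf hg
    rw [dist_eq_norm, ← Integrable.toL1_sub, L1.norm_of_fun_eq_integral_norm]
    rfl
  have hc : CauchySeq fun N => (hX N).toL1 (X N) := by
    refine Metric.cauchySeq_iff.2 fun ε hε => ?_
    obtain ⟨K, hK⟩ := hcau (ε / 2) (by positivity)
    refine ⟨K, fun N hN M hM => ?_⟩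
    rw [hdist]
    linarith [hK N M hN hM]
  obtain ⟨F, hF⟩ := cauchySeq_tendsto_of_complete hc
  have hFi : Integrable F μ := L1.integrable_coeFn F
  refine ⟨fun a => max (F a) 0, hFi.pos_part, fun a => le_max_right _ _, ?_⟩
  have h1 := tendsto_iff_dist_tendsto_zero.1 hF
  refine squeeze_zero (fun N => integral_nonneg fun a => abs_nonneg _) (fun N => ?_) h1
  have h2 : dist ((hX N).toL1 (X N)) F = ∫ a, |X N a - F a| ∂μ := by
    conv_lhs => rw [← Integrable.toL1_coeFn F hFi]
    exact hdist (hX N) hFi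
  rw [h2]
  refine integral_mono ((hX N).sub hFi.pos_part).abs ((hX N).sub hFi).abs fun a => ?_
  have h3 : X N a = max (X N a) 0 := (max_eq_left (hX0 N a)).symm
  simp only
  conv_lhs => rw [h3]
  exact abs_max_sub_max_le_abs _ _ _

end ExpGibbs

end

theorem mainTheorem4 (ρ : ExpGibbs.Mollifier) (lam β : ℝ)
    (hlam : 0 < lam) (hβ_pos : 0 < β ^ 2) (hβ_lt : β ^ 2 < 4 * Real.pi) :
    (∀ N : ℕ, 1 ≤ N → IsProbabilityMeasure (ExpGibbs.truncatedGibbs ρ lam β N)) ∧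
    ∃ ρheat : Measure ExpGibbs.TorusDistribution,
      IsProbabilityMeasure ρheat ∧
      Tendsto (fun N : ℕ => ExpGibbs.tvDist (ExpGibbs.truncatedGibbs ρ lam β N) ρheat)
        atTop (𝓝 0) ∧
      ρheat ≪ ExpGibbs.massiveGFF ∧ ExpGibbs.massiveGFF ≪ ρheat := by
  have hint : ∀ N, Integrable
      (fun u => Real.exp (-ExpGibbs.interaction ρ lam β N u)) ExpGibbs.massiveGFF := fun N =>
    ExpGibbs.integrable_exp_neg (ExpGibbs.measurable_interaction ρ lam β N).aestronglyMeasurable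
      (ExpGibbs.interaction_nonneg ρ hlam β N)
  refine ⟨fun N _ => ?_, ?_⟩
  · rw [ExpGibbs.truncatedGibbs_eq_tilted]
    exact isProbabilityMeasure_tilted (hint N)
  -- Indices are shifted by one, as the second-moment estimates require `N ≥ 1`.
  obtain ⟨Y, hY, hY0, hlim⟩ := ExpGibbs.exists_integrable_limit
    (X := fun N => ExpGibbs.interaction ρ lam β (N + 1))
    (fun N => ExpGibbs.integrable_interaction ρ lam β N.succ_pos)
    (fun N => ExpGibbs.interaction_nonneg ρ hlam β (N + 1)) (fun ε hε => by
      obtain ⟨K, -, hK⟩ := ExpGibbs.exists_integral_abs_interaction_sub_le ρ lam hβ_pos hβ_lt hε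
      exact ⟨K, fun N M hN hM => hK _ _ (by omega) (by omega)⟩)
  have iY := ExpGibbs.integrable_exp_neg hY.1 hY0
  refine ⟨ExpGibbs.massiveGFF.tilted fun u => -Y u, isProbabilityMeasure_tilted iY, ?_,
    tilted_absolutelyContinuous _ _, absolutelyContinuous_tilted iY⟩
  refine (tendsto_add_atTop_iff_nat 1).1 ?_
  have h1 := ENNReal.tendsto_ofReal
    (hlim.const_mul (2 / ∫ u, Real.exp (-Y u) ∂ExpGibbs.massiveGFF))
  rw [mul_zero, ENNReal.ofReal_zero] at h1
  refine tendsto_of_tendsto_of_tendsto_of_le_of_le tendsto_const_nhds h1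
    (fun N => zero_le) fun N => ?_
  simp only
  rw [ExpGibbs.truncatedGibbs_eq_tilted]
  exact ExpGibbs.tvDist_tilted_neg_le (ExpGibbs.integrable_interaction ρ lam β N.succ_pos) hY
    (ExpGibbs.interaction_nonneg ρ hlam β (N + 1)) hY0
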